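/- Fix integers $g\ge 0$ and $n>0$ with $2g-2+n>0$. Let $\Pi_{g,n}$ be the fundamental group of a compact connected oriented surface of genus $g$ with $n$ points removed, i.e. the group generated by $\mu_1,\nu_1,\dots,\mu_g,\nu_g,\beta_1,\dots,\beta_n$ with the single relation $[\mu_1,\nu_1]\cdots[\mu_g,\nu_g]\,\beta_1\cdots\beta_n=e$. For $G=\mathrm{SU}_2$ or $G=\mathrm{SL}_2(\mathbb C)$ let $PG=G/\{\pm I\}$ and let $\mathrm{Hom}(\Pi_{g,n},G)$ be the space of homomorphisms $\Pi_{g,n}\to G$, with the classical topology and the (real, resp. complex) algebraic structure inherited from the embedding $\rho\mapsto(\rho(\mu_1),\rho(\nu_1),\dots,\rho(\beta_n))$ into $V^{2g+n}$, $V=M_{2,2}(\mathbb C)$. The group $PG$ acts on it by conjugation. Let $\mathrm{Rep}(\Pi_{g,n},\mathrm{SU}_2)$ be the topological quotient of $\mathrm{Hom}(\Pi_{g,n},\mathrm{SU}_2)$ by $\mathrm{PSU}_2$, and $\mathrm{Rep}(\Pi_{g,n},\mathrm{SL}_2(\mathbb C))$ the largest Hausdorff quotient of $\mathrm{Hom}(\Pi_{g,n},\mathrm{SL}_2(\mathbb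 C))$ by $\mathrm{PSL}_2(\mathbb C)$ (whose points correspond to the closed orbits). The regular functions on $\mathrm{Rep}$, which define its Zariski topology and the dimension of its loci, are those induced by the $PG$-invariant polynomial functions on $V^{2g+n}$ (real polynomials for $\mathrm{SU}_2$, complex polynomials for $\mathrm{SL}_2(\mathbb C)$). A homomorphism to $\mathrm{SU}_2$ is coaxial if its image lies in a $1$-parameter subgroup $\exp(\mathbb R X)$, $X\in\mathfrak{su}_2$; a homomorphism to $\mathrm{SL}_2(\mathbb C)$ is coaxial if its image in $\mathrm{PSL}_2(\mathbb C)$ lies in a complex $1$-parameter subgroup $\exp(\mathbb C X)$, $X\in\mathfrak{sl}_2(\mathbb C)$. The coaxial locus in $\mathrm{Rep}$ is the image of the coaxial locus of $\mathrm{Hom}$, and the non-coaxial loci in $\mathrm{Hom}$ and $\mathrm{Rep}$ are the complements of the coaxial ones (so the non-coaxial points of $\mathrm{Rep}$ are those that correspond to closed orbits of non-coaxial homomorphisms). Then the following hold for $G=\mathrm{SU}_2$. (i) Every non-coaxial homomorphism has trivial stabilizer in $\mathrm{PSU}_2$. (ii) $\mathrm{Hom}(\Pi_{g,n},\mathrm{SU}_2)$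 is isomorphic, as a real algebraic set and topologically, to $\mathrm{SU}_2^{2g+n-1}$. Inside it, (ii-a) the coaxial locus is irreducible, of dimension $2g+n+1$; (ii-b) the non-coaxial locus, with the structure of a submanifold of $V^{2g+n}$, is an oriented manifold of dimension $6g-3+3n$. Inside $\mathrm{Rep}(\Pi_{g,n},\mathrm{SU}_2)$, (ii-c) the coaxial locus is irreducible, of dimension $2g+n-1$; (ii-d) the non-coaxial locus is an oriented manifold of real dimension $6g-6+3n$, such that the projection to it from its preimage in $\mathrm{Hom}(\Pi_{g,n},\mathrm{SU}_2)$ is a smooth submersion. (iii) In $\mathrm{Hom}(\Pi_{g,n},\mathrm{SU}_2)$ and in $\mathrm{Rep}(\Pi_{g,n},\mathrm{SU}_2)$ the coaxial locus is connected and the non-coaxial locus is dense and connected, in the classical topology. The same statements (i)–(iii) hold for $\mathrm{SL}_2(\mathbb C)$ in place of $\mathrm{SU}_2$ (and $\mathrm{PSL}_2(\mathbb C)$ in place of $\mathrm{PSU}_2$), with complex algebraic sets, complex dimensions and oriented complex manifolds in place of real ones. -/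

import Mathlib

open scoped Manifold ContDiff

noncomputable section

namespace SurfaceRep

/-! ### The surface group and its homomorphism spaces -/

/-- Generators of the surface group: `inl (inl j)` is `μ_j`, `inl (inr j)` is `ν_j`,
`inr i` is `β_i`. -/
abbrev Gen (g n : ℕ) : Type := (Fin g ⊕ Fin g) ⊕ Fin n

/-- The word `[μ_1, ν_1] ⋯ [μ_g, ν_g] β_1 ⋯ β_n`. -/
def surfaceWord (g n : ℕ) : FreeGroup (Gen g n) :=
  (List.ofFn fun j : Fin g =>
    FreeGroup.of (Sum.inl (Sum.inl j) : Gen g n) * FreeGroup.of (Sum.inl (Sum.inr j)) *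
      (FreeGroup.of (Sum.inl (Sum.inl j)))⁻¹ * (FreeGroup.of (Sum.inl (Sum.inr j)))⁻¹).prod *
  (List.ofFn fun i : Fin n => FreeGroup.of (Sum.inr i : Gen g n)).prod

/-- The fundamental group of the surface of genus `g` with `n` punctures, through its
standard presentation. -/
abbrev SurfaceGroup (g n : ℕ) : Type := PresentedGroup ({surfaceWord g n} : Set (FreeGroup (Gen g n)))

/-- The space of homomorphisms from the surface group to `G`. -/
def HomSpace (g n : ℕ) (G : Type) [Group G] : Type := SurfaceGroup g n →* G

section Spaces

variable {g n : ℕ} {G : Type} [Group G]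

/-- The values of a homomorphism on the standard generators. -/
def genValues (ρ : HomSpace g n G) : Gen g n → G :=
  fun s => (show SurfaceGroup g n →* G from ρ) (PresentedGroup.of s)

/-- The classical topology, inherited from the embedding into `G ^ (2g+n)`. -/
instance [TopologicalSpace G] : TopologicalSpace (HomSpace g n G) :=
  TopologicalSpace.induced genValues inferInstance

/-- The conjugation action of `G / Z(G)` on `G`. -/
def conjQuot (G : Type) [Group G] : G ⧸ Subgroup.center G →* MulAut G :=
  QuotientGroup.lift (Subgroup.center G) MulAut.conj (by
    intro x hx
    ext y
    have := Subgroup.mem_center_iff.1 hx y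
    simp [MulAut.conj_apply, ← this])

/-- The conjugation action of `G / Z(G)` (that is, of `PSU₂`, resp. `PSL₂(ℂ)`)
on homomorphisms. -/
instance : MulAction (G ⧸ Subgroup.center G) (HomSpace g n G) where
  smul x ρ := (conjQuot G x).toMonoidHom.comp (show SurfaceGroup g n →* G from ρ)
  one_smul ρ := by
    refine MonoidHom.ext fun γ => ?_
    change conjQuot G 1 _ = _
    simp
  mul_smul x y ρ := by
    refine MonoidHom.ext fun γ => ?_
    change conjQuot G (x * y) _ = conjQuot G x (conjQuot G y _)
    simp

variable (g n G) in
/-- The topological quotient of the homomorphism space by the conjugation action. -/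
abbrev OrbitSpace : Type :=
  Quotient (MulAction.orbitRel (G ⧸ Subgroup.center G) (HomSpace g n G))

end Spaces

/-! ### Algebraic structures

The Zariski structure of a set `X` is recorded by its algebra of regular functions, a subalgebra
of `X → K`. -/

section Algebraic

variable {K : Type} [Field K]

/-- Pull-back of functions. -/
def pullback (K : Type) [Field K] {X Y : Type} (φ : X → Y) : (Y → K) →ₐ[K] (X → K) where
  toFun f := f ∘ φ
  map_one' := rfl
  map_mul' _ _ := rfl
  map_zero' := rfl
  map_add' _ _ := rfl
  commutes' _ := rfl

/-- The Zariski topology: the sets `{f ≠ 0}` with `f` regular form a basis of it. -/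
@[reducible] def zariskiTopology {X : Type} (A : Subalgebra K (X → K)) : TopologicalSpace X :=
  TopologicalSpace.generateFrom {U | ∃ f ∈ A, U = {x | f x ≠ 0}}

/-- Irreducibility of a locus in the Zariski topology. -/
def IsZariskiIrreducible {X : Type} (A : Subalgebra K (X → K)) (S : Set X) : Prop :=
  @IsIrreducible X (zariskiTopology A) S

/-- The dimension of a locus `S`: the Krull dimension of the ring of regular functions
restricted to `S`, that is, of the quotient of `A` by the ideal of `S`. -/
def algDim {X : Type} (A : Subalgebra K (X → K)) (S : Set X) : WithBot ℕ∞ :=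
  ringKrullDim (A.map (pullback K (Subtype.val : S → X)))

/-- Real polynomial functions on the real vector space of families of complex `2 × 2` matrices. -/
def realPoly (σ : Type) : Subalgebra ℝ ((σ → Matrix (Fin 2) (Fin 2) ℂ) → ℝ) :=
  Algebra.adjoin ℝ
    ({f | ∃ s a b, f = fun w => (w s a b).re} ∪ {f | ∃ s a b, f = fun w => (w s a b).im})

/-- Complex polynomial functions on the complex vector space of families of complex `2 × 2`
matrices. -/
def complexPoly (σ : Type) : Subalgebra ℂ ((σ → Matrix (Fin 2) (Fin 2) ℂ) → ℂ) :=
  Algebra.adjoin ℂ {f | ∃ s a b, f = fun w => w s a b}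

variable {G : Type} [Group G]

/-- The functions in `P` that are invariant under simultaneous conjugation by the elements of a
matrix group `j : G →* M₂(ℂ)`. -/
def invariants {σ : Type} (j : G →* Matrix (Fin 2) (Fin 2) ℂ)
    (P : Subalgebra K ((σ → Matrix (Fin 2) (Fin 2) ℂ) → K)) :
    Subalgebra K ((σ → Matrix (Fin 2) (Fin 2) ℂ) → K) where
  carrier := {f | f ∈ P ∧ ∀ (x : G) (w : σ → Matrix (Fin 2) (Fin 2) ℂ),
    f (fun s => j x * w s * j x⁻¹) = f w}
  mul_mem' hf hf' :=
    ⟨P.mul_mem hf.1 hf'.1, fun x w => congrArg₂ (· * ·) (hf.2 x w) (hf'.2 x w)⟩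
  add_mem' hf hf' :=
    ⟨P.add_mem hf.1 hf'.1, fun x w => congrArg₂ (· + ·) (hf.2 x w) (hf'.2 x w)⟩
  algebraMap_mem' r := ⟨P.algebraMap_mem r, fun _ _ => rfl⟩

/-- The embedding `λ` of the homomorphism space into `M₂(ℂ) ^ (2g+n)`. -/
def lam {g n : ℕ} (j : G →* Matrix (Fin 2) (Fin 2) ℂ) (ρ : HomSpace g n G) :
    Gen g n → Matrix (Fin 2) (Fin 2) ℂ :=
  fun s => j (genValues ρ s)

/-- Regular functions on the homomorphism space: restrictions of polynomial functions. -/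
def regHom {g n : ℕ} (j : G →* Matrix (Fin 2) (Fin 2) ℂ)
    (P : Subalgebra K ((Gen g n → Matrix (Fin 2) (Fin 2) ℂ) → K)) :
    Subalgebra K (HomSpace g n G → K) :=
  P.map (pullback K (lam j))

/-- Regular functions on a quotient `π : Hom → R` of the homomorphism space: those induced by
invariant polynomial functions. -/
def regRep {g n : ℕ} {R : Type} (j : G →* Matrix (Fin 2) (Fin 2) ℂ)
    (P : Subalgebra K ((Gen g n → Matrix (Fin 2) (Fin 2) ℂ) → K)) (π : HomSpace g n G → R) :
    Subalgebra K (R → K) :=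
  (regHom j (invariants j P)).comap (pullback K π)

/-- Regular functions on the power `G ^ σ` of a matrix group. -/
def regPow {σ : Type} (j : G →* Matrix (Fin 2) (Fin 2) ℂ)
    (P : Subalgebra K ((σ → Matrix (Fin 2) (Fin 2) ℂ) → K)) : Subalgebra K ((σ → G) → K) :=
  P.map (pullback K fun (x : σ → G) (s : σ) => j (x s))

end Algebraic

/-! ### Manifolds -/

section Manifolds

/-- The charts of the atlas have orientation-preserving transition functions. -/
def IsOrientedAtlas (E M : Type) [NormedAddCommGroup E] [NormedSpace ℝ E] [TopologicalSpace M]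
    [ChartedSpace E M] : Prop :=
  ∀ e ∈ atlas E M, ∀ e' ∈ atlas E M, ∀ x ∈ (e.symm.trans e').source,
    0 < (fderiv ℝ (e.symm.trans e') x).det

/-- `M`, with the given atlas, is an oriented manifold modelled on `E`: Hausdorff, second
countable, smooth over `𝕜` (so a complex manifold if `𝕜 = ℂ`), with an oriented atlas. -/
structure IsOrientedManifold (𝕜 E M : Type) [NontriviallyNormedField 𝕜] [NormedAddCommGroup E]
    [NormedSpace 𝕜 E] [NormedSpace ℝ E] [TopologicalSpace M] [ChartedSpace E M] : Prop where
  t2 : T2Space M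
  secondCountable : SecondCountableTopology M
  smooth : IsManifold 𝓘(𝕜, E) ∞ M
  oriented : IsOrientedAtlas E M

/-- Smooth map with injective differentials into a normed space. -/
def IsSmoothImmersion (𝕜 E : Type) {M W : Type} [NontriviallyNormedField 𝕜]
    [NormedAddCommGroup E] [NormedSpace 𝕜 E] [NormedAddCommGroup W] [NormedSpace 𝕜 W]
    [TopologicalSpace M] [ChartedSpace E M] (f : M → W) : Prop :=
  ContMDiff 𝓘(𝕜, E) 𝓘(𝕜, W) ∞ f ∧
    ∀ x, Function.Injective (mfderiv 𝓘(𝕜, E) 𝓘(𝕜, W) f x)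

/-- Smooth map with surjective differentials. -/
def IsSmoothSubmersion (𝕜 E E' : Type) {M N : Type} [NontriviallyNormedField 𝕜]
    [NormedAddCommGroup E] [NormedSpace 𝕜 E] [NormedAddCommGroup E'] [NormedSpace 𝕜 E']
    [TopologicalSpace M] [ChartedSpace E M] [TopologicalSpace N] [ChartedSpace E' N]
    (f : M → N) : Prop :=
  ContMDiff 𝓘(𝕜, E) 𝓘(𝕜, E') ∞ f ∧
    ∀ x, Function.Surjective (mfderiv 𝓘(𝕜, E) 𝓘(𝕜, E') f x)

variable {g n : ℕ} {G : Type} [Group G] [TopologicalSpace G]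

/-- `lam` with the matrix entries as coordinates, restricted to a locus. -/
def lamEntries (j : G →* Matrix (Fin 2) (Fin 2) ℂ) (S : Set (HomSpace g n G)) :
    S → (Gen g n → Fin 2 → Fin 2 → ℂ) :=
  fun ρ s a b => lam j ρ.1 s a b

/-- The locus `S` of the homomorphism space is an oriented `d`-dimensional manifold over `𝕜`,
with the structure of a submanifold of `M₂(ℂ) ^ (2g+n)`. -/
def IsOrientedSubmanifold (𝕜 : Type) [RCLike 𝕜] [NormedSpace 𝕜 ℂ]
    (j : G →* Matrix (Fin 2) (Fin 2) ℂ) (d : ℕ)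
    [NormedSpace ℝ (EuclideanSpace 𝕜 (Fin d))] (S : Set (HomSpace g n G)) : Prop :=
  ∃ _ : ChartedSpace (EuclideanSpace 𝕜 (Fin d)) S,
    IsOrientedManifold 𝕜 (EuclideanSpace 𝕜 (Fin d)) S ∧
    IsSmoothImmersion 𝕜 (EuclideanSpace 𝕜 (Fin d)) (lamEntries j S)

/-- The locus `T` of the quotient `π : Hom → R` is an oriented `d`-dimensional manifold over `𝕜`,
with the structure of a quotient manifold: its preimage in the homomorphism space is a
`D`-dimensional submanifold of `M₂(ℂ) ^ (2g+n)`, which `π` maps to `T` by a submersion. -/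
def IsOrientedQuotientManifold (𝕜 : Type) [RCLike 𝕜] [NormedSpace 𝕜 ℂ]
    (j : G →* Matrix (Fin 2) (Fin 2) ℂ) (D d : ℕ)
    [NormedSpace ℝ (EuclideanSpace 𝕜 (Fin D))] [NormedSpace ℝ (EuclideanSpace 𝕜 (Fin d))]
    {R : Type} [TopologicalSpace R] (π : HomSpace g n G → R) (T : Set R) : Prop :=
  ∃ (_ : ChartedSpace (EuclideanSpace 𝕜 (Fin D)) (π ⁻¹' T))
    (_ : ChartedSpace (EuclideanSpace 𝕜 (Fin d)) T),
    IsOrientedManifold 𝕜 (EuclideanSpace 𝕜 (Fin D)) (π ⁻¹' T) ∧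
    IsSmoothImmersion 𝕜 (EuclideanSpace 𝕜 (Fin D)) (lamEntries j (π ⁻¹' T)) ∧
    IsOrientedManifold 𝕜 (EuclideanSpace 𝕜 (Fin d)) T ∧
    IsSmoothSubmersion 𝕜 (EuclideanSpace 𝕜 (Fin D)) (EuclideanSpace 𝕜 (Fin d))
      (T.restrictPreimage π)

end Manifolds

/-! ### The groups `SU₂` and `SL₂(ℂ)` -/

abbrev SU2 : Type := Matrix.specialUnitaryGroup (Fin 2) ℂ

abbrev SL2 : Type := Matrix.SpecialLinearGroup (Fin 2) ℂ

/-- The inclusion of `SU₂` in the complex matrices. -/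
def matSU2 : SU2 →* Matrix (Fin 2) (Fin 2) ℂ := (Matrix.specialUnitaryGroup (Fin 2) ℂ).subtype

/-- The inclusion of `SL₂(ℂ)` in the complex matrices. -/
def matSL2 : SL2 →* Matrix (Fin 2) (Fin 2) ℂ where
  toFun x := x.1
  map_one' := rfl
  map_mul' _ _ := rfl

variable (g n : ℕ)

/-- Homomorphisms whose image is contained in a one-parameter subgroup
`{exp (tX) : t ∈ ℝ}`, `X ∈ su₂`, of `SU₂`. -/
def coaxialSU2 : Set (HomSpace g n SU2) :=
  {ρ | ∃ X : Matrix (Fin 2) (Fin 2) ℂ, X.conjTranspose = -X ∧ X.trace = 0 ∧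
    ∀ γ : SurfaceGroup g n, ∃ t : ℝ,
      matSU2 ((show SurfaceGroup g n →* SU2 from ρ) γ) = NormedSpace.exp (t • X)}

/-- Homomorphisms whose composition with `SL₂(ℂ) → PSL₂(ℂ)` has image contained in a (complex)
one-parameter subgroup `{[exp (zX)] : z ∈ ℂ}`, `X ∈ sl₂(ℂ)`, of `PSL₂(ℂ)`. -/
def coaxialSL2 : Set (HomSpace g n SL2) :=
  {ρ | ∃ X : Matrix (Fin 2) (Fin 2) ℂ, X.trace = 0 ∧
    ∀ γ : SurfaceGroup g n, ∃ (z : ℂ) (h : SL2), matSL2 h = NormedSpace.exp (z • X) ∧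
      ((show SurfaceGroup g n →* SL2 from ρ) γ : SL2 ⧸ Subgroup.center SL2) = h}

/-- The representation space of `SU₂`: the topological quotient by `PSU₂`. -/
abbrev RepSU2 : Type := OrbitSpace g n SU2

/-- The representation space of `SL₂(ℂ)`: the largest Hausdorff quotient of the topological
quotient by `PSL₂(ℂ)`. -/
abbrev RepSL2 : Type := T2Quotient (OrbitSpace g n SL2)

/-- The projection `Hom → Rep` for `SU₂`. -/
def projSU2 (ρ : HomSpace g n SU2) : RepSU2 g n := Quotient.mk _ ρ

/-- The projection `Hom → Rep` for `SL₂(ℂ)`. -/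
def projSL2 (ρ : HomSpace g n SL2) : RepSL2 g n := T2Quotient.mk (Quotient.mk _ ρ)

/-- The coaxial locus in the representation space; the non-coaxial locus is its complement. -/
def repCoaxialSU2 : Set (RepSU2 g n) := projSU2 g n '' coaxialSU2 g n

/-- The coaxial locus in the representation space; the non-coaxial locus is its complement
(the points of which correspond to the closed orbits of non-coaxial homomorphisms). -/
def repCoaxialSL2 : Set (RepSL2 g n) := projSL2 g n '' coaxialSL2 g n

/-- Real regular functions on the `SU₂`-homomorphism space. -/
abbrev regHomSU2 : Subalgebra ℝ (HomSpace g n SU2 → ℝ) := regHom matSU2 (realPoly (Gen g n))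

/-- Real regular functions on the `SU₂`-representation space. -/
abbrev regRepSU2 : Subalgebra ℝ (RepSU2 g n → ℝ) :=
  regRep matSU2 (realPoly (Gen g n)) (projSU2 g n)

/-- Complex regular functions on the `SL₂(ℂ)`-homomorphism space. -/
abbrev regHomSL2 : Subalgebra ℂ (HomSpace g n SL2 → ℂ) := regHom matSL2 (complexPoly (Gen g n))

/-- Complex regular functions on the `SL₂(ℂ)`-representation space. -/
abbrev regRepSL2 : Subalgebra ℂ (RepSL2 g n → ℂ) :=
  regRep matSL2 (complexPoly (Gen g n)) (projSL2 g n)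

end SurfaceRep

end

open Matrix
noncomputable section
namespace SurfaceRep

/-! ### Rotations of three-space -/

section Rotations

variable {K : Type} [Field K]

/-! Both groups are groups of unit quaternions `a + p` with `a² + p·p = 1`, over `K = ℝ` for SU₂ and
over `K = ℂ` for SL₂(ℂ). The argument is carried out once over `K`, with `QuatModel` for the group
and `IsSpinField` for the few properties of the field. Conjugation fixes real parts and rotates
imaginary parts, and every matrix in SO₃(K) arises in this way (`exists_rot`). Two tuples of vectors
with the same inner and triple products are therefore conjugate as soon as they contain a
nondegenerate pair (`exists_rot_of_gram_eq`). As `n > 0`, the relation can be solved for the last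
puncture generator, so Hom is `G^M` with `M = 2g + n - 1 ≥ 2` (`exists_coordinates`).

Coaxial means commutative image, that is, pairwise parallel imaginary parts. In stereographic
coordinates such tuples have the form `l_k n`, and moving `l` and `n` on lines joins any two of them
by a polynomial curve, whence irreducibility (`isZariskiIrreducible_commuting`). The dimension is
`M` for the real parts plus 2 for the axis; in the quotient the axis is lost. A generic coaxial
tuple is conjugate into a fixed torus, which gives connectedness and lets invariant functions be
studied on the torus. An element commuting with a non-coaxial tuple has imaginary part parallel to
two independent directions, so it is central: this is the triviality of stabilizers.

The non-coaxial points of Rep come from the tuples in `irreducible`, which contain a nondegenerate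
pair or three independent vectors. Their orbits are separated by real parts, inner products and
triple products (`exists_conj_of_invMap_eq`). Over ℂ any other tuple can be conjugated towards a
commuting one (`exists_tendsto_commuting`), so a Hausdorff quotient identifies the two. A generic
tuple is conjugate to one that begins with a pair in standard position; such tuples form a connected
dense set (`conjStandard`).

The manifold structure on Hom comes from stereographic charts, whose transitions are inversions
composed with the antipodal map and preserve orientation. Charts of the quotient are the `3(M - 1)`
rotation invariants `frameInv` of the stereographic vectors, after a linear mixing of the vectors
that puts a nondegenerate pair first. Over ℂ these are automatically oriented. Over ℝ the orbit
directions carry a form, equivariant under rotations and unchanged by the chart transitions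
(`orientForm`); completing the differential of `frameInv` by it gives a determinant, the sign of
which selects an oriented atlas (`orientingSets_real`). -/

theorem cross_apply_zero (v w : Fin 3 → K) : (v ⨯₃ w) 0 = v 1 * w 2 - v 2 * w 1 := rfl
theorem cross_apply_one (v w : Fin 3 → K) : (v ⨯₃ w) 1 = v 2 * w 0 - v 0 * w 2 := rfl
theorem cross_apply_two (v w : Fin 3 → K) : (v ⨯₃ w) 2 = v 0 * w 1 - v 1 * w 0 := rfl

theorem vec3_ext {v w : Fin 3 → K} (h0 : v 0 = w 0) (h1 : v 1 = w 1) (h2 : v 2 = w 2) : v = w := by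
  ext i; fin_cases i <;> assumption

/-- The rotation of `K³` given by conjugation with the quaternion `a + p` of norm one. -/
def rot (a : K) (p : Fin 3 → K) : (Fin 3 → K) →ₗ[K] (Fin 3 → K) where
  toFun R := (a ^ 2 - p ⬝ᵥ p) • R + (2 * (p ⬝ᵥ R)) • p + (2 * a) • (p ⨯₃ R)
  map_add' R S := by
    apply vec3_ext <;> simp only [vec3_dotProduct, cross_apply_zero, cross_apply_one, cross_apply_two, Pi.add_apply, Pi.smul_apply, smul_eq_mul, RingHom.id_apply] <;> ring
  map_smul' c R := by
    apply vec3_ext <;> simp only [vec3_dotProduct, cross_apply_zero, cross_apply_one, cross_apply_two, Pi.add_apply, Pi.smul_apply, smul_eq_mul, RingHom.id_apply] <;> ring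

theorem rot_apply (a : K) (p R : Fin 3 → K) :
    rot a p R = (a ^ 2 - p ⬝ᵥ p) • R + (2 * (p ⬝ᵥ R)) • p + (2 * a) • (p ⨯₃ R) := rfl

/-- For an arbitrary quaternion `a + p` the two sides differ by the factor `(a² + p·p)²`; for cross
products the factor is `a² + p·p`. -/
theorem rot_dot {a : K} {p : Fin 3 → K} (h : a ^ 2 + p ⬝ᵥ p = 1) (R S : Fin 3 → K) :
    rot a p R ⬝ᵥ rot a p S = R ⬝ᵥ S := by
  have h2 : (a ^ 2 + p ⬝ᵥ p) ^ 2 = 1 := by rw [h, one_pow]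
  have : rot a p R ⬝ᵥ rot a p S = (a ^ 2 + p ⬝ᵥ p) ^ 2 * (R ⬝ᵥ S) := by
    simp only [rot_apply, vec3_dotProduct, cross_apply_zero, cross_apply_one, cross_apply_two, Pi.add_apply, Pi.smul_apply, smul_eq_mul]; ring
  rw [this, h2, one_mul]

theorem rot_cross {a : K} {p : Fin 3 → K} (h : a ^ 2 + p ⬝ᵥ p = 1) (R S : Fin 3 → K) :
    rot a p R ⨯₃ rot a p S = rot a p (R ⨯₃ S) := by
  have : rot a p R ⨯₃ rot a p S = (a ^ 2 + p ⬝ᵥ p) • rot a p (R ⨯₃ S) := by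
    apply vec3_ext <;> simp only [rot_apply, vec3_dotProduct, cross_apply_zero, cross_apply_one, cross_apply_two, Pi.add_apply, Pi.smul_apply, smul_eq_mul] <;> ring
  rw [this, h, one_smul]

theorem rot_comp (a b : K) (p q R : Fin 3 → K) :
    rot a p (rot b q R) = rot (a * b - p ⬝ᵥ q) (a • q + b • p + p ⨯₃ q) R := by
  apply vec3_ext <;> simp only [rot_apply, vec3_dotProduct, cross_apply_zero, cross_apply_one, cross_apply_two, Pi.add_apply, Pi.smul_apply, smul_eq_mul] <;> ring

theorem norm_mul {a b : K} {p q : Fin 3 → K} (hp : a ^ 2 + p ⬝ᵥ p = 1) (hq : b ^ 2 + q ⬝ᵥ q = 1) :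
    (a * b - p ⬝ᵥ q) ^ 2 + (a • q + b • p + p ⨯₃ q) ⬝ᵥ (a • q + b • p + p ⨯₃ q) = 1 := by
  have : (a * b - p ⬝ᵥ q) ^ 2 + (a • q + b • p + p ⨯₃ q) ⬝ᵥ (a • q + b • p + p ⨯₃ q) =
      (a ^ 2 + p ⬝ᵥ p) * (b ^ 2 + q ⬝ᵥ q) := by
    simp only [vec3_dotProduct, cross_apply_zero, cross_apply_one, cross_apply_two, Pi.add_apply, Pi.smul_apply, smul_eq_mul]; ring
  rw [this, hp, hq, one_mul]

theorem rot_div {s : K} (hs : s ≠ 0) (a : K) (p R : Fin 3 → K) :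
    rot (a / s) (fun k => p k / s) R = (s ^ 2)⁻¹ • rot a p R := by
  apply vec3_ext <;>
    simp only [rot_apply, vec3_dotProduct, cross_apply_zero, cross_apply_one, cross_apply_two,
      Pi.add_apply, Pi.smul_apply, smul_eq_mul] <;>
    field_simp

/-- A rotation matrix with `1 + tr M ≠ 0` is conjugation by an explicit quaternion. -/
theorem exists_rot_of_trace_ne (hs : ∀ (a : K) (p : Fin 3 → K), ∃ s, s ^ 2 = a ^ 2 + p ⬝ᵥ p)
    (h2 : (2 : K) ≠ 0) (M : Matrix (Fin 3) (Fin 3) K) (hM : M * Mᵀ = 1) (hdet : M.det = 1)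
    (htr : 1 + M.trace ≠ 0) :
    ∃ a p, a ^ 2 + p ⬝ᵥ p = 1 ∧ ∀ R, M *ᵥ R = rot a p R := by
  have hM' : Mᵀ * M = 1 := mul_eq_one_comm.1 hM
  have hadj : M.adjugate = Mᵀ := by
    calc M.adjugate = M.adjugate * (M * Mᵀ) := by rw [hM, mul_one]
      _ = Mᵀ := by rw [← mul_assoc, adjugate_mul, hdet, one_smul, one_mul]
  rw [adjugate_fin_three] at hadj
  obtain ⟨a, b, c, d, e, f, g, h, i, rfl⟩ : ∃ a b c d e f g h i, M = !![a, b, c; d, e, f; g, h, i] :=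
    ⟨_, _, _, _, _, _, _, _, _, eta_fin_three M⟩
  have e1 := fun i j => congrFun (congrFun hadj i) j
  have e2 := fun i j => congrFun (congrFun hM i) j
  have e3 := fun i j => congrFun (congrFun hM' i) j
  simp only [Fin.forall_fin_succ, Fin.isValue, Matrix.mul_apply, Fin.sum_univ_three] at e1 e2 e3
  simp at e1 e2 e3
  simp [trace_fin_three] at htr
  -- For `M = rot a p` one has `1 + tr M = 4a²`, and the antisymmetric part of `M` yields the vector
  -- `4a p`. Together they are `4a (a, p)`, a multiple of the quaternion sought, which remains to be
  -- normalised by `s`.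
  obtain ⟨s, hs⟩ := hs (1 + (a + e + i)) ![h - f, c - g, d - b]
  have hN : s ^ 2 = 4 * (1 + (a + e + i)) := by
    rw [hs]; simp [dotProduct, Fin.sum_univ_three]; grind
  have hs0 : s ≠ 0 := by
    rintro rfl
    have h4 : (4 : K) ≠ 0 := by
      have := mul_ne_zero h2 h2; norm_num at this ⊢; exact this
    exact mul_ne_zero h4 htr (by rw [← hN]; ring)
  refine ⟨(1 + (a + e + i)) / s, fun k => ![h - f, c - g, d - b] k / s, ?_, fun R => ?_⟩
  · rw [dotProduct] at *
    simp only [Fin.sum_univ_three] at *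
    field_simp
    rw [hs]; ring
  · have key : s ^ 2 • (!![a, b, c; d, e, f; g, h, i] *ᵥ R) =
        rot (1 + (a + e + i)) ![h - f, c - g, d - b] R := by
      rw [hN]
      obtain ⟨x, y, z, rfl⟩ : ∃ x y z, R = ![x, y, z] := ⟨R 0, R 1, R 2, vec3_ext rfl rfl rfl⟩
      clear hM hM' hadj hdet hs hN hs0
      apply vec3_ext <;>
        simp [rot_apply, vec3_dotProduct, cross_apply_zero, cross_apply_one, cross_apply_two,
          mulVec] <;> grind
    rw [rot_div hs0, ← key, smul_smul, inv_mul_cancel₀ (pow_ne_zero 2 hs0), one_smul]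

/-- Every rotation matrix is conjugation by a quaternion of norm one. -/
theorem exists_rot (hs : ∀ (a : K) (p : Fin 3 → K), ∃ s, s ^ 2 = a ^ 2 + p ⬝ᵥ p)
    (h2 : (2 : K) ≠ 0) (M : Matrix (Fin 3) (Fin 3) K) (hM : M * Mᵀ = 1) (hdet : M.det = 1) :
    ∃ a p, a ^ 2 + p ⬝ᵥ p = 1 ∧ ∀ R, M *ᵥ R = rot a p R := by
  by_cases h0 : 1 + M.trace ≠ 0
  · exact exists_rot_of_trace_ne hs h2 M hM hdet h0
  -- If `1 + tr M = 0`, then `M` is first multiplied by a half-turn `diagonal d` about a coordinate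
  -- axis. The half-turn is an involution and is itself conjugation by a unit quaternion.
  have key : ∀ d q : Fin 3 → K, d 0 * d 0 = 1 → d 1 * d 1 = 1 → d 2 * d 2 = 1 →
      d 0 * d 1 * d 2 = 1 → q ⬝ᵥ q = 1 → (∀ R, rot 0 (-q) R = diagonal d *ᵥ R) →
      1 + (M * diagonal d).trace ≠ 0 →
      ∃ a p, a ^ 2 + p ⬝ᵥ p = 1 ∧ ∀ R, M *ᵥ R = rot a p R := by
    intro d q d0 d1 d2 d3 hq hrot htr
    have hd : diagonal d * diagonal d = 1 := by
      rw [diagonal_mul_diagonal, ← diagonal_one]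
      congr 1; ext i; fin_cases i <;> simpa
    obtain ⟨a, p, h, hR⟩ := exists_rot_of_trace_ne hs h2 (M * diagonal d)
      (by rw [transpose_mul, diagonal_transpose, ← mul_assoc, mul_assoc M, hd, mul_one, hM])
      (by rw [det_mul, hdet, det_diagonal, Fin.prod_univ_three, d3, one_mul]) htr
    refine ⟨_, _, norm_mul h (b := 0) (q := -q) (by simpa using hq), fun R => ?_⟩
    rw [← rot_comp, hrot, ← hR, mulVec_mulVec, mul_assoc, hd, mul_one]
  push Not at h0
  rw [trace_fin_three] at h0
  by_cases h1 : 1 + M 0 0 - M 1 1 - M 2 2 ≠ 0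
  · refine key ![1, -1, -1] ![1, 0, 0] (by simp) (by simp) (by simp) (by simp)
      (by simp [dotProduct, Fin.sum_univ_three]) (fun R => ?_) ?_
    · obtain ⟨x, y, z, rfl⟩ : ∃ x y z, R = ![x, y, z] := ⟨R 0, R 1, R 2, vec3_ext rfl rfl rfl⟩
      apply vec3_ext <;>
        simp [rot_apply, vec3_dotProduct, cross_apply_zero, cross_apply_one, cross_apply_two,
          mulVec_diagonal, two_mul]
    · rw [trace_fin_three]; simpa [← sub_eq_add_neg, add_sub_assoc] using h1
  by_cases h3 : 1 - M 0 0 + M 1 1 - M 2 2 ≠ 0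
  · refine key ![-1, 1, -1] ![0, 1, 0] (by simp) (by simp) (by simp) (by simp)
      (by simp [dotProduct, Fin.sum_univ_three]) (fun R => ?_) ?_
    · obtain ⟨x, y, z, rfl⟩ : ∃ x y z, R = ![x, y, z] := ⟨R 0, R 1, R 2, vec3_ext rfl rfl rfl⟩
      apply vec3_ext <;>
        simp [rot_apply, vec3_dotProduct, cross_apply_zero, cross_apply_one, cross_apply_two,
          mulVec_diagonal, two_mul]
    · rw [trace_fin_three]; simp; convert h3 using 1; ring
  by_cases h4 : 1 - M 0 0 - M 1 1 + M 2 2 ≠ 0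
  · refine key ![-1, -1, 1] ![0, 0, 1] (by simp) (by simp) (by simp) (by simp)
      (by simp [dotProduct, Fin.sum_univ_three]) (fun R => ?_) ?_
    · obtain ⟨x, y, z, rfl⟩ : ∃ x y z, R = ![x, y, z] := ⟨R 0, R 1, R 2, vec3_ext rfl rfl rfl⟩
      apply vec3_ext <;>
        simp [rot_apply, vec3_dotProduct, cross_apply_zero, cross_apply_one, cross_apply_two,
          mulVec_diagonal, two_mul]
    · rw [trace_fin_three]; simp; convert h4 using 1; ring
  -- The four numbers that would all vanish have sum 4.
  push Not at h1 h3 h4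
  exact absurd (show (2 : K) * 2 = 0 by linear_combination h0 + h1 + h3 + h4) (mul_ne_zero h2 h2)

/-- Two frames `P, Q, P × Q` with the same Gram matrix differ by a rotation. -/
theorem exists_rot_of_gram_eq (hs : ∀ (a : K) (p : Fin 3 → K), ∃ s, s ^ 2 = a ^ 2 + p ⬝ᵥ p)
    (h2 : (2 : K) ≠ 0) {P Q P' Q' : Fin 3 → K} (h11 : P ⬝ᵥ P = P' ⬝ᵥ P')
    (h12 : P ⬝ᵥ Q = P' ⬝ᵥ Q') (h22 : Q ⬝ᵥ Q = Q' ⬝ᵥ Q') (hD : (P ⨯₃ Q) ⬝ᵥ (P ⨯₃ Q) ≠ 0) :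
    ∃ a p, a ^ 2 + p ⬝ᵥ p = 1 ∧ ∀ R R', R ⬝ᵥ P = R' ⬝ᵥ P' → R ⬝ᵥ Q = R' ⬝ᵥ Q' →
      R ⬝ᵥ (P ⨯₃ Q) = R' ⬝ᵥ (P' ⨯₃ Q') → R' = rot a p R := by
  have hdet : ∀ P Q : Fin 3 → K, (Matrix.of ![P, Q, P ⨯₃ Q]).det = (P ⨯₃ Q) ⬝ᵥ (P ⨯₃ Q) := by
    intro P Q
    rw [← triple_product_permutation, ← triple_product_permutation, triple_product_eq_det]; rfl
  have hDD : (P ⨯₃ Q) ⬝ᵥ (P ⨯₃ Q) = (P' ⨯₃ Q') ⬝ᵥ (P' ⨯₃ Q') := by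
    rw [cross_dot_cross, cross_dot_cross, dotProduct_comm Q P, dotProduct_comm Q' P', h11, h12, h22]
  set A := Matrix.of ![P, Q, P ⨯₃ Q] with hA
  set B := Matrix.of ![P', Q', P' ⨯₃ Q'] with hB
  have hAdet : A.det ≠ 0 := by rw [hdet]; exact hD
  have hBdet : IsUnit B.det := by rw [hdet, ← hDD]; exact hD.isUnit
  have hgram : A * Aᵀ = B * Bᵀ := by
    have hm : ∀ (M : Matrix (Fin 3) (Fin 3) K) i j, (M * Mᵀ) i j = M i ⬝ᵥ M j := fun _ _ _ => rfl
    ext i j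
    rw [hm, hm]
    change ![P, Q, P ⨯₃ Q] i ⬝ᵥ ![P, Q, P ⨯₃ Q] j =
      ![P', Q', P' ⨯₃ Q'] i ⬝ᵥ ![P', Q', P' ⨯₃ Q'] j
    fin_cases i <;> fin_cases j <;>
      simp [h11, h12, h22, hDD, dotProduct_comm Q P, dotProduct_comm Q' P',
        dotProduct_comm (P ⨯₃ Q) P, dotProduct_comm (P' ⨯₃ Q') P',
        dotProduct_comm (P ⨯₃ Q) Q, dotProduct_comm (P' ⨯₃ Q') Q']
  -- The two frames have equal Gram matrices and equal determinants, so `B⁻¹ A` is a rotation; it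
  -- carries any `R` to the `R'` with the same products against the second frame.
  obtain ⟨a, p, h, hR⟩ := exists_rot hs h2 (B⁻¹ * A)
    (by
      rw [transpose_mul, ← mul_assoc, mul_assoc B⁻¹, hgram, ← mul_assoc, nonsing_inv_mul _ hBdet,
        one_mul, transpose_nonsing_inv, mul_nonsing_inv _ (by rwa [det_transpose])])
    (by
      rw [det_mul, det_nonsing_inv, hdet, hdet, hDD, Ring.inverse_eq_inv',
        inv_mul_cancel₀ (by rwa [← hDD])])
  refine ⟨a, p, h, fun R R' e1 e2 e3 => ?_⟩
  have e : A *ᵥ R = B *ᵥ R' := by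
    ext i
    change ![P, Q, P ⨯₃ Q] i ⬝ᵥ R = ![P', Q', P' ⨯₃ Q'] i ⬝ᵥ R'
    rw [dotProduct_comm, dotProduct_comm _ R']
    fin_cases i <;> simpa
  rw [← hR, ← mulVec_mulVec, e, mulVec_mulVec, nonsing_inv_mul _ hBdet, one_mulVec]

end Rotations

end SurfaceRep
end

noncomputable section
namespace SurfaceRep

/-! ### Groups of quaternions of norm one -/

/-- An identification of `G` with the group of quaternions `a + p`, `a ∈ K`, `p ∈ K³`,
with `a² + p ⬝ p = 1`. -/
structure QuatModel (K G : Type) [RCLike K] [Group G] [TopologicalSpace G] where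
  re : G → K
  im : G → Fin 3 → K
  re_mul : ∀ x y, re (x * y) = re x * re y - im x ⬝ᵥ im y
  im_mul : ∀ x y, im (x * y) = re x • im y + re y • im x + im x ⨯₃ im y
  norm_eq : ∀ x, re x ^ 2 + im x ⬝ᵥ im x = 1
  exists_eq : ∀ a p, a ^ 2 + p ⬝ᵥ p = 1 → ∃ x, re x = a ∧ im x = p
  ext : ∀ x y, re x = re y → im x = im y → x = y
  isInducing : Topology.IsInducing fun x => (re x, im x)

namespace QuatModel

variable {K G : Type} [RCLike K] [Group G] [TopologicalSpace G] (Q : QuatModel K G)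

/-- The element with given coordinates. -/
def ofCoords (a : K) (p : Fin 3 → K) (h : a ^ 2 + p ⬝ᵥ p = 1) : G := (Q.exists_eq a p h).choose

@[simp] theorem re_ofCoords (a : K) (p : Fin 3 → K) (h : a ^ 2 + p ⬝ᵥ p = 1) : Q.re (Q.ofCoords a p h) = a :=
  (Q.exists_eq a p h).choose_spec.1

@[simp] theorem im_ofCoords (a : K) (p : Fin 3 → K) (h : a ^ 2 + p ⬝ᵥ p = 1) : Q.im (Q.ofCoords a p h) = p :=
  (Q.exists_eq a p h).choose_spec.2

theorem ofCoords_one : Q.ofCoords 1 0 (by simp) = 1 := by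
  have h : ∀ y, Q.ofCoords 1 0 (by simp) * y = y := fun y => Q.ext _ _ (by simp [re_mul])
    (by simp [im_mul])
  simpa using h 1

@[simp] theorem re_one : Q.re 1 = 1 := by rw [← Q.ofCoords_one, re_ofCoords]

@[simp] theorem im_one : Q.im 1 = 0 := by rw [← Q.ofCoords_one, im_ofCoords]

theorem inv_eq (x : G) : x⁻¹ = Q.ofCoords (Q.re x) (-Q.im x) (by simpa using Q.norm_eq x) := by
  refine (eq_inv_of_mul_eq_one_right (a := x) ?_).symm
  refine Q.ext _ _ ?_ ?_
  · simpa [re_mul, ← sq] using Q.norm_eq x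
  · simp [im_mul]

@[simp] theorem re_inv (x : G) : Q.re x⁻¹ = Q.re x := by rw [Q.inv_eq, re_ofCoords]

@[simp] theorem im_inv (x : G) : Q.im x⁻¹ = -Q.im x := by rw [Q.inv_eq, im_ofCoords]

@[simp] theorem re_conj (x y : G) : Q.re (x * y * x⁻¹) = Q.re y := by
  have h := Q.norm_eq x
  simp only [re_mul, im_mul, re_inv, im_inv, vec3_dotProduct, cross_apply_zero, cross_apply_one,
    cross_apply_two, Pi.add_apply, Pi.smul_apply, Pi.neg_apply, smul_eq_mul] at h ⊢
  linear_combination Q.re y * h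

@[simp] theorem im_conj (x y : G) : Q.im (x * y * x⁻¹) = rot (Q.re x) (Q.im x) (Q.im y) := by
  apply vec3_ext <;>
  simp only [rot_apply, re_mul, im_mul, re_inv, im_inv, vec3_dotProduct, cross_apply_zero,
    cross_apply_one, cross_apply_two, Pi.add_apply, Pi.smul_apply, Pi.neg_apply, smul_eq_mul] <;>
  ring

/-- The real parts of `x * y` and `y * x` agree, and the imaginary parts differ by twice the cross
product. -/
theorem mul_comm_iff (x y : G) : x * y = y * x ↔ Q.im x ⨯₃ Q.im y = 0 := by
  constructor
  · intro h
    have h1 := Q.im_mul x y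
    rw [h, Q.im_mul y x, ← cross_anticomm] at h1
    have h2 : (2 : K) • (Q.im x ⨯₃ Q.im y) = 0 := by
      rw [two_smul]
      have := sub_eq_zero.2 h1
      rw [← neg_eq_zero, ← this]; abel
    exact (smul_eq_zero.1 h2).resolve_left two_ne_zero
  · intro h
    refine Q.ext _ _ ?_ ?_
    · rw [re_mul, re_mul, mul_comm, dotProduct_comm]
    · rw [im_mul, im_mul, ← cross_anticomm (Q.im x), h]; simp [add_comm]

theorem mem_center_of_im_eq_zero {x : G} (h : Q.im x = 0) : x ∈ Subgroup.center G :=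
  Subgroup.mem_center_iff.2 fun y => (Q.mul_comm_iff y x).2 (by simp [h])

include Q in
theorem t2Space : T2Space G :=
  T2Space.of_injective_continuous (f := fun x => (Q.re x, Q.im x))
    (fun x y h => Q.ext x y (congrArg Prod.fst h) (congrArg Prod.snd h)) Q.isInducing.continuous

include Q in
theorem secondCountableTopology : SecondCountableTopology G :=
  Q.isInducing.secondCountableTopology

theorem continuous_re : Continuous Q.re := continuous_fst.comp Q.isInducing.continuous

theorem continuous_im : Continuous Q.im := continuous_snd.comp Q.isInducing.continuous

theorem continuous_iff {X : Type} [TopologicalSpace X] {f : X → G} :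
    Continuous f ↔ Continuous (fun x => Q.re (f x)) ∧ Continuous (fun x => Q.im (f x)) := by
  rw [Q.isInducing.continuous_iff, ← continuous_prodMk]; rfl

theorem continuousAt_iff {X : Type} [TopologicalSpace X] {f : X → G} {x : X} :
    ContinuousAt f x ↔
      ContinuousAt (fun x => Q.re (f x)) x ∧ ContinuousAt (fun x => Q.im (f x)) x := by
  rw [Q.isInducing.continuousAt_iff]
  exact ⟨fun h => ⟨continuousAt_fst.comp' h, continuousAt_snd.comp' h⟩, fun h => h.1.prodMk h.2⟩

include Q in
theorem isTopologicalGroup : IsTopologicalGroup G := by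
  have hr := Q.continuous_re
  have hi := Q.continuous_im
  have hc : ∀ i, Continuous fun x => Q.im x i := fun i => (continuous_apply i).comp hi
  refine { continuous_mul := Q.continuous_iff.2 ⟨?_, ?_⟩, continuous_inv := Q.continuous_iff.2 ⟨?_, ?_⟩ }
  · simp only [re_mul, vec3_dotProduct]; fun_prop
  · simp only [im_mul, cross_apply]
    refine continuous_pi fun i => ?_
    fin_cases i <;> simp <;> fun_prop
  · simpa using hr
  · simp only [im_inv]; exact hi.neg

end QuatModel

/-! ### Coordinates on the homomorphism space -/

section Coordinates

variable {g n : ℕ} {G : Type} [Group G]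

/-- A point of the homomorphism space as a homomorphism. -/
def toHom (ρ : HomSpace g n G) : SurfaceGroup g n →* G := ρ

theorem genValues_smul (x : G) (ρ : HomSpace g n G) (s : Gen g n) :
    genValues ((x : G ⧸ Subgroup.center G) • ρ) s = x * genValues ρ s * x⁻¹ := rfl

theorem hom_ext {ρ ρ' : HomSpace g n G} (h : genValues ρ = genValues ρ') : ρ = ρ' :=
  PresentedGroup.ext fun s => congrFun h s

theorem lift_genValues (ρ : HomSpace g n G) (w : FreeGroup (Gen g n)) :
    toHom ρ (PresentedGroup.mk _ w) = FreeGroup.lift (genValues ρ) w := by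
  have : (toHom ρ).comp (PresentedGroup.mk _) =
      FreeGroup.lift (genValues ρ) := FreeGroup.ext_hom _ _ fun s => by
      simp [genValues]; rfl
  exact DFunLike.congr_fun this w

/-- The last puncture generator occurs once, at the end of the relator, so the relation can be
solved for it. This is where `n > 0` matters. -/
theorem lift_surfaceWord_succ (z : Gen g (n + 1) → G) :
    FreeGroup.lift z (surfaceWord g (n + 1)) =
      FreeGroup.lift (fun s => z (Sum.map id Fin.castSucc s)) (surfaceWord g n) *
        z (Sum.inr (Fin.last n)) := by
  simp only [surfaceWord, map_mul, map_list_prod, List.map_ofFn, Function.comp_def, map_inv,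
    FreeGroup.lift_apply_of, Sum.map_inl, Sum.map_inr, id]
  rw [List.ofFn_succ_last, List.prod_append, List.prod_singleton, mul_assoc]

/-- The generator values determined by the values on all generators but the last. -/
def extendValues (z : Gen g n → G) : Gen g (n + 1) → G :=
  Sum.elim (fun s => z (Sum.inl s))
    (Fin.snoc (fun i => z (Sum.inr i)) (FreeGroup.lift z (surfaceWord g n))⁻¹)

theorem extendValues_map (z : Gen g n → G) (s : Gen g n) :
    extendValues z (Sum.map id Fin.castSucc s) = z s := by
  rcases s with s | s <;> simp [extendValues]

theorem extendValues_last (z : Gen g n → G) :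
    extendValues z (Sum.inr (Fin.last n)) = (FreeGroup.lift z (surfaceWord g n))⁻¹ := by
  simp [extendValues]

/-- The homomorphism with given values on all generators but the last. -/
def ofValues (z : Gen g n → G) : HomSpace g (n + 1) G :=
  PresentedGroup.toGroup (f := extendValues z) (by
    rintro _ rfl
    rw [lift_surfaceWord_succ, extendValues_last]
    simp only [extendValues_map]
    exact mul_inv_cancel _)

theorem genValues_ofValues (z : Gen g n → G) : genValues (ofValues z) = extendValues z := by
  funext s
  exact PresentedGroup.toGroup.of _

theorem genValues_last (ρ : HomSpace g (n + 1) G) :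
    genValues ρ (Sum.inr (Fin.last n)) =
      (FreeGroup.lift (fun s => genValues ρ (Sum.map id Fin.castSucc s)) (surfaceWord g n))⁻¹ := by
  have h : FreeGroup.lift (genValues ρ) (surfaceWord g (n + 1)) = 1 := by
    rw [← lift_genValues, (PresentedGroup.mk_eq_one_iff).2
      (Subgroup.subset_normalClosure (Set.mem_singleton _)), map_one]
  rw [lift_surfaceWord_succ] at h
  exact eq_inv_of_mul_eq_one_right h

theorem continuous_lift [TopologicalSpace G] [IsTopologicalGroup G] {σ : Type} (w : FreeGroup σ) :
    Continuous fun z : σ → G => FreeGroup.lift z w := by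
  induction w using FreeGroup.induction_on with
  | C1 => simpa using continuous_const
  | of s => simpa using continuous_apply s
  | inv_of s h => simp only [map_inv, FreeGroup.lift_apply_of]; exact (continuous_apply s).inv
  | mul x y hx hy => simp only [map_mul]; exact hx.mul hy

/-- The values on all generators but the last are coordinates on the homomorphism space. -/
def valuesHomeo [TopologicalSpace G] [IsTopologicalGroup G] :
    HomSpace g (n + 1) G ≃ₜ (Gen g n → G) where
  toFun ρ s := genValues ρ (Sum.map id Fin.castSucc s)
  invFun := ofValues
  left_inv ρ := hom_ext <| by
    rw [genValues_ofValues]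
    funext s
    rcases s with s | s
    · rfl
    · induction s using Fin.lastCases with
      | last => rw [extendValues_last, genValues_last]
      | cast i => exact extendValues_map _ (Sum.inr i)
  right_inv z := by
    funext s
    change genValues (ofValues z) _ = _
    rw [genValues_ofValues, extendValues_map]
  continuous_toFun := continuous_pi fun s => (continuous_apply (Sum.map id Fin.castSucc s)).comp
    (f := genValues) continuous_induced_dom
  continuous_invFun := by
    rw [continuous_induced_rng]
    refine continuous_pi fun s => ?_
    simp only [Function.comp_def, genValues_ofValues]
    rcases s with s | s
    · exact continuous_apply _
    · induction s using Fin.lastCases with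
      | last => simp only [extendValues_last]; exact (continuous_lift _).inv
      | cast i => exact (continuous_apply (Sum.inr i)).congr fun z =>
          (extendValues_map z (Sum.inr i)).symm

/-- The homomorphism space is a power of the group, and the values of a homomorphism are words
in the coordinates. -/
theorem exists_coordinates [TopologicalSpace G] [IsTopologicalGroup G] {m : ℕ} (hn : 0 < n)
    (hm : 2 * g + n - 1 = m) :
    ∃ (e : HomSpace g n G ≃ₜ (Fin m → G)) (ι : Fin m → Gen g n),
      (∀ ρ k, e ρ k = genValues ρ (ι k)) ∧ ∀ γ : SurfaceGroup g n, ∃ w : FreeGroup (Fin m),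
        ∀ ρ, toHom ρ γ = FreeGroup.lift (e ρ) w := by
  obtain ⟨n, rfl⟩ : ∃ n', n = n' + 1 := ⟨n - 1, by omega⟩
  -- After the shift of `n`, the generators other than the last one number `2g + n = m`.
  let c : Gen g n ≃ Fin m := Fintype.equivFinOfCardEq (by simp; omega)
  let e : HomSpace g (n + 1) G ≃ₜ (Fin m → G) :=
    valuesHomeo.trans (Homeomorph.piCongrLeft (Y := fun _ => G) c)
  have he : ∀ ρ k, e ρ k = genValues ρ (Sum.map id Fin.castSucc (c.symm k)) := by
    intro ρ k
    obtain ⟨s, rfl⟩ := c.surjective k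
    rw [Equiv.symm_apply_apply]
    exact Equiv.piCongrLeft_apply_apply (fun _ => G) c (valuesHomeo ρ) s
  have hgen : ∀ s : Gen g (n + 1), ∃ w : FreeGroup (Fin m), ∀ ρ : HomSpace g (n + 1) G,
      genValues ρ s = FreeGroup.lift (e ρ) w := by
    have hold : ∀ s : Gen g n, ∀ ρ : HomSpace g (n + 1) G,
        genValues ρ (Sum.map id Fin.castSucc s) = FreeGroup.lift (e ρ) (FreeGroup.of (c s)) := by
      intro s ρ
      rw [FreeGroup.lift_apply_of, he, Equiv.symm_apply_apply]
    intro s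
    rcases s with s | s
    · exact ⟨_, hold (Sum.inl s)⟩
    · induction s using Fin.lastCases with
      | last =>
        refine ⟨(FreeGroup.map c (surfaceWord g n))⁻¹, fun ρ => ?_⟩
        have h : (FreeGroup.lift (e ρ)).comp (FreeGroup.map c) =
            FreeGroup.lift fun s => genValues ρ (Sum.map id Fin.castSucc s) :=
          FreeGroup.ext_hom _ _ fun s => by simp [he]
        rw [genValues_last, map_inv, ← h]; rfl
      | cast i => exact ⟨_, hold (Sum.inr i)⟩
  choose W hW using hgen
  refine ⟨e, _, he, fun γ => ?_⟩
  obtain ⟨w, rfl⟩ := PresentedGroup.mk_surjective _ γ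
  refine ⟨FreeGroup.lift W w, fun ρ => ?_⟩
  rw [lift_genValues]
  have : FreeGroup.lift (genValues ρ) = (FreeGroup.lift (e ρ)).comp (FreeGroup.lift W) :=
    FreeGroup.ext_hom _ _ fun s => by simp [hW]
  exact DFunLike.congr_fun this w

end Coordinates

end SurfaceRep
end

noncomputable section
namespace SurfaceRep

/-! ### Krull dimension -/

/-- Incomparability gives one inequality. For the other, lying over and going up lift each chain of
primes of `R` to a chain of the same length in `S`. -/
theorem ringKrullDim_eq_of_isIntegral (R S : Type) [CommRing R] [CommRing S] [Algebra R S]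
    [Algebra.IsIntegral R S] (hinj : Function.Injective (algebraMap R S)) :
    ringKrullDim S = ringKrullDim R := by
  apply le_antisymm
  · exact Order.krullDim_le_of_strictMono (PrimeSpectrum.comap (algebraMap R S))
      fun p q hpq => Ideal.IsIntegral.comap_lt_comap hpq
  · refine iSup_le fun l => ?_
    obtain ⟨P, -, hP, hPl⟩ := Ideal.exists_ideal_over_prime_of_isIntegral l.head.asIdeal (⊥ : Ideal S)
      (by
        change RingHom.ker _ ≤ _
        rw [(RingHom.injective_iff_ker_eq_bot _).1 hinj]; exact bot_le)
    have : P.LiesOver l.head.asIdeal := ⟨hPl.symm⟩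
    obtain ⟨L, hL, -⟩ := Ideal.exists_ltSeries_of_hasGoingUp l P
    rw [← hL]
    exact le_iSup (fun L : LTSeries (PrimeSpectrum S) => (L.length : WithBot ℕ∞)) L

open Cardinal in
-- Noether normalisation makes `A` integral over a polynomial ring in `s` variables, so its
-- dimension is `s`. These variables form a second transcendence basis, and two such bases have the
-- same cardinality.
theorem ringKrullDim_eq_of_isAlgebraic {k A : Type} [Field k] [CommRing A] [IsDomain A]
    [Algebra k A] [Algebra.FiniteType k A] {d : ℕ} {ι : Type} [Fintype ι] (hι : Fintype.card ι = d)
    {x : ι → A} (hx : AlgebraicIndependent k x)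
    (halg : Algebra.IsAlgebraic (Algebra.adjoin k (Set.range x)) A) :
    ringKrullDim A = d := by
  obtain ⟨s, g, hg, hint⟩ := exists_integral_inj_algHom_of_fg k A
  have hX : IsTranscendenceBasis k x := hx.isTranscendenceBasis_iff_isAlgebraic.2 halg
  have hdim : ringKrullDim A = s := by
    algebraize [g.toRingHom]
    have : Algebra.IsIntegral (MvPolynomial (Fin s) k) A := ⟨hint⟩
    rw [ringKrullDim_eq_of_isIntegral (MvPolynomial (Fin s) k) A hg,
      MvPolynomial.ringKrullDim_of_isNoetherianRing, ringKrullDim_eq_zero_of_field]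
    simp
  have hgX : MvPolynomial.aeval (fun i => g (MvPolynomial.X i)) = g :=
    (MvPolynomial.aeval_unique g).symm
  have hy : AlgebraicIndependent k fun i => g (MvPolynomial.X i) := by
    rw [AlgebraicIndependent, hgX]; exact hg
  have hY : IsTranscendenceBasis k fun i => g (MvPolynomial.X i) := by
    rw [hy.isTranscendenceBasis_iff_isAlgebraic]
    have hr : Algebra.adjoin k (Set.range fun i => g (MvPolynomial.X i)) = g.range := by
      rw [Algebra.adjoin_range_eq_range_aeval, hgX]
    rw [hr]
    have : Algebra.IsIntegral g.range A := ⟨fun a => by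
      obtain ⟨p, hp, hpa⟩ := hint a
      refine ⟨p.map g.rangeRestrict.toRingHom, hp.map _, ?_⟩
      rw [Polynomial.eval₂_map]
      exact hpa⟩
    exact Algebra.IsIntegral.isAlgebraic
  have h := hX.cardinalMk_eq_trdeg.trans hY.cardinalMk_eq_trdeg.symm
  rw [mk_fintype, mk_fintype, hι] at h
  have : d = s := by simpa using h
  rw [hdim, this]

end SurfaceRep
end

noncomputable section
namespace SurfaceRep

/-! ### Stereographic charts -/

section Stereo

/-- A sign as an element of `K`. -/
def sg (K : Type) [Ring K] (e : ℤˣ) : K := ((e : ℤ) : K)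

@[simp] theorem sg_mul_self (K : Type) [Ring K] (e : ℤˣ) : sg K e * sg K e = 1 := by
  rcases Int.units_eq_one_or e with rfl | rfl <;> simp [sg]

namespace QuatModel

variable {K G : Type} [RCLike K] [Group G] [TopologicalSpace G] (Q : QuatModel K G)

/-- Stereographic projection from the pole `-e`. -/
def stereo (e : ℤˣ) (x : G) : Fin 3 → K := (sg K e / (1 + sg K e * Q.re x)) • Q.im x

theorem stereoInv_norm (e : ℤˣ) (u : Fin 3 → K) (h : ¬ 1 + u ⬝ᵥ u = 0) :
    (sg K e * (1 - u ⬝ᵥ u) / (1 + u ⬝ᵥ u)) ^ 2 +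
      ((2 * sg K e / (1 + u ⬝ᵥ u)) • u) ⬝ᵥ ((2 * sg K e / (1 + u ⬝ᵥ u)) • u) = 1 := by
  rw [smul_dotProduct, dotProduct_smul]
  simp only [smul_eq_mul]
  field_simp
  linear_combination (1 + u ⬝ᵥ u) ^ 2 * sg_mul_self K e

open Classical in
/-- The inverse of stereographic projection. -/
def stereoInv (e : ℤˣ) (u : Fin 3 → K) : G :=
  if h : 1 + u ⬝ᵥ u = 0 then 1 else Q.ofCoords _ _ (stereoInv_norm e u h)

variable {Q}

theorem re_stereoInv {e : ℤˣ} {u : Fin 3 → K} (h : 1 + u ⬝ᵥ u ≠ 0) :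
    Q.re (Q.stereoInv e u) = sg K e * (1 - u ⬝ᵥ u) / (1 + u ⬝ᵥ u) := by
  rw [stereoInv, dif_neg h, re_ofCoords]

theorem im_stereoInv {e : ℤˣ} {u : Fin 3 → K} (h : 1 + u ⬝ᵥ u ≠ 0) :
    Q.im (Q.stereoInv e u) = (2 * sg K e / (1 + u ⬝ᵥ u)) • u := by
  rw [stereoInv, dif_neg h, im_ofCoords]

theorem one_add_re_stereoInv {e : ℤˣ} {u : Fin 3 → K} (h : 1 + u ⬝ᵥ u ≠ 0) :
    1 + sg K e * Q.re (Q.stereoInv e u) = 2 / (1 + u ⬝ᵥ u) := by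
  rw [re_stereoInv h]
  field_simp
  linear_combination (1 - u ⬝ᵥ u) * sg_mul_self K e

theorem one_add_re_stereoInv_ne {e : ℤˣ} {u : Fin 3 → K} (h : 1 + u ⬝ᵥ u ≠ 0) :
    1 + sg K e * Q.re (Q.stereoInv e u) ≠ 0 := by
  rw [one_add_re_stereoInv h]; exact div_ne_zero two_ne_zero h

theorem stereo_stereoInv {e : ℤˣ} {u : Fin 3 → K} (h : 1 + u ⬝ᵥ u ≠ 0) :
    Q.stereo e (Q.stereoInv e u) = u := by
  rw [stereo, one_add_re_stereoInv h, im_stereoInv h, smul_smul]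
  convert one_smul K u using 2
  field_simp
  linear_combination sg_mul_self K e

theorem one_add_stereo {e : ℤˣ} {x : G} (h : 1 + sg K e * Q.re x ≠ 0) :
    1 + Q.stereo e x ⬝ᵥ Q.stereo e x = 2 / (1 + sg K e * Q.re x) := by
  rw [stereo, smul_dotProduct, dotProduct_smul]
  simp only [smul_eq_mul]
  have h1 := Q.norm_eq x
  have h2 := sg_mul_self K e
  field_simp
  linear_combination h1 + (Q.im x ⬝ᵥ Q.im x + Q.re x ^ 2) * h2

theorem one_add_stereo_ne {e : ℤˣ} {x : G} (h : 1 + sg K e * Q.re x ≠ 0) :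
    1 + Q.stereo e x ⬝ᵥ Q.stereo e x ≠ 0 := by
  rw [one_add_stereo h]; exact div_ne_zero two_ne_zero h

theorem stereoInv_stereo {e : ℤˣ} {x : G} (h : 1 + sg K e * Q.re x ≠ 0) :
    Q.stereoInv e (Q.stereo e x) = x := by
  have h2 := sg_mul_self K e
  refine Q.ext _ _ ?_ ?_
  · rw [re_stereoInv (one_add_stereo_ne h), one_add_stereo h, ← sub_sub_cancel 1 (_ ⬝ᵥ _),
      sub_sub_cancel 1 (_ ⬝ᵥ _), show (1 : K) - Q.stereo e x ⬝ᵥ Q.stereo e x =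
        2 - (1 + Q.stereo e x ⬝ᵥ Q.stereo e x) by ring, one_add_stereo h]
    field_simp
    linear_combination Q.re x * h2
  · rw [im_stereoInv (one_add_stereo_ne h), one_add_stereo h, stereo, smul_smul]
    convert one_smul K (Q.im x) using 2
    field_simp
    linear_combination h2

/-- The poles `±1` are central, so conjugation is linear in stereographic coordinates. Rotation
invariants of these coordinates are thus conjugation invariants. -/
theorem stereo_conj (e : ℤˣ) (x y : G) :
    Q.stereo e (x * y * x⁻¹) = rot (Q.re x) (Q.im x) (Q.stereo e y) := by
  rw [stereo, re_conj, im_conj, stereo, map_smul]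

theorem exists_sign (x : G) : ∃ e : ℤˣ, 1 + sg K e * Q.re x ≠ 0 := by
  by_contra! h
  have h1 := h 1
  have h2 := h (-1)
  simp only [sg, Units.val_one, Int.cast_one, one_mul, Units.val_neg, Int.cast_neg, neg_mul] at h1 h2
  exact two_ne_zero (α := K) (by linear_combination h1 + h2)

/-- The change between the two stereographic charts is inversion composed with the antipodal map.
For `u·u = 0` the point is outside the second chart, and both sides are zero because division by
zero gives zero. -/
theorem stereo_neg_stereoInv {e : ℤˣ} {u : Fin 3 → K} (h : 1 + u ⬝ᵥ u ≠ 0) :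
    Q.stereo (-e) (Q.stereoInv e u) = -((u ⬝ᵥ u)⁻¹ • u) := by
  have h2 := sg_mul_self K e
  have hs : sg K (-e) = - sg K e := by simp [sg]
  have h3 : 1 + sg K (-e) * Q.re (Q.stereoInv e u) = 2 * (u ⬝ᵥ u) / (1 + u ⬝ᵥ u) := by
    rw [re_stereoInv h, hs]
    field_simp
    linear_combination -(1 - u ⬝ᵥ u) * h2
  rw [stereo, h3, im_stereoInv h, smul_smul, ← neg_smul, hs]
  congr 1
  by_cases hu : u ⬝ᵥ u = 0
  · simp [hu]
  · field_simp
    linear_combination -h2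

theorem continuousAt_stereoInv {e : ℤˣ} {u : Fin 3 → K} (h : 1 + u ⬝ᵥ u ≠ 0) :
    ContinuousAt (Q.stereoInv e) u := by
  have hd : Continuous fun u : Fin 3 → K => u ⬝ᵥ u := by
    simp only [vec3_dotProduct]; fun_prop
  have hev : ∀ᶠ v in nhds u, 1 + v ⬝ᵥ v ≠ 0 :=
    (continuous_const.add hd).continuousAt.eventually_ne h
  rw [Q.continuousAt_iff]
  constructor
  · refine ContinuousAt.congr (f := fun v : Fin 3 → K =>
      sg K e * (1 - v ⬝ᵥ v) / (1 + v ⬝ᵥ v)) ?_ (hev.mono fun v hv => (re_stereoInv hv).symm)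
    fun_prop (disch := exact h)
  · refine ContinuousAt.congr (f := fun v : Fin 3 → K =>
      (2 * sg K e / (1 + v ⬝ᵥ v)) • v) ?_ (hev.mono fun v hv => (im_stereoInv hv).symm)
    fun_prop (disch := exact h)

theorem continuousAt_stereo {e : ℤˣ} {x : G} (h : 1 + sg K e * Q.re x ≠ 0) :
    ContinuousAt (Q.stereo e) x := by
  have h1 := Q.continuous_re
  have h2 := Q.continuous_im
  unfold QuatModel.stereo; fun_prop (disch := exact h)

end QuatModel

end Stereo

/-! ### Polynomial functions -/

section PolyFun

open Polynomial

variable {K : Type} [RCLike K] {m : ℕ}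

/-- The point at time `t` of a polynomial curve of families of vectors. -/
def curveAt (c : Fin m → Fin 3 → K[X]) (t : K) : Fin m → Fin 3 → K := fun k b => (c k b).eval t

/-- Functions whose restrictions to polynomial curves are polynomial. -/
def IsPolyFun (F : (Fin m → Fin 3 → K) → K) : Prop :=
  ∀ c : Fin m → Fin 3 → K[X], ∃ p : K[X], ∀ t, F (curveAt c t) = p.eval t

namespace IsPolyFun

theorem const (a : K) : IsPolyFun (fun _ : Fin m → Fin 3 → K => a) := fun _ => ⟨C a, by simp⟩

theorem coord (k : Fin m) (b : Fin 3) : IsPolyFun (fun v : Fin m → Fin 3 → K => v k b) :=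
  fun c => ⟨c k b, fun _ => rfl⟩

variable {F H : (Fin m → Fin 3 → K) → K}

theorem add (hF : IsPolyFun F) (hH : IsPolyFun H) : IsPolyFun (fun v => F v + H v) := fun c => by
  obtain ⟨p, hp⟩ := hF c
  obtain ⟨q, hq⟩ := hH c
  exact ⟨p + q, fun t => by simp only [hp, hq, eval_add]⟩

theorem mul (hF : IsPolyFun F) (hH : IsPolyFun H) : IsPolyFun (fun v => F v * H v) := fun c => by
  obtain ⟨p, hp⟩ := hF c
  obtain ⟨q, hq⟩ := hH c
  exact ⟨p * q, fun t => by simp only [hp, hq, eval_mul]⟩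

theorem sub (hF : IsPolyFun F) (hH : IsPolyFun H) : IsPolyFun (fun v => F v - H v) := by
  simpa [sub_eq_add_neg] using hF.add ((const (-1)).mul hH)

theorem pow (hF : IsPolyFun F) (N : ℕ) : IsPolyFun (fun v => F v ^ N) := by
  induction N with
  | zero => simpa using const 1
  | succ N ih => simpa only [pow_succ] using ih.mul hF

theorem prod {ι : Type} (s : Finset ι) {F : ι → (Fin m → Fin 3 → K) → K}
    (hF : ∀ i, IsPolyFun (F i)) : IsPolyFun (fun v => ∏ i ∈ s, F i v) := by
  classical
  induction s using Finset.induction_on with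
  | empty => simpa using const 1
  | insert i s hi ih => simpa only [Finset.prod_insert hi] using (hF i).mul ih

theorem dot {P R : (Fin m → Fin 3 → K) → Fin 3 → K} (hP : ∀ b, IsPolyFun fun v => P v b)
    (hR : ∀ b, IsPolyFun fun v => R v b) : IsPolyFun fun v => P v ⬝ᵥ R v := by
  simp only [vec3_dotProduct]
  exact (((hP 0).mul (hR 0)).add ((hP 1).mul (hR 1))).add ((hP 2).mul (hR 2))

theorem cross {P R : (Fin m → Fin 3 → K) → Fin 3 → K} (hP : ∀ b, IsPolyFun fun v => P v b)
    (hR : ∀ b, IsPolyFun fun v => R v b) (b : Fin 3) : IsPolyFun fun v => (P v ⨯₃ R v) b := by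
  fin_cases b
  · exact ((hP 1).mul (hR 2)).sub ((hP 2).mul (hR 1))
  · exact ((hP 2).mul (hR 0)).sub ((hP 0).mul (hR 2))
  · exact ((hP 0).mul (hR 1)).sub ((hP 1).mul (hR 0))

/-- On a polynomial curve, two polynomial functions which are not identically zero have a common
point where both are nonzero. -/
theorem exists_ne (hF : IsPolyFun F) (hH : IsPolyFun H) (c : Fin m → Fin 3 → K[X]) {s t : K}
    (hs : F (curveAt c s) ≠ 0) (ht : H (curveAt c t) ≠ 0) :
    ∃ r, F (curveAt c r) ≠ 0 ∧ H (curveAt c r) ≠ 0 := by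
  obtain ⟨p, hp⟩ := hF c
  obtain ⟨q, hq⟩ := hH c
  by_contra! h
  have hpq : p * q = 0 := Polynomial.funext fun r => by
    rw [eval_mul, eval_zero, mul_eq_zero, ← hp, ← hq]
    by_cases h1 : F (curveAt c r) = 0
    · exact Or.inl h1
    · exact Or.inr (h r h1)
  rcases mul_eq_zero.1 hpq with h0 | h0
  · exact hs (by rw [hp, h0, eval_zero])
  · exact ht (by rw [hq, h0, eval_zero])

/-- The restriction to the curve is a nonzero polynomial and has finitely many roots, so `t` is
isolated from the other ones. Generic conditions can thus be attained in the limit `r → t`. -/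
theorem eventually_ne (hF : IsPolyFun F) (c : Fin m → Fin 3 → K[X]) {s : K}
    (hs : F (curveAt c s) ≠ 0) (t : K) : ∀ᶠ r in nhdsWithin t {t}ᶜ, F (curveAt c r) ≠ 0 := by
  obtain ⟨p, hp⟩ := hF c
  have hp0 : p ≠ 0 := by rintro rfl; exact hs (by rw [hp, eval_zero])
  have hfin : (p.rootSet K \ {t}).Finite := (p.rootSet_finite K).subset Set.sdiff_subset
  have h := hfin.isClosed.isOpen_compl.mem_nhds (show t ∈ (p.rootSet K \ {t})ᶜ by simp)
  filter_upwards [mem_nhdsWithin_of_mem_nhds h, self_mem_nhdsWithin] with r hr hrt h0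
  refine hr ⟨?_, hrt⟩
  rw [mem_rootSet]
  exact ⟨hp0, by rw [coe_aeval_eq_eval, ← hp, h0]⟩

end IsPolyFun

theorem continuous_curveAt (c : Fin m → Fin 3 → K[X]) : Continuous (curveAt c) :=
  continuous_pi fun k => continuous_pi fun b => (c k b).continuous

/-- The line through two families of vectors. -/
def lineCurve (v w : Fin m → Fin 3 → K) : Fin m → Fin 3 → K[X] :=
  fun k b => C (v k b) + X * C (w k b - v k b)

theorem lineCurve_zero (v w : Fin m → Fin 3 → K) : curveAt (lineCurve v w) 0 = v := by
  ext; simp [curveAt, lineCurve]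

theorem lineCurve_one (v w : Fin m → Fin 3 → K) : curveAt (lineCurve v w) 1 = w := by
  ext; simp [curveAt, lineCurve]

/-- The curve of families of parallel vectors `λ_k n`, with `λ` and `n` moving on lines. -/
def parallelCurve (l l' : Fin m → K) (n n' : Fin 3 → K) : Fin m → Fin 3 → K[X] :=
  fun k b => (C (l k) + X * C (l' k - l k)) * (C (n b) + X * C (n' b - n b))

theorem parallelCurve_apply (l l' : Fin m → K) (n n' : Fin 3 → K) (t : K) :
    curveAt (parallelCurve l l' n n') t =
      fun k => (l k + t * (l' k - l k)) • fun b => n b + t * (n' b - n b) := by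
  ext; simp [curveAt, parallelCurve]

end PolyFun

end SurfaceRep
end

noncomputable section
namespace SurfaceRep

/-! ### Irreducibility of the commuting locus -/

section Zariski

variable {K : Type} [Field K] {X Y : Type}

/-- Products of regular functions are regular, so the sets of nonvanishing form a basis and not
merely a subbasis. -/
theorem exists_basic_of_isOpen {A : Subalgebra K (X → K)} {U : Set X}
    (hU : @IsOpen X (zariskiTopology A) U) {x : X} (hx : x ∈ U) :
    ∃ f ∈ A, f x ≠ 0 ∧ {y | f y ≠ 0} ⊆ U := by
  induction hU with
  | basic s hs =>
    obtain ⟨f, hf, rfl⟩ := hs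
    exact ⟨f, hf, hx, subset_rfl⟩
  | univ => exact ⟨1, A.one_mem, one_ne_zero, Set.subset_univ _⟩
  | inter s t _ _ hs ht =>
    obtain ⟨f, hf, hfx, hfs⟩ := hs hx.1
    obtain ⟨h, hh, hhx, hht⟩ := ht hx.2
    exact ⟨f * h, A.mul_mem hf hh, mul_ne_zero hfx hhx, fun y hy =>
      ⟨hfs (left_ne_zero_of_mul hy), hht (right_ne_zero_of_mul hy)⟩⟩
  | sUnion S _ ih =>
    obtain ⟨s, hs, hxs⟩ := hx
    obtain ⟨f, hf, hfx, hfs⟩ := ih s hs hxs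
    exact ⟨f, hf, hfx, hfs.trans (Set.subset_sUnion_of_mem hs)⟩

theorem isZariskiIrreducible_of_mul {A : Subalgebra K (X → K)} {S : Set X} (hS : S.Nonempty)
    (h : ∀ f ∈ A, ∀ f' ∈ A, (∃ x ∈ S, f x ≠ 0) → (∃ x ∈ S, f' x ≠ 0) → ∃ x ∈ S, f x * f' x ≠ 0) :
    IsZariskiIrreducible A S := by
  refine ⟨hS, fun U V hU hV ⟨x, hx, hxU⟩ ⟨y, hy, hyV⟩ => ?_⟩
  obtain ⟨f, hf, hfx, hfU⟩ := exists_basic_of_isOpen hU hxU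
  obtain ⟨f', hf', hfy, hfV⟩ := exists_basic_of_isOpen hV hyV
  obtain ⟨z, hz, hzz⟩ := h f hf f' hf' ⟨x, hx, hfx⟩ ⟨y, hy, hfy⟩
  exact ⟨z, hz, hfU (left_ne_zero_of_mul hzz), hfV (right_ne_zero_of_mul hzz)⟩

theorem mul_ne_zero_of_isZariskiIrreducible {A : Subalgebra K (X → K)} {S : Set X}
    (hS : IsZariskiIrreducible A S) {f f' : X → K} (hf : f ∈ A) (hf' : f' ∈ A)
    (h : ∃ x ∈ S, f x ≠ 0) (h' : ∃ x ∈ S, f' x ≠ 0) : ∃ x ∈ S, f x * f' x ≠ 0 := by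
  obtain ⟨x, hx, hfx⟩ := h
  obtain ⟨y, hy, hfy⟩ := h'
  letI := zariskiTopology A
  obtain ⟨z, hz, h1, h2⟩ := hS.2 {y | f y ≠ 0} {y | f' y ≠ 0}
    (TopologicalSpace.isOpen_generateFrom_of_mem ⟨f, hf, rfl⟩)
    (TopologicalSpace.isOpen_generateFrom_of_mem ⟨f', hf', rfl⟩) ⟨x, hx, hfx⟩ ⟨y, hy, hfy⟩
  exact ⟨z, hz, mul_ne_zero h1 h2⟩

theorem IsZariskiIrreducible.image {A : Subalgebra K (X → K)} {B : Subalgebra K (Y → K)}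
    {S : Set X} (hS : IsZariskiIrreducible A S) (π : X → Y) (hπ : ∀ f ∈ B, f ∘ π ∈ A) :
    IsZariskiIrreducible B (π '' S) := by
  refine isZariskiIrreducible_of_mul (hS.1.image π) ?_
  rintro f hf f' hf' ⟨_, ⟨x, hx, rfl⟩, hfx⟩ ⟨_, ⟨y, hy, rfl⟩, hfy⟩
  obtain ⟨z, hz, h⟩ := mul_ne_zero_of_isZariskiIrreducible hS (hπ f hf) (hπ f' hf')
    ⟨x, hx, hfx⟩ ⟨y, hy, hfy⟩
  exact ⟨_, ⟨z, hz, rfl⟩, h⟩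

theorem isDomain_map_of_isZariskiIrreducible {A : Subalgebra K (X → K)} {S : Set X}
    (hS : IsZariskiIrreducible A S) :
    IsDomain (A.map (pullback K (Subtype.val : S → X))) := by
  have : Nontrivial (A.map (pullback K (Subtype.val : S → X))) := by
    obtain ⟨x, hx⟩ := hS.1
    exact ⟨0, 1, fun h => zero_ne_one (congrFun (congrArg Subtype.val h) ⟨x, hx⟩)⟩
  have : NoZeroDivisors (A.map (pullback K (Subtype.val : S → X))) := by
    refine ⟨?_⟩
    rintro ⟨_, f, hf, rfl⟩ ⟨_, f', hf', rfl⟩ h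
    by_contra! hne
    have key : ∀ f : X → K, ∀ hf : _ ∈ A.map (pullback K (Subtype.val : S → X)),
        (⟨(pullback K (Subtype.val : S → X)).toRingHom f, hf⟩ :
          A.map (pullback K (Subtype.val : S → X))) ≠ 0 → ∃ x ∈ S, f x ≠ 0 := by
      intro f hf h
      by_contra! h0
      exact h (Subtype.ext (funext fun x => h0 x x.2))
    obtain ⟨x, hx, hxx⟩ := mul_ne_zero_of_isZariskiIrreducible hS hf hf' (key _ _ hne.1)
      (key _ _ hne.2)
    exact hxx (congrFun (congrArg Subtype.val h) ⟨x, hx⟩)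
  exact NoZeroDivisors.to_isDomain _

end Zariski

namespace QuatModel

variable {K G : Type} [RCLike K] [Group G] [TopologicalSpace G] (Q : QuatModel K G)

/-- The algebra generated by the coordinates of a family of `G`-valued functions. -/
def coordAlg {X ι : Type} (φ : X → ι → G) : Subalgebra K (X → K) :=
  Algebra.adjoin K (Set.range (fun (s : ι) x => Q.re (φ x s)) ∪
    Set.range fun (s : ι × Fin 3) x => Q.im (φ x s.1) s.2)

theorem re_mem_coordAlg {X ι : Type} (φ : X → ι → G) (s : ι) :
    (fun x => Q.re (φ x s)) ∈ Q.coordAlg φ := Algebra.subset_adjoin (Or.inl ⟨s, rfl⟩)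

theorem im_mem_coordAlg {X ι : Type} (φ : X → ι → G) (s : ι) (b : Fin 3) :
    (fun x => Q.im (φ x s) b) ∈ Q.coordAlg φ := Algebra.subset_adjoin (Or.inr ⟨(s, b), rfl⟩)

theorem map_coordAlg {X X' ι : Type} (φ : X → ι → G) (ψ : X' → X) :
    (Q.coordAlg φ).map (pullback K ψ) = Q.coordAlg (φ ∘ ψ) := by
  rw [coordAlg, AlgHom.map_adjoin, Set.image_union, ← Set.range_comp, ← Set.range_comp]
  rfl

/-- Products are polynomial in the quaternion coordinates, and so are inverses, since the inverse of
a unit quaternion is its conjugate. -/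
theorem word_mem {X ι : Type} (φ : X → ι → G) (w : FreeGroup ι) :
    (fun x => Q.re (FreeGroup.lift (φ x) w)) ∈ Q.coordAlg φ ∧
      ∀ b, (fun x => Q.im (FreeGroup.lift (φ x) w) b) ∈ Q.coordAlg φ := by
  have hinv : ∀ a : X → G, ((fun x => Q.re (a x)) ∈ Q.coordAlg φ ∧
      ∀ b, (fun x => Q.im (a x) b) ∈ Q.coordAlg φ) → ((fun x => Q.re (a x)⁻¹) ∈ Q.coordAlg φ ∧
      ∀ b, (fun x => Q.im (a x)⁻¹ b) ∈ Q.coordAlg φ) := by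
    intro a ha
    simp only [re_inv, im_inv]
    exact ⟨ha.1, fun b => neg_mem (ha.2 b)⟩
  induction w using FreeGroup.induction_on with
  | C1 =>
    simp only [map_one, re_one, im_one]
    exact ⟨one_mem _, fun _ => zero_mem _⟩
  | of s =>
    simp only [FreeGroup.lift_apply_of]
    exact ⟨Q.re_mem_coordAlg φ s, Q.im_mem_coordAlg φ s⟩
  | inv_of s h =>
    simp only [map_inv]
    exact hinv _ h
  | mul x y hx hy =>
    simp only [map_mul, re_mul, im_mul]
    constructor
    · simp only [vec3_dotProduct]
      exact sub_mem (mul_mem hx.1 hy.1) (add_mem (add_mem (mul_mem (hx.2 0) (hy.2 0))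
        (mul_mem (hx.2 1) (hy.2 1))) (mul_mem (hx.2 2) (hy.2 2)))
    · intro b
      refine add_mem (add_mem (mul_mem hx.1 (hy.2 b)) (mul_mem hy.1 (hx.2 b))) ?_
      fin_cases b
      · exact sub_mem (mul_mem (hx.2 1) (hy.2 2)) (mul_mem (hx.2 2) (hy.2 1))
      · exact sub_mem (mul_mem (hx.2 2) (hy.2 0)) (mul_mem (hx.2 0) (hy.2 2))
      · exact sub_mem (mul_mem (hx.2 0) (hy.2 1)) (mul_mem (hx.2 1) (hy.2 0))

theorem coordAlg_le_of_words {X ι ι' : Type} (φ : X → ι → G) (φ' : X → ι' → G)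
    (h : ∀ s, ∃ w : FreeGroup ι, ∀ x, φ' x s = FreeGroup.lift (φ x) w) :
    Q.coordAlg φ' ≤ Q.coordAlg φ := by
  refine Algebra.adjoin_le ?_
  rintro _ (⟨s, rfl⟩ | ⟨⟨s, b⟩, rfl⟩) <;> obtain ⟨w, hw⟩ := h s <;> simp only [hw]
  · exact (Q.word_mem φ w).1
  · exact (Q.word_mem φ w).2 b

variable {m : ℕ}

/-- The inverse of the stereographic chart of `G ^ m`. -/
def chartInv (ε : Fin m → ℤˣ) (v : Fin m → Fin 3 → K) : Fin m → G :=
  fun k => Q.stereoInv (ε k) (v k)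

/-- The common denominator of the inverse charts. -/
def denom (v : Fin m → Fin 3 → K) : K := ∏ k, (1 + v k ⬝ᵥ v k)

theorem denom_ne_zero {v : Fin m → Fin 3 → K} : denom v ≠ 0 ↔ ∀ k, 1 + v k ⬝ᵥ v k ≠ 0 := by
  simp [denom, Finset.prod_ne_zero_iff]

theorem isPolyFun_denom : IsPolyFun (denom : (Fin m → Fin 3 → K) → K) :=
  IsPolyFun.prod _ fun k => (IsPolyFun.const 1).add (IsPolyFun.dot (IsPolyFun.coord k)
    (IsPolyFun.coord k))

/-- The inverse charts are rational with denominators `1 + v_k·v_k`, so a power of `denom` clears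
the denominators of any polynomial in the coordinates. -/
theorem exists_isPolyFun (ε : Fin m → ℤˣ) {f : (Fin m → G) → K}
    (hf : f ∈ Q.coordAlg (id : (Fin m → G) → _)) :
    ∃ (N : ℕ) (F : (Fin m → Fin 3 → K) → K), IsPolyFun F ∧
      ∀ v, denom v ≠ 0 → F v = denom v ^ N * f (Q.chartInv ε v) := by
  classical
  have hden : ∀ k (v : Fin m → Fin 3 → K), denom v =
      (1 + v k ⬝ᵥ v k) * ∏ l ∈ Finset.univ.erase k, (1 + v l ⬝ᵥ v l) := fun k v =>
    (Finset.mul_prod_erase Finset.univ _ (Finset.mem_univ k)).symm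
  have hp : ∀ k : Fin m, IsPolyFun fun v : Fin m → Fin 3 → K =>
      ∏ l ∈ Finset.univ.erase k, (1 + v l ⬝ᵥ v l) := fun k => IsPolyFun.prod _ fun l =>
    (IsPolyFun.const 1).add (IsPolyFun.dot (IsPolyFun.coord l) (IsPolyFun.coord l))
  induction hf using Algebra.adjoin_induction with
  | mem f hf =>
    rcases hf with ⟨k, rfl⟩ | ⟨⟨k, b⟩, rfl⟩
    · refine ⟨1, fun v => (sg K (ε k) * (1 - v k ⬝ᵥ v k)) *
        ∏ l ∈ Finset.univ.erase k, (1 + v l ⬝ᵥ v l), IsPolyFun.mul ((IsPolyFun.const _).mul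
        ((IsPolyFun.const 1).sub (IsPolyFun.dot (IsPolyFun.coord k) (IsPolyFun.coord k)))) (hp k),
        fun v hv => ?_⟩
      have h := denom_ne_zero.1 hv k
      simp only [chartInv, id, re_stereoInv h, hden k v, pow_one]
      field_simp
    · refine ⟨1, fun v => (2 * sg K (ε k) * v k b) *
        ∏ l ∈ Finset.univ.erase k, (1 + v l ⬝ᵥ v l), IsPolyFun.mul ((IsPolyFun.const _).mul
        (IsPolyFun.coord k b)) (hp k), fun v hv => ?_⟩
      have h := denom_ne_zero.1 hv k
      simp only [chartInv, id, im_stereoInv h, hden k v, pow_one, Pi.smul_apply, smul_eq_mul]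
      field_simp
  | algebraMap r => exact ⟨0, fun _ => r, IsPolyFun.const r, fun v _ => by simp⟩
  | add f f' _ _ hf hf' =>
    obtain ⟨N, F, hF, h⟩ := hf
    obtain ⟨N', F', hF', h'⟩ := hf'
    refine ⟨N + N', fun v => denom v ^ N' * F v + denom v ^ N * F' v,
      ((isPolyFun_denom.pow N').mul hF).add ((isPolyFun_denom.pow N).mul hF'), fun v hv => ?_⟩
    simp only [h v hv, h' v hv, Pi.add_apply]; ring
  | mul f f' _ _ hf hf' =>
    obtain ⟨N, F, hF, h⟩ := hf
    obtain ⟨N', F', hF', h'⟩ := hf'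
    refine ⟨N + N', fun v => F v * F' v, hF.mul hF', fun v hv => ?_⟩
    simp only [h v hv, h' v hv, Pi.mul_apply]; ring

/-- Commuting tuples. -/
def commuting (m : ℕ) : Set (Fin m → G) := {z | ∀ i j, Q.im (z i) ⨯₃ Q.im (z j) = 0}

/-- A nonzero member `v i` serves as the axis, and the factors are ratios of a coordinate `b` in
which it does not vanish. No inner product is inverted, so isotropic axes over ℂ are included. -/
theorem exists_parallel {ι : Type} {v : ι → Fin 3 → K} (h : ∀ i j, v i ⨯₃ v j = 0) :
    ∃ (l : ι → K) (n : Fin 3 → K), v = fun k => l k • n := by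
  by_cases h0 : ∀ i, v i = 0
  · exact ⟨0, 0, funext fun i => by simp [h0]⟩
  push Not at h0
  obtain ⟨i, hi⟩ := h0
  obtain ⟨b, hb⟩ := Function.ne_iff.1 hi
  refine ⟨fun k => v k b / v i b, v i, funext fun k => ?_⟩
  have h1 := congrFun (h i k) 0
  have h2 := congrFun (h i k) 1
  have h3 := congrFun (h i k) 2
  simp only [cross_apply_zero, cross_apply_one, cross_apply_two, Pi.zero_apply] at h1 h2 h3 hb
  apply vec3_ext <;> simp only [Pi.smul_apply, smul_eq_mul] <;> rw [div_mul_eq_mul_div, eq_div_iff hb] <;>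
    fin_cases b <;> simp only [Fin.zero_eta, Fin.mk_one, Fin.reduceFinMk] <;> grind

theorem smul_cross_smul (a b : K) (n : Fin 3 → K) : (a • n) ⨯₃ (b • n) = 0 := by
  rw [LinearMap.map_smul₂, LinearMap.map_smul, cross_self, smul_zero, smul_zero]

theorem chartInv_mem_commuting (ε : Fin m → ℤˣ) {l : Fin m → K} {n : Fin 3 → K}
    (h : denom (fun k => l k • n) ≠ 0) : Q.chartInv ε (fun k => l k • n) ∈ Q.commuting m := by
  intro i j
  rw [denom_ne_zero] at h
  rw [chartInv, chartInv, im_stereoInv (h i), im_stereoInv (h j), smul_smul, smul_smul,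
    smul_cross_smul]

theorem exists_chartInv_eq {z : Fin m → G} (hz : z ∈ Q.commuting m) (ε : Fin m → ℤˣ)
    (hε : ∀ k, 1 + sg K (ε k) * Q.re (z k) ≠ 0) :
    ∃ (l : Fin m → K) (n : Fin 3 → K), denom (fun k => l k • n) ≠ 0 ∧
      Q.chartInv ε (fun k => l k • n) = z := by
  obtain ⟨l, n, h⟩ := exists_parallel (v := fun k => Q.stereo (ε k) (z k)) (fun i j => by
    rw [stereo, stereo, LinearMap.map_smul₂, LinearMap.map_smul, hz i j, smul_zero, smul_zero])
  refine ⟨l, n, ?_, ?_⟩ <;> rw [← h]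
  · exact denom_ne_zero.2 fun k => one_add_stereo_ne (hε k)
  · exact funext fun k => stereoInv_stereo (hε k)

/-- The left-hand side is `2 / (1 + u·u)` if the signs agree and `2 (u·u) / (1 + u·u)` if not, so a
point with `u·u ≠ 0` lies in both charts. -/
theorem one_add_re_stereoInv_neg {e : ℤˣ} {u : Fin 3 → K} (h : 1 + u ⬝ᵥ u ≠ 0)
    (hu : u ⬝ᵥ u ≠ 0) (e' : ℤˣ) : 1 + sg K e' * Q.re (Q.stereoInv e u) ≠ 0 := by
  by_cases he : e' = e
  · rw [he]; exact one_add_re_stereoInv_ne h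
  · have hs : sg K e' = - sg K e := by
      rcases Int.units_eq_one_or e with rfl | rfl <;> rcases Int.units_eq_one_or e' with rfl | rfl <;>
        simp_all [sg]
    have h3 : 1 + sg K e' * Q.re (Q.stereoInv e u) = 2 * (u ⬝ᵥ u) / (1 + u ⬝ᵥ u) := by
      rw [re_stereoInv h, hs]
      field_simp
      linear_combination -(1 - u ⬝ᵥ u) * sg_mul_self K e
    rw [h3]
    exact div_ne_zero (mul_ne_zero two_ne_zero hu) h

theorem isPolyFun_normSq : IsPolyFun (fun v : Fin m → Fin 3 → K => ∏ k, v k ⬝ᵥ v k) :=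
  IsPolyFun.prod _ fun k => IsPolyFun.dot (IsPolyFun.coord k) (IsPolyFun.coord k)

/-- Moves a point of nonvanishing into the chart with all signs 1, so that two functions can be
compared in a single chart. The point is moved along a curve of parallel tuples towards the tuple
with all vectors `e₁`: for generic parameters `f` is still nonzero and every vector is
non-isotropic, so that the point lies in every chart. -/
theorem exists_ne_in_chart {f : (Fin m → G) → K} (hf : f ∈ Q.coordAlg (id : (Fin m → G) → _))
    {z : Fin m → G} (hz : z ∈ Q.commuting m) (hfz : f z ≠ 0) :
    ∃ (l : Fin m → K) (n : Fin 3 → K), denom (fun k => l k • n) ≠ 0 ∧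
      f (Q.chartInv (fun _ => 1) (fun k => l k • n)) ≠ 0 := by
  choose ε hε using fun k => exists_sign (Q := Q) (z k)
  obtain ⟨l, n, hd, rfl⟩ := Q.exists_chartInv_eq hz ε hε
  obtain ⟨N, F, hF, hFf⟩ := Q.exists_isPolyFun ε hf
  have h0 : curveAt (parallelCurve l (fun _ => 1) n ![1, 0, 0]) 0 = fun k => l k • n := by
    rw [parallelCurve_apply]; simp
  have h1 : curveAt (parallelCurve l (fun _ => 1) n ![1, 0, 0]) 1 = fun k => ![1, 0, 0] := by
    rw [parallelCurve_apply]; ext; simp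
  obtain ⟨r, hr1, hr2⟩ := IsPolyFun.exists_ne (hF.mul isPolyFun_denom) isPolyFun_normSq
    (parallelCurve l (fun _ => 1) n ![1, 0, 0]) (s := 0) (t := 1)
    (by rw [h0, hFf _ hd]; exact mul_ne_zero (mul_ne_zero (pow_ne_zero _ hd) hfz) hd)
    (by rw [h1]; simp [vec3_dotProduct])
  rw [parallelCurve_apply] at hr1 hr2
  have hd' := right_ne_zero_of_mul hr1
  have hf' := left_ne_zero_of_mul hr1
  rw [hFf _ hd'] at hf'
  rw [Finset.prod_ne_zero_iff] at hr2
  obtain ⟨l', n', hl', he⟩ := Q.exists_chartInv_eq (Q.chartInv_mem_commuting ε hd') (fun _ => 1)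
    (fun k => Q.one_add_re_stereoInv_neg (denom_ne_zero.1 hd' k) (hr2 k (Finset.mem_univ k)) _)
  exact ⟨l', n', hl', by rw [he]; exact right_ne_zero_of_mul hf'⟩

/-- In a common chart, the two points of nonvanishing are joined by the curve obtained by moving `l`
and `n` on lines, all of whose tuples are parallel. Along it both functions, cleared of
denominators, are nonzero polynomials in one variable, so they have a common point of nonvanishing.
-/
theorem isZariskiIrreducible_commuting :
    IsZariskiIrreducible (Q.coordAlg (id : (Fin m → G) → _)) (Q.commuting m) := by
  refine isZariskiIrreducible_of_mul ⟨1, fun i j => by simp⟩ ?_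
  rintro f hf f' hf' ⟨z, hz, hfz⟩ ⟨z', hz', hfz'⟩
  obtain ⟨l, n, hd, h⟩ := Q.exists_ne_in_chart hf hz hfz
  obtain ⟨l', n', hd', h'⟩ := Q.exists_ne_in_chart hf' hz' hfz'
  obtain ⟨N, F, hF, hFf⟩ := Q.exists_isPolyFun (fun _ => 1) hf
  obtain ⟨N', F', hF', hFf'⟩ := Q.exists_isPolyFun (fun _ => 1) hf'
  obtain ⟨r, hr1, hr2⟩ := IsPolyFun.exists_ne (hF.mul isPolyFun_denom) (hF'.mul isPolyFun_denom)
    (parallelCurve l l' n n') (s := 0) (t := 1)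
    (by
      rw [parallelCurve_apply]
      simp only [zero_mul, add_zero]
      rw [hFf _ hd]; exact mul_ne_zero (mul_ne_zero (pow_ne_zero _ hd) h) hd)
    (by
      rw [parallelCurve_apply]
      simp only [one_mul, add_sub_cancel]
      rw [hFf' _ hd']; exact mul_ne_zero (mul_ne_zero (pow_ne_zero _ hd') h') hd')
  rw [parallelCurve_apply] at hr1 hr2
  have hd2 := right_ne_zero_of_mul hr1
  refine ⟨_, Q.chartInv_mem_commuting (fun _ => 1) hd2, mul_ne_zero ?_ ?_⟩
  · have := left_ne_zero_of_mul hr1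
    rw [hFf _ hd2] at this
    exact right_ne_zero_of_mul this
  · have := left_ne_zero_of_mul hr2
    rw [hFf' _ hd2] at this
    exact right_ne_zero_of_mul this

end QuatModel

end SurfaceRep
end

noncomputable section
namespace SurfaceRep

/-! ### Connectedness and density -/

/-- The properties of `ℝ` and `ℂ` used below: sums of four squares are squares, the circle
`c² + s² = 1` is connected, it has a connected arc of points with `s ≠ 0`, and the sphere has many
points with given coordinates. -/
structure IsSpinField (K : Type) [RCLike K] : Prop where
  sqrt : ∀ (a : K) (p : Fin 3 → K), ∃ s, s ^ 2 = a ^ 2 + p ⬝ᵥ p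
  circle : IsPreconnected {c : K × K | c.1 ^ 2 + c.2 ^ 2 = 1}
  arc : ∃ A : Set (K × K), IsPreconnected A ∧ (∀ c ∈ A, c.1 ^ 2 + c.2 ^ 2 = 1 ∧ c.2 ≠ 0) ∧
    ∀ (c : K) (w : Fin 3 → K), c ^ 2 + w ⬝ᵥ w = 1 → w ⬝ᵥ w ≠ 0 → ∃ s, (c, s) ∈ A
  box : ∃ B : Set K, B.Infinite ∧ ∀ a ∈ B, ∀ b ∈ B, ∀ c ∈ B,
    (∃ d, a ^ 2 + (b ^ 2 + c ^ 2 + d ^ 2) = 1) ∧ 1 - a ^ 2 ≠ 0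

namespace QuatModel

variable {K G : Type} [RCLike K] [Group G] [TopologicalSpace G] (Q : QuatModel K G)

theorem circle_norm {u : Fin 3 → K} (hu : u ⬝ᵥ u = 1) {c s : K} (h : c ^ 2 + s ^ 2 = 1) :
    c ^ 2 + (s • u) ⬝ᵥ (s • u) = 1 := by
  rw [smul_dotProduct, dotProduct_smul, hu]; simp only [smul_eq_mul]; linear_combination h

theorem e1_dot : (![1, 0, 0] : Fin 3 → K) ⬝ᵥ ![1, 0, 0] = 1 := by simp [vec3_dotProduct]

theorem continuous_ofCoords {X : Type} [TopologicalSpace X] {a : X → K} {p : X → Fin 3 → K}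
    (ha : Continuous a) (hp : Continuous p) (h : ∀ x, a x ^ 2 + p x ⬝ᵥ p x = 1) :
    Continuous fun x => Q.ofCoords (a x) (p x) (h x) := by
  rw [Q.continuous_iff]
  simpa using ⟨ha, hp⟩

-- An element with non-isotropic imaginary part lies on a circle `c + s u`, `u·u = 1`, through 1. If
-- the imaginary part `p` is isotropic, the real part `a` has square 1, and the line `a + t p` joins
-- the element to `a`, which lies on such a circle.
include Q in
theorem preconnectedSpace (hK : IsSpinField K) : PreconnectedSpace G := by
  have hcirc := isPreconnected_iff_preconnectedSpace.1 hK.circle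
  have hKc : PreconnectedSpace K := by
    have : PathConnectedSpace K := IsTopologicalAddGroup.pathConnectedSpace
    infer_instance
  refine ⟨isPreconnected_of_forall 1 fun x _ => ?_⟩
  have hcircle : ∀ u : Fin 3 → K, ∀ hu : u ⬝ᵥ u = 1,
      IsPreconnected (Set.range fun c : {c : K × K | c.1 ^ 2 + c.2 ^ 2 = 1} =>
        Q.ofCoords c.1.1 (c.1.2 • u) (circle_norm hu c.2)) := fun u hu =>
    isPreconnected_range (Q.continuous_ofCoords (by fun_prop) (by fun_prop) _)
  by_cases hp : Q.im x ⬝ᵥ Q.im x = 0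
  · have ha : Q.re x ^ 2 = 1 := by simpa [hp] using Q.norm_eq x
    have hline : IsPreconnected (Set.range fun t : K =>
        Q.ofCoords (Q.re x) (t • Q.im x) (by simp [hp, ha])) :=
      isPreconnected_range (Q.continuous_ofCoords (by fun_prop) (by fun_prop) _)
    refine ⟨_, Set.subset_univ _, ?_, ?_, IsPreconnected.union
      (Q.ofCoords (Q.re x) 0 (by rw [ha, dotProduct_zero, add_zero]))
      ?_ ?_ (hcircle _ e1_dot) hline⟩
    · exact Or.inl ⟨⟨(1, 0), by simp⟩, Q.ext _ _ (by simp) (by simp)⟩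
    · exact Or.inr ⟨1, Q.ext _ _ (by simp) (by simp)⟩
    · exact ⟨⟨(Q.re x, 0), by simp only [Set.mem_ofPred_eq]; rw [ha]; ring⟩, Q.ext _ _ (by simp) (by simp)⟩
    · exact ⟨0, Q.ext _ _ (by simp) (by simp)⟩
  · obtain ⟨s, hs⟩ := hK.sqrt 0 (Q.im x)
    rw [zero_pow two_ne_zero, zero_add] at hs
    have hs0 : s ≠ 0 := by rintro rfl; exact hp (by rw [← hs]; simp)
    have hu : (s⁻¹ • Q.im x) ⬝ᵥ (s⁻¹ • Q.im x) = 1 := by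
      rw [smul_dotProduct, dotProduct_smul, ← hs]; simp only [smul_eq_mul]; field_simp
    refine ⟨_, Set.subset_univ _, ?_, ?_, hcircle _ hu⟩
    · exact ⟨⟨(1, 0), by simp⟩, Q.ext _ _ (by simp) (by simp)⟩
    · exact ⟨⟨(Q.re x, s), by simpa [hs] using Q.norm_eq x⟩, Q.ext _ _ (by simp) (by simp [hs0])⟩

/-- Unit vectors are conjugate. -/
theorem exists_rot_e1_eq (hK : IsSpinField K) {u : Fin 3 → K} (hu : u ⬝ᵥ u = 1) :
    ∃ x : G, rot (Q.re x) (Q.im x) ![1, 0, 0] = u := by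
  have key : ∀ u : Fin 3 → K, u ⬝ᵥ u = 1 → 1 + u 0 ≠ 0 →
      ∃ x : G, rot (Q.re x) (Q.im x) ![1, 0, 0] = u := by
    intro u hu h0
    -- Here `p = e₁ × u`: up to normalisation, `(1 + u₀) + e₁ × u` is the quaternion of the rotation
    -- that takes `e₁` to `u`.
    obtain ⟨p, hp0, hp1, hp2⟩ : ∃ p : Fin 3 → K, p 0 = 0 ∧ p 1 = -u 2 ∧ p 2 = u 1 :=
      ⟨![0, -u 2, u 1], rfl, rfl, rfl⟩
    obtain ⟨e, he, he0, he1, he2⟩ : ∃ e : Fin 3 → K, e = ![1, 0, 0] ∧ e 0 = 1 ∧ e 1 = 0 ∧ e 2 = 0 :=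
      ⟨![1, 0, 0], rfl, rfl, rfl, rfl⟩
    obtain ⟨s, hs⟩ := hK.sqrt (1 + u 0) p
    rw [vec3_dotProduct] at hu
    rw [vec3_dotProduct, hp0, hp1, hp2] at hs
    have hN : s ^ 2 = 2 * (1 + u 0) := by rw [hs]; linear_combination hu
    have hs0 : s ≠ 0 := by
      rintro rfl
      exact mul_ne_zero two_ne_zero h0 (by rw [← hN]; simp)
    refine ⟨Q.ofCoords ((1 + u 0) / s) (fun k => p k / s) ?_, ?_⟩
    · simp only [vec3_dotProduct, hp0, hp1, hp2]
      field_simp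
      rw [hs]; ring
    · rw [re_ofCoords, im_ofCoords, rot_div hs0, hN, ← he]
      apply vec3_ext <;>
        simp only [rot_apply, vec3_dotProduct, cross_apply_zero, cross_apply_one, cross_apply_two,
          Pi.add_apply, Pi.smul_apply, smul_eq_mul, hp0, hp1, hp2, he0, he1, he2] <;>
        field_simp <;> first | ring1 | linear_combination -hu
  by_cases h0 : 1 + u 0 = 0
  · obtain ⟨x, hx⟩ := key (-u) (by simpa using hu) (by
      intro h
      simp only [Pi.neg_apply] at h
      exact two_ne_zero (α := K) (by linear_combination h + h0))
    -- If `1 + u₀ = 0`, the construction applies to `-u`; a half-turn about the second axis, which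
    -- reverses `e₁`, is performed before it.
    refine ⟨x * Q.ofCoords 0 ![0, 1, 0] (by simp [vec3_dotProduct]), ?_⟩
    rw [re_mul, im_mul, ← rot_comp, re_ofCoords, im_ofCoords]
    have : rot 0 ![0, 1, 0] (![1, 0, 0] : Fin 3 → K) = -![1, 0, 0] := by
      apply vec3_ext <;>
        simp [rot_apply, vec3_dotProduct, cross_apply_zero, cross_apply_one, cross_apply_two]
    rw [this, map_neg, hx, neg_neg]
  · exact key u hu h0

variable {m : ℕ}

/-- Conjugates of tuples in the standard torus. -/
def conjTorus (m : ℕ) : Set (Fin m → G) :=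
  Set.range fun y : G × (Fin m → {c : K × K | c.1 ^ 2 + c.2 ^ 2 = 1}) => fun k =>
    y.1 * Q.ofCoords (y.2 k).1.1 ((y.2 k).1.2 • ![1, 0, 0]) (circle_norm e1_dot (y.2 k).2) * y.1⁻¹

theorem conjTorus_subset : Q.conjTorus m ⊆ Q.commuting m := by
  rintro _ ⟨y, rfl⟩ i j
  rw [im_conj, im_conj, im_ofCoords, im_ofCoords, (rot _ _).map_smul, (rot _ _).map_smul,
    smul_cross_smul]

theorem isConnected_conjTorus (hK : IsSpinField K) : IsConnected (Q.conjTorus m) := by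
  have := Q.isTopologicalGroup
  have := Q.preconnectedSpace hK
  have := isPreconnected_iff_preconnectedSpace.1 hK.circle
  refine ⟨⟨_, ⟨(1, fun _ => ⟨(1, 0), by simp⟩), rfl⟩⟩, isPreconnected_range ?_⟩
  refine continuous_pi fun k => (continuous_fst.mul ?_).mul continuous_fst.inv
  exact Q.continuous_ofCoords (by fun_prop) (by fun_prop) _

/-- A non-isotropic axis can be normalised and rotated to `e₁`. Over ℂ isotropic axes escape this,
which is why conjugates of the torus are only shown to be dense among commuting tuples. -/
theorem mem_conjTorus (hK : IsSpinField K) {z : Fin m → G} {l : Fin m → K} {n : Fin 3 → K}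
    (hn : n ⬝ᵥ n ≠ 0) (hz : ∀ k, Q.im (z k) = l k • n) : z ∈ Q.conjTorus m := by
  obtain ⟨s, hs⟩ := hK.sqrt 0 n
  rw [zero_pow two_ne_zero, zero_add] at hs
  have hs0 : s ≠ 0 := by rintro rfl; exact hn (by rw [← hs]; simp)
  obtain ⟨x, hx⟩ := Q.exists_rot_e1_eq hK (u := s⁻¹ • n) (by
    rw [smul_dotProduct, dotProduct_smul, ← hs]; simp only [smul_eq_mul]; field_simp)
  refine ⟨(x, fun k => ⟨(Q.re (z k), l k * s), ?_⟩), funext fun k => Q.ext _ _ ?_ ?_⟩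
  · have := Q.norm_eq (z k)
    rw [hz, smul_dotProduct, dotProduct_smul, ← hs] at this
    simp only [smul_eq_mul, Set.mem_ofPred_eq] at this ⊢
    rw [← this]; ring
  · rw [re_conj, re_ofCoords]
  · rw [im_conj, im_ofCoords, map_smul, hx, smul_smul, hz, mul_assoc, mul_inv_cancel₀ hs0, mul_one]

theorem continuousAt_chartInv {ε : Fin m → ℤˣ} {v : Fin m → Fin 3 → K} (h : denom v ≠ 0) :
    ContinuousAt (Q.chartInv ε) v :=
  continuousAt_pi.2 fun k => ContinuousAt.comp (f := fun v : Fin m → Fin 3 → K => v k)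
    (continuousAt_stereoInv (denom_ne_zero.1 h k)) (continuous_apply k).continuousAt

/-- Moving the axis on the line towards `e₁` makes it non-isotropic for all small `t ≠ 0`: its
square is a polynomial in `t` with value 1 at `t = 1`. -/
theorem commuting_subset_closure (hK : IsSpinField K) :
    Q.commuting m ⊆ closure (Q.conjTorus m) := by
  intro z hz
  choose ε hε using fun k => exists_sign (Q := Q) (z k)
  obtain ⟨l, n, hd, rfl⟩ := Q.exists_chartInv_eq hz ε hε
  have h0 : curveAt (parallelCurve l l n ![1, 0, 0]) 0 = fun k => l k • n := by
    rw [parallelCurve_apply]; simp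
  have e1 := isPolyFun_denom.eventually_ne (parallelCurve l l n ![1, 0, 0]) (s := 0)
    (by rwa [h0]) 0
  have e2 := (IsPolyFun.dot (IsPolyFun.coord 0) (IsPolyFun.coord 0)).eventually_ne
    (lineCurve (fun _ : Fin 1 => n) (fun _ => ![1, 0, 0])) (s := 1)
    (by rw [lineCurve_one]; simp [vec3_dotProduct]) 0
  have hlim : Filter.Tendsto (fun t => Q.chartInv ε (curveAt (parallelCurve l l n ![1, 0, 0]) t))
      (nhdsWithin 0 {0}ᶜ) (nhds (Q.chartInv ε (fun k => l k • n))) := by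
    refine Filter.Tendsto.mono_left ?_ nhdsWithin_le_nhds
    have := Q.continuousAt_chartInv (ε := ε) hd
    rw [← h0] at this ⊢
    exact ContinuousAt.comp (x := (0 : K)) this (continuous_curveAt _).continuousAt
  refine mem_closure_of_tendsto hlim ?_
  filter_upwards [e1, e2] with t h1 h2
  refine Q.mem_conjTorus hK (n := curveAt (lineCurve (fun _ : Fin 1 => n)
    (fun _ => ![1, 0, 0])) t 0) h2 (l := fun k => 2 * sg K (ε k) / (1 +
      curveAt (parallelCurve l l n ![1, 0, 0]) t k ⬝ᵥ curveAt (parallelCurve l l n ![1, 0, 0]) t k) *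
      l k) (fun k => ?_)
  have : curveAt (parallelCurve l l n ![1, 0, 0]) t k =
      l k • curveAt (lineCurve (fun _ : Fin 1 => n) (fun _ => ![1, 0, 0])) t 0 := by
    rw [parallelCurve_apply]; ext; simp [curveAt, lineCurve]
  rw [chartInv, im_stereoInv (denom_ne_zero.1 h1 k), this, smul_smul]

theorem isConnected_commuting (hK : IsSpinField K) : IsConnected (Q.commuting m) :=
  (Q.isConnected_conjTorus hK).subset_closure Q.conjTorus_subset (Q.commuting_subset_closure hK)

/-- Irreducible tuples. -/
def irreducible (m : ℕ) : Set (Fin m → G) :=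
  {z | (∃ i j, (Q.im (z i) ⨯₃ Q.im (z j)) ⬝ᵥ (Q.im (z i) ⨯₃ Q.im (z j)) ≠ 0) ∨
    ∃ i j k, Q.im (z i) ⬝ᵥ (Q.im (z j) ⨯₃ Q.im (z k)) ≠ 0}

/-- Conjugates of tuples that begin with a pair in standard position. -/
def conjStandard (A : Set (K × K)) (hA : ∀ c ∈ A, c.1 ^ 2 + c.2 ^ 2 = 1 ∧ c.2 ≠ 0) (m : ℕ) :
    Set (Fin (m + 2) → G) :=
  Set.range fun y : G × A × A × A × (Fin m → G) => fun k =>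
    y.1 * (Fin.cons (Q.ofCoords y.2.1.1.1 (y.2.1.1.2 • ![1, 0, 0])
        (circle_norm e1_dot (hA _ y.2.1.2).1))
      (Fin.cons (Q.ofCoords y.2.2.1.1.1 (y.2.2.1.1.2 • ![y.2.2.2.1.1.1, y.2.2.2.1.1.2, 0])
        (circle_norm (by simpa [vec3_dotProduct, ← sq] using (hA _ y.2.2.2.1.2).1)
          (hA _ y.2.2.1.2).1)) y.2.2.2.2 : Fin (m + 1) → G) : Fin (m + 2) → G) k * y.1⁻¹

theorem isPreconnected_conjStandard (hK : IsSpinField K) {A : Set (K × K)} (hAc : IsPreconnected A)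
    (hA : ∀ c ∈ A, c.1 ^ 2 + c.2 ^ 2 = 1 ∧ c.2 ≠ 0) : IsPreconnected (Q.conjStandard A hA m) := by
  have := Q.isTopologicalGroup
  have := Q.preconnectedSpace hK
  have := isPreconnected_iff_preconnectedSpace.1 hAc
  refine isPreconnected_range ?_
  refine continuous_pi fun k => (continuous_fst.mul ?_).mul continuous_fst.inv
  refine Fin.cases ?_ (fun k => Fin.cases ?_ (fun k => ?_) k) k
  · simp only [Fin.cons_zero]
    exact Q.continuous_ofCoords (by fun_prop) (by fun_prop) _
  · simp only [Fin.cons_zero, Fin.cons_succ]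
    refine Q.continuous_ofCoords (by fun_prop) (continuous_pi fun b => ?_) _
    fin_cases b <;> simp <;> fun_prop
  · simp only [Fin.cons_succ]
    fun_prop

theorem conjStandard_subset {A : Set (K × K)} (hA : ∀ c ∈ A, c.1 ^ 2 + c.2 ^ 2 = 1 ∧ c.2 ≠ 0) :
    Q.conjStandard A hA m ⊆ Q.irreducible (m + 2) := by
  rintro _ ⟨⟨x, a, b, c, y⟩, rfl⟩
  refine Or.inl ⟨0, 1, ?_⟩
  rw [im_conj, im_conj, rot_cross (Q.norm_eq x), rot_dot (Q.norm_eq x)]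
  have e : ((1 : Fin (m + 2))) = Fin.succ 0 := rfl
  rw [Fin.cons_zero, e, Fin.cons_succ, Fin.cons_zero, im_ofCoords, im_ofCoords]
  have h1 := (hA _ a.2).2
  have h2 := (hA _ b.2).2
  have h3 := (hA _ c.2).2
  simp [vec3_dotProduct, cross_apply_zero, cross_apply_one, cross_apply_two, h1, h2, h3]

/-- A pair `s e₁`, `t (c e₁ + r e₂)` is constructed with the same Gram matrix as the first two
imaginary parts, so a rotation relates the pairs. The remaining entries are unconstrained and only
have to be conjugated back. -/
theorem mem_conjStandard (hK : IsSpinField K) {A : Set (K × K)}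
    (hA : ∀ c ∈ A, c.1 ^ 2 + c.2 ^ 2 = 1 ∧ c.2 ≠ 0)
    (hA' : ∀ (c : K) (w : Fin 3 → K), c ^ 2 + w ⬝ᵥ w = 1 → w ⬝ᵥ w ≠ 0 → ∃ s, (c, s) ∈ A)
    {z : Fin (m + 2) → G} (h0 : Q.im (z 0) ⬝ᵥ Q.im (z 0) ≠ 0) (h1 : Q.im (z 1) ⬝ᵥ Q.im (z 1) ≠ 0)
    (hD : (Q.im (z 0) ⨯₃ Q.im (z 1)) ⬝ᵥ (Q.im (z 0) ⨯₃ Q.im (z 1)) ≠ 0) :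
    z ∈ Q.conjStandard A hA m := by
  obtain ⟨s, hs⟩ := hA' _ _ (Q.norm_eq (z 0)) h0
  obtain ⟨t, ht⟩ := hA' _ _ (Q.norm_eq (z 1)) h1
  have hs1 := hA _ hs
  have ht1 := hA _ ht
  have hs2 : Q.im (z 0) ⬝ᵥ Q.im (z 0) = s ^ 2 := by
    linear_combination Q.norm_eq (z 0) - hs1.1
  have ht2 : Q.im (z 1) ⬝ᵥ Q.im (z 1) = t ^ 2 := by
    linear_combination Q.norm_eq (z 1) - ht1.1
  have hs0 : s ≠ 0 := hs1.2
  have ht0 : t ≠ 0 := ht1.2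
  have hst : s * t ≠ 0 := mul_ne_zero hs1.2 ht1.2
  have hcross := cross_dot_cross (Q.im (z 0)) (Q.im (z 1)) (Q.im (z 0)) (Q.im (z 1))
  rw [hs2, ht2, dotProduct_comm (Q.im (z 1)) (Q.im (z 0))] at hcross
  -- The cosine of the angle between the two vectors is completed by a sine `r` from the arc;
  -- Lagrange's identity for the square of the cross product shows that they lie on the circle.
  obtain ⟨r, hr⟩ := hA' (Q.im (z 0) ⬝ᵥ Q.im (z 1) / (s * t))
    ((s * t)⁻¹ • (Q.im (z 0) ⨯₃ Q.im (z 1)))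
    (by
      rw [smul_dotProduct, dotProduct_smul, hcross]
      simp only [smul_eq_mul]
      field_simp
      ring)
    (by
      rw [smul_dotProduct, dotProduct_smul]
      exact mul_ne_zero (inv_ne_zero hst) (mul_ne_zero (inv_ne_zero hst) hD))
  have hr1 := (hA _ hr).1
  simp only at hr1
  have e1 : (s • ![1, 0, 0]) ⬝ᵥ (s • ![1, 0, 0]) = Q.im (z 0) ⬝ᵥ Q.im (z 0) := by
    rw [hs2]; simp [vec3_dotProduct, sq]
  have e2 : (s • ![1, 0, 0]) ⬝ᵥ (t • ![Q.im (z 0) ⬝ᵥ Q.im (z 1) / (s * t), r, 0]) =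
      Q.im (z 0) ⬝ᵥ Q.im (z 1) := by
    simp only [vec3_dotProduct (s • _), Pi.smul_apply, smul_eq_mul]
    simp
    field_simp
  have e3 : (t • ![Q.im (z 0) ⬝ᵥ Q.im (z 1) / (s * t), r, 0]) ⬝ᵥ
      (t • ![Q.im (z 0) ⬝ᵥ Q.im (z 1) / (s * t), r, 0]) = Q.im (z 1) ⬝ᵥ Q.im (z 1) := by
    rw [ht2, smul_dotProduct, dotProduct_smul, vec3_dotProduct]
    simp
    linear_combination t ^ 2 * hr1
  obtain ⟨a, p, hap, hrot⟩ := exists_rot_of_gram_eq hK.sqrt two_ne_zero e1 e2 e3 (by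
    rw [cross_dot_cross, e1, e3, e2, dotProduct_comm _ (s • _), e2, hs2, ht2, ← hcross]; exact hD)
  have hP := hrot (s • ![1, 0, 0]) (Q.im (z 0)) e1 e2
    (by rw [dot_self_cross, dot_self_cross])
  have hQ := hrot _ (Q.im (z 1)) (by rw [dotProduct_comm, e2, dotProduct_comm]) e3
    (by rw [dot_cross_self, dot_cross_self])
  refine ⟨(Q.ofCoords a p hap, ⟨_, hs⟩, ⟨_, ht⟩, ⟨_, hr⟩, fun k => (Q.ofCoords a p hap)⁻¹ *
    z k.succ.succ * Q.ofCoords a p hap), funext fun k => ?_⟩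
  refine Fin.cases ?_ (fun k => Fin.cases ?_ (fun k => ?_) k) k
  · simp only [Fin.cons_zero]
    refine Q.ext _ _ (by simp) ?_
    rw [im_conj, im_ofCoords, re_ofCoords, im_ofCoords, ← hP]
  · simp only [Fin.cons_zero, Fin.cons_succ]
    refine Q.ext _ _ (by simp) ?_
    rw [im_conj, im_ofCoords, re_ofCoords, im_ofCoords, ← hQ]; rfl
  · simp only [Fin.cons_succ]
    group

/-- In a chart, the tuple is moved on a line towards one that begins with `e₁, e₂`. The conditions
of `mem_conjStandard` are nonvanishing of polynomials along the line, so they hold for all small `t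
≠ 0`. -/
theorem dense_conjStandard (hK : IsSpinField K) {A : Set (K × K)}
    (hA : ∀ c ∈ A, c.1 ^ 2 + c.2 ^ 2 = 1 ∧ c.2 ≠ 0)
    (hA' : ∀ (c : K) (w : Fin 3 → K), c ^ 2 + w ⬝ᵥ w = 1 → w ⬝ᵥ w ≠ 0 → ∃ s, (c, s) ∈ A) :
    Dense (Q.conjStandard A hA m) := by
  intro z
  choose ε hε using fun k => exists_sign (Q := Q) (z k)
  set v := fun k => Q.stereo (ε k) (z k) with hv
  have hd : denom v ≠ 0 := denom_ne_zero.2 fun k => one_add_stereo_ne (hε k)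
  have hz : Q.chartInv ε v = z := funext fun k => stereoInv_stereo (hε k)
  rw [← hz]
  let c := lineCurve v (Fin.cons ![1, 0, 0] (Fin.cons ![0, 1, 0] (0 : Fin m → Fin 3 → K)))
  have h0 : curveAt c 0 = v := lineCurve_zero _ _
  have h1 : curveAt c 1 = Fin.cons ![1, 0, 0] (Fin.cons ![0, 1, 0] (0 : Fin m → Fin 3 → K)) :=
    lineCurve_one _ _
  have h10 : curveAt c 1 0 = ![1, 0, 0] := by rw [h1]; rfl
  have h11 : curveAt c 1 1 = ![0, 1, 0] := by rw [h1]; rfl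
  have e1 := isPolyFun_denom.eventually_ne c (s := 0) (by rwa [h0]) 0
  have e2 := (IsPolyFun.dot (IsPolyFun.coord 0) (IsPolyFun.coord 0)).eventually_ne c (s := 1)
    (by rw [h10]; simp [vec3_dotProduct]) 0
  have e3 := (IsPolyFun.dot (IsPolyFun.coord 1) (IsPolyFun.coord 1)).eventually_ne c (s := 1)
    (by rw [h11]; simp [vec3_dotProduct]) 0
  have e4 := (IsPolyFun.dot (IsPolyFun.cross (IsPolyFun.coord 0) (IsPolyFun.coord 1))
    (IsPolyFun.cross (IsPolyFun.coord 0) (IsPolyFun.coord 1))).eventually_ne c (s := 1)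
    (by rw [h10, h11]; simp [vec3_dotProduct, cross_apply]) 0
  have hlim : Filter.Tendsto (fun t => Q.chartInv ε (curveAt c t))
      (nhdsWithin 0 {0}ᶜ) (nhds (Q.chartInv ε v)) := by
    refine Filter.Tendsto.mono_left ?_ nhdsWithin_le_nhds
    have := Q.continuousAt_chartInv (ε := ε) hd
    rw [← h0] at this ⊢
    exact ContinuousAt.comp (x := (0 : K)) this (continuous_curveAt _).continuousAt
  refine mem_closure_of_tendsto hlim ?_
  filter_upwards [e1, e2, e3, e4] with t h1 h2 h3 h4
  have hne : ∀ k, (2 * sg K (ε k) / (1 + curveAt c t k ⬝ᵥ curveAt c t k)) ≠ 0 := fun k =>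
    div_ne_zero (mul_ne_zero two_ne_zero (left_ne_zero_of_mul_eq_one (sg_mul_self K _)))
      (denom_ne_zero.1 h1 k)
  refine Q.mem_conjStandard hK hA hA' ?_ ?_ ?_
  all_goals simp only [chartInv, im_stereoInv (denom_ne_zero.1 h1 _), smul_dotProduct,
    dotProduct_smul, LinearMap.map_smul₂, LinearMap.map_smul, smul_eq_mul]
  · exact mul_ne_zero (hne 0) (mul_ne_zero (hne 0) h2)
  · exact mul_ne_zero (hne 1) (mul_ne_zero (hne 1) h3)
  · rw [LinearMap.smul_apply, smul_dotProduct, dotProduct_smul]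
    exact mul_ne_zero (hne 1) (mul_ne_zero (hne 1) (mul_ne_zero (hne 0) (mul_ne_zero (hne 0) h4)))

theorem dense_irreducible (hK : IsSpinField K) : Dense (Q.irreducible (m + 2)) := by
  obtain ⟨A, -, hA, hA'⟩ := hK.arc
  exact (Q.dense_conjStandard hK hA hA').mono (Q.conjStandard_subset hA)

/-- A set between a preconnected set and its closure is preconnected, and `conjStandard` is both
preconnected and dense. The same principle then yields the complement of the commuting tuples. -/
theorem isConnected_irreducible (hK : IsSpinField K) : IsConnected (Q.irreducible (m + 2)) := by
  obtain ⟨A, hAc, hA, hA'⟩ := hK.arc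
  have hd := Q.dense_conjStandard (m := m) hK hA hA'
  refine ⟨(Q.dense_irreducible hK).nonempty_iff.2 ⟨1⟩,
    (Q.isPreconnected_conjStandard hK hAc hA).subset_closure (Q.conjStandard_subset hA) ?_⟩
  rw [hd.closure_eq]; exact Set.subset_univ _

theorem irreducible_subset : Q.irreducible m ⊆ (Q.commuting m)ᶜ := by
  rintro z (⟨i, j, h⟩ | ⟨i, j, k, h⟩) hz
  · exact h (by rw [hz i j]; simp)
  · exact h (by rw [hz j k]; simp)

theorem isConnected_compl_commuting (hK : IsSpinField K) :
    IsConnected (Q.commuting (m + 2))ᶜ :=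
  (Q.isConnected_irreducible hK).subset_closure Q.irreducible_subset
    (by rw [(Q.dense_irreducible hK).closure_eq]; exact Set.subset_univ _)

end QuatModel

end SurfaceRep
end

noncomputable section
namespace SurfaceRep

/-! ### Dimension of the coaxial loci -/

section Algebra

variable {K : Type} [Field K]

theorem isAlgebraic_adjoin_of_generators {A : Type} [CommRing A] [IsDomain A] [Algebra K A]
    {S T : Set A} (hS : Algebra.adjoin K S = ⊤)
    (h : ∀ y ∈ S, ∃ q r : Algebra.adjoin K T, q ≠ 0 ∧ (q : A) * y ^ 2 = r) :
    Algebra.IsAlgebraic (Algebra.adjoin K T) A := by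
  have hle : Algebra.adjoin K S ≤
      (Subalgebra.algebraicClosure (Algebra.adjoin K T) A).restrictScalars K := by
    refine Algebra.adjoin_le fun y hy => ?_
    obtain ⟨q, r, hq, hqr⟩ := h y hy
    refine ⟨Polynomial.C q * Polynomial.X ^ 2 - Polynomial.C r, fun h0 => hq ?_, ?_⟩
    · simpa [Polynomial.coeff_C] using congrArg (fun p => Polynomial.coeff p 2) h0
    · simp only [map_sub, map_mul, map_pow, Polynomial.aeval_C, Polynomial.aeval_X]
      exact sub_eq_zero.2 hqr
  exact ⟨fun a => hle (by rw [hS]; trivial)⟩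

/-- A polynomial relation would vanish on all of `B^ι` with `B` infinite, hence identically. -/
theorem algebraicIndependent_of_surjOn {X ι : Type} {A : Subalgebra K (X → K)} (x : ι → A)
    {B : Set K} (hB : B.Infinite)
    (h : ∀ b : ι → K, (∀ i, b i ∈ B) → ∃ y : X, ∀ i, (x i : X → K) y = b i) :
    AlgebraicIndependent K x := by
  rw [algebraicIndependent_iff]
  intro p hp
  refine MvPolynomial.funext_set (fun _ => B) (fun _ => hB) fun b hb => ?_
  obtain ⟨y, hy⟩ := h b fun i => hb i trivial
  have h1 := congrArg (fun f : A => (f : X → K) y) hp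
  have h2 : ((Pi.evalAlgHom K (fun _ : X => K) y).comp A.val).comp (MvPolynomial.aeval x) =
      MvPolynomial.aeval b := by
    refine MvPolynomial.algHom_ext fun i => ?_
    simpa using hy i
  rw [map_zero, ← MvPolynomial.coe_aeval_eq_eval, RingHom.coe_coe, ← h2]
  exact h1

/-- Pulled back to `Y`, the algebra lies between `K[c]` and `K[c, s]`, and the latter is integral
over the former since `s² = 1 - c²`. So `B` is integral over a polynomial ring in `m` variables;
finite generation of `B` is not required, which suits rings of invariants. -/
theorem ringKrullDim_eq_of_sandwich {X Y : Type} {m : ℕ} (B : Subalgebra K (X → K))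
    (t : Fin m → X → K) (ht : ∀ k, t k ∈ B) (ψ : Y → X)
    (hinj : ∀ f ∈ B, f ∘ ψ = 0 → f = 0) (c s : Fin m → Y → K) (hc : ∀ k, t k ∘ ψ = c k)
    (hcs : ∀ k, s k ^ 2 = 1 - c k ^ 2)
    (hB : ∀ f ∈ B, f ∘ ψ ∈ Algebra.adjoin K (Set.range c ∪ Set.range s))
    {S : Set K} (hS : S.Infinite)
    (hsurj : ∀ b : Fin m → K, (∀ i, b i ∈ S) → ∃ y, ∀ i, c i y = b i) :
    ringKrullDim B = m := by
  let g : MvPolynomial (Fin m) K →ₐ[K] B := MvPolynomial.aeval fun k => ⟨t k, ht k⟩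
  have hg : Function.Injective g := by
    refine algebraicIndependent_of_surjOn (fun k => (⟨t k, ht k⟩ : B)) hS fun b hb => ?_
    obtain ⟨y, hy⟩ := hsurj b hb
    exact ⟨ψ y, fun i => (congrFun (hc i) y).trans (hy i)⟩
  let g' : MvPolynomial (Fin m) K →ₐ[K] (Y → K) := (pullback K ψ).comp (B.val.comp g)
  have hg' : ∀ k, g' (MvPolynomial.X k) = c k := fun k => by
    simp only [g', g, AlgHom.comp_apply, MvPolynomial.aeval_X]
    exact hc k
  have hint : ∀ f ∈ Algebra.adjoin K (Set.range c ∪ Set.range s), g'.toRingHom.IsIntegralElem f := by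
    intro f hf
    induction hf using Algebra.adjoin_induction with
    | mem f hf =>
      rcases hf with ⟨k, rfl⟩ | ⟨k, rfl⟩
      · rw [← hg' k]; exact RingHom.isIntegralElem_map _
      · refine ⟨Polynomial.X ^ 2 - Polynomial.C (1 - MvPolynomial.X k ^ 2),
          Polynomial.monic_X_pow_sub_C _ two_ne_zero, ?_⟩
        have : g'.toRingHom (MvPolynomial.X k) = c k := hg' k
        rw [Polynomial.eval₂_sub, Polynomial.eval₂_pow, Polynomial.eval₂_X, Polynomial.eval₂_C,
          map_sub, map_one, map_pow, this, sub_eq_zero]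
        exact funext fun y => congrFun (hcs k) y
    | algebraMap r =>
      have : g'.toRingHom (algebraMap K _ r) = algebraMap K (Y → K) r := g'.commutes r
      rw [← this]; exact RingHom.isIntegralElem_map _
    | add f f' _ _ hf hf' => exact hf.add _ hf'
    | mul f f' _ _ hf hf' => exact hf.mul _ hf'
  algebraize [g.toRingHom]
  have : Algebra.IsIntegral (MvPolynomial (Fin m) K) B := ⟨fun f => by
    obtain ⟨p, hp, hpf⟩ := hint _ (hB f.1 f.2)
    refine ⟨p, hp, Subtype.ext (hinj _ (Polynomial.eval₂ g.toRingHom f p).2 ?_)⟩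
    rw [← hpf]
    exact Polynomial.hom_eval₂ p g.toRingHom ((pullback K ψ).comp B.val).toRingHom f⟩
  rw [ringKrullDim_eq_of_isIntegral (MvPolynomial (Fin m) K) B hg,
    MvPolynomial.ringKrullDim_of_isNoetherianRing, ringKrullDim_eq_zero_of_field]
  simp

end Algebra

namespace QuatModel

variable {K G : Type} [RCLike K] [Group G] [TopologicalSpace G] (Q : QuatModel K G) {m : ℕ}

/-- For parallel vectors `(u·u) v_b² = u_b² (v·v)`, and `v·v = 1 - a²`. -/
theorem dot_mul_sq {u v : Fin 3 → K} (h : u ⨯₃ v = 0) {a : K} (hn : a ^ 2 + v ⬝ᵥ v = 1)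
    (b : Fin 3) : u ⬝ᵥ u * v b ^ 2 = u b ^ 2 * (1 - a ^ 2) := by
  have h1 := congrFun h 0
  have h2 := congrFun h 1
  have h3 := congrFun h 2
  simp only [vec3_dotProduct, cross_apply_zero, cross_apply_one, cross_apply_two,
    Pi.zero_apply] at hn h1 h2 h3 ⊢
  fin_cases b <;> simp only [Fin.zero_eta, Fin.mk_one, Fin.reduceFinMk] <;> grind

/-- The transcendence basis consists of the `m + 1` real parts and two coordinates of the first
imaginary part `n`. They are independent because generic values can be prescribed: the sphere
equation gives the third coordinate of `n`, and the other imaginary parts are taken to be multiples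
of `n` of the right length. The remaining generators are algebraic by `dot_mul_sq`, with nonzero
leading coefficient `q = n·n`. -/
theorem ringKrullDim_coordAlg (hK : IsSpinField K) {X : Type} (φ : X → Fin (m + 1) → G)
    (hφ : Set.range φ = Q.commuting (m + 1)) [IsDomain (Q.coordAlg φ)] :
    ringKrullDim (Q.coordAlg φ) = (m + 3 : ℕ) := by
  have hfg : (Q.coordAlg φ).FG := ⟨(Set.toFinite (Set.range (fun (s : Fin (m + 1)) x => Q.re (φ x s)) ∪
    Set.range fun (s : Fin (m + 1) × Fin 3) x => Q.im (φ x s.1) s.2)).toFinset, by simp [coordAlg]⟩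
  have : Algebra.FiniteType K (Q.coordAlg φ) := (Subalgebra.fg_iff_finiteType _).1 hfg
  let a : Fin (m + 1) → Q.coordAlg φ := fun k => ⟨_, Q.re_mem_coordAlg φ k⟩
  let p : Fin (m + 1) → Fin 3 → Q.coordAlg φ := fun k b => ⟨_, Q.im_mem_coordAlg φ k b⟩
  let x : Fin (m + 1) ⊕ Fin 2 → Q.coordAlg φ := Sum.elim a (fun b => p 0 b.castSucc)
  obtain ⟨B, hBi, hB⟩ := hK.box
  have hind : AlgebraicIndependent K x := by
    refine algebraicIndependent_of_surjOn x hBi fun b hb => ?_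
    have hsq : ∀ k, ∃ s, s ^ 2 = 1 - b (Sum.inl k) ^ 2 := fun k => by
      obtain ⟨⟨d, hd⟩, -⟩ := hB _ (hb (Sum.inl k)) _ (hb (Sum.inr 0)) _ (hb (Sum.inr 1))
      obtain ⟨s, hs⟩ := hK.sqrt 0 ![b (Sum.inr 0), b (Sum.inr 1), d]
      refine ⟨s, ?_⟩
      rw [hs, vec3_dotProduct]
      simp
      linear_combination hd
    choose s hs using hsq
    obtain ⟨⟨d, hd⟩, hne⟩ := hB _ (hb (Sum.inl 0)) _ (hb (Sum.inr 0)) _ (hb (Sum.inr 1))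
    have hs0 : s 0 ≠ 0 := by
      intro h; rw [← hs 0, h] at hne; simp at hne
    obtain ⟨n, hn0, hn1, hn2⟩ : ∃ n : Fin 3 → K, n 0 = b (Sum.inr 0) ∧ n 1 = b (Sum.inr 1) ∧
      n 2 = d := ⟨![b (Sum.inr 0), b (Sum.inr 1), d], rfl, rfl, rfl⟩
    have hn : n ⬝ᵥ n = s 0 ^ 2 := by
      rw [vec3_dotProduct, hn0, hn1, hn2, hs 0]; linear_combination hd
    have hz : ∀ k, b (Sum.inl k) ^ 2 + ((s k / s 0) • n) ⬝ᵥ ((s k / s 0) • n) = 1 := fun k => by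
      rw [smul_dotProduct, dotProduct_smul, hn]
      simp only [smul_eq_mul]
      field_simp
      rw [hs k]; ring
    obtain ⟨y, hy⟩ : (fun k => Q.ofCoords _ _ (hz k)) ∈ Set.range φ := by
      rw [hφ]
      intro i j
      rw [im_ofCoords, im_ofCoords, smul_cross_smul]
    refine ⟨y, ?_⟩
    rintro (k | k)
    · simp [x, a, hy]
    · simp only [x, p, hy, Sum.elim_inr, im_ofCoords, div_self hs0, one_smul]
      fin_cases k
      · exact hn0
      · exact hn1
  have hR : ∀ i, x i ∈ Algebra.adjoin K (Set.range x) := fun i => Algebra.subset_adjoin ⟨i, rfl⟩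
  let X' : Fin (m + 1) ⊕ Fin 2 → Algebra.adjoin K (Set.range x) := fun i => ⟨x i, hR i⟩
  let q : Algebra.adjoin K (Set.range x) := 1 - X' (Sum.inl 0) ^ 2
  let r : Fin 3 → Algebra.adjoin K (Set.range x) :=
    ![X' (Sum.inr 0) ^ 2, X' (Sum.inr 1) ^ 2, q - X' (Sum.inr 0) ^ 2 - X' (Sum.inr 1) ^ 2]
  have hq : q ≠ 0 := by
    intro h
    obtain ⟨b, hb⟩ := hBi.nonempty
    obtain ⟨⟨d, hd⟩, hne⟩ := hB _ hb _ hb _ hb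
    obtain ⟨n, hn0, hn1, hn2⟩ : ∃ n : Fin 3 → K, n 0 = b ∧ n 1 = b ∧
      n 2 = d := ⟨![b, b, d], rfl, rfl, rfl⟩
    have hz : b ^ 2 + n ⬝ᵥ n = 1 := by
      rw [vec3_dotProduct, hn0, hn1, hn2]; linear_combination hd
    obtain ⟨y, hy⟩ : (fun k => Q.ofCoords _ _ hz) ∈ Set.range φ := by
      rw [hφ]
      intro i j
      rw [cross_self]
    refine hne ?_
    have := congrFun (congrArg (fun f : Algebra.adjoin K (Set.range x) => ((f : Q.coordAlg φ) : X → K)) h) y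
    simpa [q, X', x, a, hy] using this
  have hqv : ∀ y, ((q : Q.coordAlg φ) : X → K) y = Q.im (φ y 0) ⬝ᵥ Q.im (φ y 0) := fun y => by
    have : ((q : Q.coordAlg φ) : X → K) y = 1 - Q.re (φ y 0) ^ 2 := rfl
    rw [this]; linear_combination -Q.norm_eq (φ y 0)
  have hrv : ∀ b y, ((r b : Q.coordAlg φ) : X → K) y = Q.im (φ y 0) b ^ 2 := fun b y => by
    fin_cases b
    · rfl
    · rfl
    · change ((q : Q.coordAlg φ) : X → K) y - Q.im (φ y 0) 0 ^ 2 - Q.im (φ y 0) 1 ^ 2 =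
        Q.im (φ y 0) 2 ^ 2
      rw [hqv, vec3_dotProduct]; ring
  refine ringKrullDim_eq_of_isAlgebraic (ι := Fin (m + 1) ⊕ Fin 2) (by simp) hind
    (isAlgebraic_adjoin_of_generators (Algebra.adjoin_adjoin_coe_preimage) ?_)
  rintro ⟨y, hy'⟩ (⟨k, rfl⟩ | ⟨⟨k, b⟩, rfl⟩)
  · exact ⟨1, X' (Sum.inl k) ^ 2, fun h => hq (by rw [← one_mul q, h, zero_mul]), one_mul _⟩
  · refine ⟨q, r b * (1 - X' (Sum.inl k) ^ 2), hq, Subtype.ext (funext fun y => ?_)⟩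
    change ((q : Q.coordAlg φ) : X → K) y * Q.im (φ y k) b ^ 2 =
      ((r b : Q.coordAlg φ) : X → K) y * (1 - Q.re (φ y k) ^ 2)
    rw [hqv, hrv]
    have h : φ y ∈ Q.commuting (m + 1) := hφ ▸ ⟨y, rfl⟩
    exact dot_mul_sq (h 0 k) (Q.norm_eq (φ y k)) b

/-! ### Dimension of the coaxial locus in the quotient, by restriction to a torus -/

theorem continuous_of_mem_coordAlg {X ι : Type} [TopologicalSpace X] {φ : X → ι → G}
    (hφ : ∀ s, Continuous fun x => φ x s) {f : X → K} (hf : f ∈ Q.coordAlg φ) : Continuous f := by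
  induction hf using Algebra.adjoin_induction with
  | mem f hf =>
    rcases hf with ⟨s, rfl⟩ | ⟨s, rfl⟩
    · exact Q.continuous_re.comp (hφ s)
    · exact (continuous_apply s.2).comp (Q.continuous_im.comp (hφ s.1))
  | algebraMap r => exact continuous_const
  | add f f' _ _ hf hf' => exact hf.add hf'
  | mul f f' _ _ hf hf' => exact hf.mul hf'

/-- The standard torus. -/
def torus (y : Fin m → {c : K × K | c.1 ^ 2 + c.2 ^ 2 = 1}) : Fin m → G := fun k =>
  Q.ofCoords (y k).1.1 ((y k).1.2 • ![1, 0, 0]) (circle_norm e1_dot (y k).2)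

theorem torus_mem_commuting (y : Fin m → {c : K × K | c.1 ^ 2 + c.2 ^ 2 = 1}) :
    Q.torus y ∈ Q.commuting m := by
  intro i j
  rw [torus, torus, im_ofCoords, im_ofCoords, smul_cross_smul]

theorem eq_zero_of_torus (hK : IsSpinField K) {f : (Fin m → G) → K} (hf : Continuous f)
    (hinv : ∀ (x : G) z, f (fun k => x * z k * x⁻¹) = f z) (h0 : ∀ y, f (Q.torus y) = 0)
    {z : Fin m → G} (hz : z ∈ Q.commuting m) : f z = 0 := by
  have hcl : IsClosed {z | f z = 0} := isClosed_eq hf continuous_const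
  refine closure_minimal (s := Q.conjTorus m) ?_ hcl (Q.commuting_subset_closure hK hz)
  rintro _ ⟨y, rfl⟩
  exact (hinv y.1 (Q.torus y.2)).trans (h0 y.2)

/-- Conjugates of the torus are dense among commuting tuples, so restriction to the torus is
injective on invariant functions. It turns real parts into the cosines `c_k` and all regular
functions into polynomials in `c_k, s_k`, and the sandwich lemma applies. -/
theorem ringKrullDim_of_invariant (hK : IsSpinField K) {X : Type} (B : Subalgebra K (X → K))
    (p : (Fin m → G) → X) (hB : ∀ f ∈ B, f ∘ p ∈ Q.coordAlg (id : (Fin m → G) → _))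
    (hinv : ∀ (x : G) z, p (fun k => x * z k * x⁻¹) = p z)
    (hB' : ∀ k, ∃ f ∈ B, ∀ z, f (p z) = Q.re (z k)) :
    ringKrullDim (B.map (pullback K (Subtype.val : (p '' Q.commuting m) → X))) = m := by
  choose t ht htp using hB'
  let ψ : (Fin m → {c : K × K | c.1 ^ 2 + c.2 ^ 2 = 1}) → (p '' Q.commuting m) := fun y =>
    ⟨p (Q.torus y), _, Q.torus_mem_commuting y, rfl⟩
  obtain ⟨S, hSi, hS⟩ := hK.box
  refine ringKrullDim_eq_of_sandwich (Y := Fin m → {c : K × K | c.1 ^ 2 + c.2 ^ 2 = 1}) _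
    (fun k => t k ∘ Subtype.val) (fun k => ⟨t k, ht k, rfl⟩) ψ ?_ (fun k y => (y k).1.1)
    (fun k y => (y k).1.2) (fun k => funext fun y => ?_) (fun k => funext fun y => ?_) ?_ hSi ?_
  · rintro _ ⟨f, hf, rfl⟩ h0
    funext ⟨_, z, hz, rfl⟩
    have hfp := hB f hf
    exact Q.eq_zero_of_torus hK (f := f ∘ p)
      (Q.continuous_of_mem_coordAlg (fun s => continuous_apply s) hfp)
      (fun x z => congrArg f (hinv x z)) (fun y => congrFun h0 y) hz
  · change t k (p (Q.torus y)) = _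
    rw [htp, torus, re_ofCoords]
  · have := (y k).2
    simp only [Set.mem_ofPred_eq] at this
    simp only [Pi.pow_apply, Pi.sub_apply, Pi.one_apply]
    linear_combination this
  · rintro _ ⟨f, hf, rfl⟩
    have h1 : (f ∘ p) ∘ Q.torus ∈ Q.coordAlg (Q.torus (m := m)) := by
      have := Q.map_coordAlg (id : (Fin m → G) → _) (Q.torus (m := m))
      rw [Function.id_comp] at this
      rw [← this]
      exact ⟨_, hB f hf, rfl⟩
    refine Algebra.adjoin_le ?_ h1
    rintro _ (⟨k, rfl⟩ | ⟨⟨k, b⟩, rfl⟩)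
    · simp only [torus, re_ofCoords]
      exact Algebra.subset_adjoin (Or.inl ⟨k, rfl⟩)
    · simp only [torus, im_ofCoords, Pi.smul_apply, smul_eq_mul]
      refine mul_mem (Algebra.subset_adjoin (Or.inr ⟨k, rfl⟩)) ?_
      exact Subalgebra.algebraMap_mem _ (![1, 0, 0] b : K)
  · intro b hb
    have hsq : ∀ k, ∃ s, b k ^ 2 + s ^ 2 = 1 := fun k => by
      obtain ⟨⟨d, hd⟩, -⟩ := hS _ (hb k) _ (hb k) _ (hb k)
      obtain ⟨s, hs⟩ := hK.sqrt 0 ![b k, b k, d]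
      refine ⟨s, ?_⟩
      rw [hs, vec3_dotProduct]
      simp
      linear_combination hd
    choose s hs using hsq
    exact ⟨fun k => ⟨(b k, s k), hs k⟩, fun k => rfl⟩

end QuatModel

end SurfaceRep
end

noncomputable section
namespace SurfaceRep

/-! ### Manifolds given by families of charts, and quotient manifolds -/

section Charts

open Filter Topology

/-- The charted space defined by a family of charts. -/
@[reducible] def chartedSpaceOfFamily {H M ι : Type} [TopologicalSpace H] [TopologicalSpace M]
    (e : ι → OpenPartialHomeomorph M H) (i : M → ι) (h : ∀ x, x ∈ (e (i x)).source) :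
    ChartedSpace H M where
  atlas := Set.range e
  chartAt x := e (i x)
  mem_chart_source := h
  chart_mem_atlas x := ⟨i x, rfl⟩

variable {K : Type} [RCLike K] {E F : Type} [NormedAddCommGroup E] [NormedSpace K E]
  [NormedAddCommGroup F] [NormedSpace K F]

theorem isManifold_of_transitions {M : Type} [TopologicalSpace M] [ChartedSpace E M]
    (h : ∀ e ∈ atlas E M, ∀ e' ∈ atlas E M, ∀ y ∈ (e.symm.trans e').source,
      ContDiffAt K ∞ (e.symm.trans e') y) : IsManifold 𝓘(K, E) ∞ M := by
  refine isManifold_of_contDiffOn _ _ _ fun e e' he he' => ?_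
  simp only [modelWithCornersSelf_coe, modelWithCornersSelf_coe_symm, Set.range_id, Set.inter_univ,
    Set.preimage_id, Function.id_comp, Function.comp_id]
  exact fun y hy => (h e he e' he' y hy).contDiffWithinAt

theorem contMDiffAt_iff_charts {M N : Type} [TopologicalSpace M] [ChartedSpace E M]
    [TopologicalSpace N] [ChartedSpace F N] {f : M → N} {x : M} :
    ContMDiffAt 𝓘(K, E) 𝓘(K, F) ∞ f x ↔ ContinuousAt f x ∧
      ContDiffAt K ∞ (chartAt F (f x) ∘ f ∘ (chartAt E x).symm) (chartAt E x x) := by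
  rw [contMDiffAt_iff]
  simp [extChartAt, OpenPartialHomeomorph.extend, contDiffWithinAt_univ]

theorem mfderiv_eq_fderiv_charts {M N : Type} [TopologicalSpace M] [ChartedSpace E M]
    [TopologicalSpace N] [ChartedSpace F N] {f : M → N} {x : M}
    (hf : ContMDiffAt 𝓘(K, E) 𝓘(K, F) ∞ f x) : mfderiv 𝓘(K, E) 𝓘(K, F) f x =
      fderiv K (chartAt F (f x) ∘ f ∘ (chartAt E x).symm) (chartAt E x x) := by
  refine (hf.mdifferentiableAt (by simp)).mfderiv.trans ?_
  simp [writtenInExtChartAt, extChartAt, OpenPartialHomeomorph.extend, fderivWithin_univ]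
  rfl

variable [FiniteDimensional K E] [FiniteDimensional K F]

/-- A submersion has a local section. -/
theorem exists_local_section {f : E → F} {a : E} (hf : ContDiffAt K ∞ f a)
    (hs : Function.Surjective (fderiv K f a)) :
    ∃ s : F → E, ContDiffAt K ∞ s (f a) ∧ s (f a) = a ∧ ∀ᶠ y in 𝓝 (f a), f (s y) = y := by
  have := FiniteDimensional.complete K F
  obtain ⟨r, hr⟩ := (fderiv K f a).exists_rightInverse_of_surjective (LinearMap.range_eq_top.2 hs)
  let u : F → E := fun y => a + r (y - f a)
  have hu : ContDiff K ∞ u := contDiff_const.add (r.contDiff.comp (contDiff_id.sub contDiff_const))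
  have hua : u (f a) = a := by simp [u]
  have hu' : HasFDerivAt u r (f a) := by
    have h := HasFDerivAt.comp (g := r) (f := fun y => y - f a) (f a) r.hasFDerivAt
      ((hasFDerivAt_id (𝕜 := K) (f a)).sub_const (f a))
    rw [ContinuousLinearMap.comp_id] at h
    exact h.const_add a
  have hfu : ContDiffAt K ∞ (f ∘ u) (f a) := ContDiffAt.comp _ (by rwa [hua]) hu.contDiffAt
  have hfu' : HasFDerivAt (f ∘ u) ((ContinuousLinearEquiv.refl K F : F ≃L[K] F) : F →L[K] F) (f a) := by
    have h := HasFDerivAt.comp (f a) (by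
      rw [hua]; exact (hf.differentiableAt (by simp)).hasFDerivAt) hu'
    rw [hr] at h
    exact h
  refine ⟨u ∘ hfu.localInverse hfu' (by simp), ?_, ?_, ?_⟩
  · have h := hfu.to_localInverse hfu' (by simp)
    simp only [Function.comp_apply, hua] at h
    exact hu.contDiffAt.comp _ h
  · have h := hfu.localInverse_apply_image hfu' (by simp)
    simp only [Function.comp_apply, hua] at h
    simp [h, hua]
  · have h := (hfu.hasStrictFDerivAt' hfu' (by simp)).eventually_right_inverse
    simp only [Function.comp_apply, hua] at h
    exact h

/-- A locally open injective map on an open set is a chart. -/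
def chartOfInjOn {X Y : Type} [TopologicalSpace X] [TopologicalSpace Y] [Nonempty X] (f : X → Y)
    (S : Set X) (hS : IsOpen S) (hi : S.InjOn f) (h : ∀ x ∈ S, map f (𝓝 x) = 𝓝 (f x)) :
    OpenPartialHomeomorph X Y :=
  OpenPartialHomeomorph.ofContinuousOpenRestrict (hi.toPartialEquiv f S)
    (fun x hx => ContinuousAt.continuousWithinAt (h x hx).le)
    (IsOpenMap.of_nhds_le fun x => by
      have h1 := hS.isOpenEmbedding_subtypeVal.map_nhds_eq x
      have h2 := h x.1 x.2
      rw [← h1, Filter.map_map] at h2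
      exact h2.ge) hS

theorem map_nhds_eq_of_submersion {M : Type} [TopologicalSpace M] (e : OpenPartialHomeomorph M E)
    {f : M → F} {x : M} (hx : x ∈ e.source) (hf : ContDiffAt K ∞ (f ∘ e.symm) (e x))
    (hs : Function.Surjective (fderiv K (f ∘ e.symm) (e x))) : map f (𝓝 x) = 𝓝 (f x) := by
  have := FiniteDimensional.complete K E
  have := FiniteDimensional.complete K F
  have h := (hf.hasStrictFDerivAt (by simp)).map_nhds_eq_of_surj (LinearMap.range_eq_top.2 hs)
  rw [← e.map_nhds_eq hx, Filter.map_map, Function.comp_apply, e.left_inv hx] at h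
  rw [← h]
  refine Filter.map_congr ?_
  filter_upwards [e.open_source.mem_nhds hx] with y hy
  simp [e.left_inv hy]

/-- The data of quotient charts on an open quotient `p : M → T` of a manifold: functions `φ k` on
saturated open sets `U k` that are submersions, the fibres of which are those of `p`. -/
structure QuotientCharts (K : Type) [RCLike K] (E F : Type) [NormedAddCommGroup E] [NormedSpace K E]
    [NormedAddCommGroup F] [NormedSpace K F] {M T ι : Type} [TopologicalSpace M] [TopologicalSpace T]
    [ChartedSpace E M] (p : M → T) (U : ι → Set M) (φ : ι → M → F) : Prop where
  isOpenQuotientMap : IsOpenQuotientMap p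
  isOpen : ∀ k, IsOpen (U k)
  exists_mem : ∀ x, ∃ k, x ∈ U k
  mem_of_eq : ∀ k x y, x ∈ U k → p x = p y → y ∈ U k
  eq_iff : ∀ k x y, x ∈ U k → y ∈ U k → (φ k x = φ k y ↔ p x = p y)
  contDiffAt : ∀ k x, x ∈ U k → ∀ e ∈ atlas E M, x ∈ e.source → ContDiffAt K ∞ (φ k ∘ e.symm) (e x)
  surjective : ∀ k x, x ∈ U k → ∀ e ∈ atlas E M, x ∈ e.source →
    Function.Surjective (fderiv K (φ k ∘ e.symm) (e x))

namespace QuotientCharts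

variable {M T ι : Type} [TopologicalSpace M] [TopologicalSpace T] [ChartedSpace E M] {p : M → T}
  {U : ι → Set M} {φ : ι → M → F}

section

omit [FiniteDimensional K E] [FiniteDimensional K F]

/-- The function on the quotient induced by `φ k`. -/
def descend (h : QuotientCharts K E F p U φ) (k : ι) (t : T) : F :=
  φ k (Function.surjInv h.isOpenQuotientMap.surjective t)

theorem descend_apply (h : QuotientCharts K E F p U φ) {k : ι} {x : M} (hx : x ∈ U k) :
    h.descend k (p x) = φ k x := by
  have e := Function.surjInv_eq h.isOpenQuotientMap.surjective (p x)
  exact (h.eq_iff k _ _ (h.mem_of_eq k x _ hx e.symm) hx).2 e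

theorem injOn_descend (h : QuotientCharts K E F p U φ) (k : ι) :
    (p '' U k).InjOn (h.descend k) := by
  rintro _ ⟨x, hx, rfl⟩ _ ⟨y, hy, rfl⟩ hxy
  rw [h.descend_apply hx, h.descend_apply hy] at hxy
  exact (h.eq_iff k x y hx hy).1 hxy

end

theorem map_nhds_descend (h : QuotientCharts K E F p U φ) (k : ι) :
    ∀ t ∈ p '' U k, map (h.descend k) (𝓝 t) = 𝓝 (h.descend k t) := by
  rintro _ ⟨x, hx, rfl⟩
  rw [← h.isOpenQuotientMap.map_nhds_eq, Filter.map_map, h.descend_apply hx,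
    ← map_nhds_eq_of_submersion (chartAt E x) (mem_chart_source E x)
      (h.contDiffAt k x hx _ (chart_mem_atlas E x) (mem_chart_source E x))
      (h.surjective k x hx _ (chart_mem_atlas E x) (mem_chart_source E x))]
  refine Filter.map_congr ?_
  filter_upwards [(h.isOpen k).mem_nhds hx] with y hy
  exact h.descend_apply hy

variable [Nonempty T]

/-- The charts of the quotient. -/
def chart (h : QuotientCharts K E F p U φ) (k : ι) : OpenPartialHomeomorph T F :=
  chartOfInjOn (h.descend k) (p '' U k) (h.isOpenQuotientMap.isOpenMap _ (h.isOpen k))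
    (h.injOn_descend k) (h.map_nhds_descend k)

theorem chart_apply (h : QuotientCharts K E F p U φ) {k : ι} {x : M} (hx : x ∈ U k) :
    h.chart k (p x) = φ k x := h.descend_apply hx

theorem chart_symm_apply (h : QuotientCharts K E F p U φ) {k : ι} {x : M} (hx : x ∈ U k) :
    (h.chart k).symm (φ k x) = p x := by
  rw [← h.chart_apply hx]
  exact (h.chart k).left_inv ⟨x, hx, rfl⟩

theorem exists_of_mem_source (h : QuotientCharts K E F p U φ) {k l : ι} {y : F}
    (hy : y ∈ ((h.chart k).symm.trans (h.chart l)).source) : ∃ x ∈ U k ∩ U l, φ k x = y := by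
  obtain ⟨hy1, hy2⟩ := hy
  obtain ⟨x, hx, hxt⟩ : (h.chart k).symm y ∈ p '' U k := (h.chart k).map_target hy1
  obtain ⟨x', hx', hxt'⟩ : (h.chart k).symm y ∈ p '' U l := hy2
  refine ⟨x, ⟨hx, h.mem_of_eq l x' x hx' (hxt'.trans hxt.symm)⟩, ?_⟩
  rw [← h.chart_apply hx, hxt]
  exact (h.chart k).right_inv hy1

/-- Composing `φ l` with a local section of the submersion `φ k` expresses the transition as a
smooth map; the derivative formula is the chain rule for `transition ∘ φ k = φ l`. -/
theorem transition (h : QuotientCharts K E F p U φ) {k l : ι} {x : M} (hx : x ∈ U k ∩ U l)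
    {e : OpenPartialHomeomorph M E} (he : e ∈ atlas E M) (hxe : x ∈ e.source) :
    ContDiffAt K ∞ ((h.chart k).symm.trans (h.chart l)) (φ k x) ∧
      (fderiv K ((h.chart k).symm.trans (h.chart l)) (φ k x)).comp (fderiv K (φ k ∘ e.symm) (e x)) =
        fderiv K (φ l ∘ e.symm) (e x) := by
  obtain ⟨s, hs, hsa, hsr⟩ := exists_local_section (h.contDiffAt k x hx.1 e he hxe)
    (h.surjective k x hx.1 e he hxe)
  have hfe : (φ k ∘ e.symm) (e x) = φ k x := by simp [e.left_inv hxe]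
  rw [hfe] at hs hsa hsr
  have hU : ∀ᶠ v in 𝓝 (e x), e.symm v ∈ U k ∩ U l := by
    refine (e.continuousAt_symm (e.map_source hxe)).eventually_mem ?_
    rw [e.left_inv hxe]
    exact ((h.isOpen k).inter (h.isOpen l)).mem_nhds hx
  have h1 : (h.chart k).symm.trans (h.chart l) ∘ φ k ∘ e.symm =ᶠ[𝓝 (e x)] φ l ∘ e.symm := by
    filter_upwards [hU] with v hv
    simp only [Function.comp_apply, OpenPartialHomeomorph.coe_trans]
    rw [h.chart_symm_apply hv.1, h.chart_apply hv.2]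
  have h2 : ⇑((h.chart k).symm.trans (h.chart l)) =ᶠ[𝓝 (φ k x)] (φ l ∘ e.symm) ∘ s := by
    have ht : Tendsto s (𝓝 (φ k x)) (𝓝 (e x)) := by
      have := hs.continuousAt
      rwa [ContinuousAt, hsa] at this
    filter_upwards [hsr, ht.eventually h1] with y hy hy1
    simp only [Function.comp_apply] at hy hy1 ⊢
    rw [← hy1, hy]
  have h3 : ContDiffAt K ∞ ((h.chart k).symm.trans (h.chart l)) (φ k x) :=
    (ContDiffAt.comp _ (by rw [hsa]; exact h.contDiffAt l x hx.2 e he hxe) hs).congr_of_eventuallyEq h2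
  refine ⟨h3, ?_⟩
  rw [← h1.fderiv_eq, fderiv_comp _ (by rw [hfe]; exact h3.differentiableAt (by simp))
    ((h.contDiffAt k x hx.1 e he hxe).differentiableAt (by simp)), hfe]

/-- The differential of `φ k` is onto, so it determines the derivative `L` of the transition.
Orientedness can therefore be required upstairs, in any one chart of `M` around each point. -/
theorem exists_chartedSpace [NormedSpace ℝ F] [IsScalarTower ℝ K F]
    (h : QuotientCharts K E F p U φ)
    (hor : ∀ k l x, x ∈ U k ∩ U l → ∃ e ∈ atlas E M, x ∈ e.source ∧ ∀ L : F →L[K] F,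
      L.comp (fderiv K (φ k ∘ e.symm) (e x)) = fderiv K (φ l ∘ e.symm) (e x) →
        0 < (L.restrictScalars ℝ).det) :
    ∃ _ : ChartedSpace F T, IsManifold 𝓘(K, F) ∞ T ∧ IsOrientedAtlas F T ∧
      IsSmoothSubmersion K E F p := by
  choose i hi using fun t => h.exists_mem (Function.surjInv h.isOpenQuotientMap.surjective t)
  letI c : ChartedSpace F T := chartedSpaceOfFamily h.chart i fun t =>
    ⟨_, hi t, Function.surjInv_eq h.isOpenQuotientMap.surjective t⟩
  refine ⟨c, isManifold_of_transitions ?_, ?_, ?_⟩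
  · rintro _ ⟨k, rfl⟩ _ ⟨l, rfl⟩ y hy
    obtain ⟨x, hx, rfl⟩ := h.exists_of_mem_source hy
    exact (h.transition hx (chart_mem_atlas E x) (mem_chart_source E x)).1
  · rintro _ ⟨k, rfl⟩ _ ⟨l, rfl⟩ y hy
    obtain ⟨x, hx, rfl⟩ := h.exists_of_mem_source hy
    obtain ⟨e, he, hxe, hL⟩ := hor k l x hx
    obtain ⟨h1, h2⟩ := h.transition hx he hxe
    rw [(h1.differentiableAt (by simp)).fderiv_restrictScalars ℝ]
    exact hL _ h2
  · have key : ∀ x, ∃ k, x ∈ U k ∧ chartAt F (p x) ∘ p ∘ (chartAt E x).symm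
        =ᶠ[𝓝 (chartAt E x x)] φ k ∘ (chartAt E x).symm := fun x => by
      have hx : x ∈ U (i (p x)) :=
        h.mem_of_eq _ _ x (hi (p x)) (Function.surjInv_eq h.isOpenQuotientMap.surjective _)
      refine ⟨i (p x), hx, ?_⟩
      have : ∀ᶠ v in 𝓝 (chartAt E x x), (chartAt E x).symm v ∈ U (i (p x)) := by
        refine ((chartAt E x).continuousAt_symm (mem_chart_target E x)).eventually_mem ?_
        rw [(chartAt E x).left_inv (mem_chart_source E x)]
        exact (h.isOpen _).mem_nhds hx
      filter_upwards [this] with v hv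
      exact h.chart_apply hv
    have hsm : ContMDiff 𝓘(K, E) 𝓘(K, F) ∞ p := fun x => by
      obtain ⟨k, hk, hke⟩ := key x
      exact contMDiffAt_iff_charts.2 ⟨h.isOpenQuotientMap.continuous.continuousAt,
        (h.contDiffAt k x hk _ (chart_mem_atlas E x) (mem_chart_source E x)).congr_of_eventuallyEq hke⟩
    refine ⟨hsm, fun x => ?_⟩
    obtain ⟨k, hk, hke⟩ := key x
    rw [mfderiv_eq_fderiv_charts (hsm x), hke.fderiv_eq]
    exact h.surjective k x hk _ (chart_mem_atlas E x) (mem_chart_source E x)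

end QuotientCharts

end Charts

end SurfaceRep
end

noncomputable section
namespace SurfaceRep

/-! ### Rotation invariants of tuples of vectors -/

section Frame

variable {K : Type} [RCLike K] {m : ℕ}

/-- Rotation invariants of a tuple of vectors, the first two of which are in general position. -/
def frameInv (v : Fin (m + 2) → Fin 3 → K) : Fin (m + 1) → Fin 3 → K :=
  Fin.cons ![v 0 ⬝ᵥ v 0, v 0 ⬝ᵥ v 1, v 1 ⬝ᵥ v 1] fun k : Fin m =>
    ![v k.succ.succ ⬝ᵥ v 0, v k.succ.succ ⬝ᵥ v 1, v k.succ.succ ⬝ᵥ (v 0 ⨯₃ v 1)]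

/-- The Gram determinant of the first two vectors. -/
def frameDet (v : Fin (m + 2) → Fin 3 → K) : K := (v 0 ⨯₃ v 1) ⬝ᵥ (v 0 ⨯₃ v 1)

theorem frameInv_eq_iff {v w : Fin (m + 2) → Fin 3 → K} : frameInv v = frameInv w ↔
    (v 0 ⬝ᵥ v 0 = w 0 ⬝ᵥ w 0 ∧ v 0 ⬝ᵥ v 1 = w 0 ⬝ᵥ w 1 ∧ v 1 ⬝ᵥ v 1 = w 1 ⬝ᵥ w 1) ∧
    ∀ k : Fin m, v k.succ.succ ⬝ᵥ v 0 = w k.succ.succ ⬝ᵥ w 0 ∧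
      v k.succ.succ ⬝ᵥ v 1 = w k.succ.succ ⬝ᵥ w 1 ∧
      v k.succ.succ ⬝ᵥ (v 0 ⨯₃ v 1) = w k.succ.succ ⬝ᵥ (w 0 ⨯₃ w 1) := by
  rw [frameInv, frameInv, Fin.cons_inj, funext_iff (β := fun _ => Fin 3 → K)]
  simp [Matrix.vecCons_inj]

theorem frameInv_rot {a : K} {p : Fin 3 → K} (h : a ^ 2 + p ⬝ᵥ p = 1)
    (v : Fin (m + 2) → Fin 3 → K) : frameInv (fun k => rot a p (v k)) = frameInv v := by
  rw [frameInv_eq_iff]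
  simp [rot_cross h, rot_dot h]

theorem frameDet_rot {a : K} {p : Fin 3 → K} (h : a ^ 2 + p ⬝ᵥ p = 1)
    (v : Fin (m + 2) → Fin 3 → K) : frameDet (fun k => rot a p (v k)) = frameDet v := by
  simp [frameDet, rot_cross h, rot_dot h]

theorem exists_rot_of_frameInv_eq (hs : ∀ (a : K) (p : Fin 3 → K), ∃ s, s ^ 2 = a ^ 2 + p ⬝ᵥ p)
    {v w : Fin (m + 2) → Fin 3 → K} (hv : frameDet v ≠ 0) (h : frameInv v = frameInv w) :
    ∃ a p, a ^ 2 + p ⬝ᵥ p = 1 ∧ w = fun k => rot a p (v k) := by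
  obtain ⟨⟨h1, h2, h3⟩, hR⟩ := frameInv_eq_iff.1 h
  obtain ⟨a, p, hap, hrot⟩ := exists_rot_of_gram_eq hs two_ne_zero h1 h2 h3 hv
  refine ⟨a, p, hap, funext fun k => ?_⟩
  refine Fin.cases ?_ (fun k => Fin.cases ?_ (fun k => ?_) k) k
  · exact hrot _ _ h1 h2 (by rw [dot_self_cross, dot_self_cross])
  · exact hrot _ _ (by rw [dotProduct_comm, Fin.succ_zero_eq_one, h2, dotProduct_comm]) h3
      (by rw [Fin.succ_zero_eq_one, dot_cross_self, dot_cross_self])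
  · exact hrot _ _ (hR k).1 (hR k).2.1 (hR k).2.2

theorem contDiff_frameInv : ContDiff K ∞ (frameInv : (Fin (m + 2) → Fin 3 → K) → _) := by
  refine contDiff_pi.2 fun k => contDiff_pi.2 fun b => ?_
  refine Fin.cases ?_ (fun k => ?_) k
  · fin_cases b <;> simp [frameInv, vec3_dotProduct] <;> fun_prop
  · fin_cases b <;> simp [frameInv, vec3_dotProduct, cross_apply_zero, cross_apply_one,
      cross_apply_two] <;> fun_prop

theorem continuous_frameDet : Continuous (frameDet : (Fin (m + 2) → Fin 3 → K) → _) := by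
  have h : Continuous fun v : Fin (m + 2) → Fin 3 → K => frameDet v := by
    simp only [frameDet, vec3_dotProduct, cross_apply_zero, cross_apply_one, cross_apply_two]
    fun_prop
  exact h

/-- Along a line each component of `frameInv` is a polynomial of degree at most 3, whose linear
coefficient is the directional derivative. -/
theorem hasDerivAt_cubic {f : K → K} {b c d : K} (h : ∀ t, f t = f 0 + t * b + t ^ 2 * c + t ^ 3 * d) :
    HasDerivAt f b 0 := by
  have e : f = fun t => f 0 + t * b + t ^ 2 * c + t ^ 3 * d := funext h
  rw [e]
  have h1 := (((hasDerivAt_id (0 : K)).mul_const b).const_add (f 0)).add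
    (((hasDerivAt_pow 2 (0 : K)).mul_const c).add ((hasDerivAt_pow 3 (0 : K)).mul_const d))
  refine (h1.congr_deriv (by simp)).congr_of_eventuallyEq (Filter.Eventually.of_forall fun t => ?_)
  simp only [Pi.add_apply, id]
  ring

/-- The derivative of the rotation invariants. -/
theorem fderiv_frameInv (v δ : Fin (m + 2) → Fin 3 → K) : fderiv K frameInv v δ =
    (Fin.cons ![2 * (v 0 ⬝ᵥ δ 0), v 0 ⬝ᵥ δ 1 + δ 0 ⬝ᵥ v 1, 2 * (v 1 ⬝ᵥ δ 1)] fun k : Fin m =>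
      ![δ k.succ.succ ⬝ᵥ v 0 + v k.succ.succ ⬝ᵥ δ 0, δ k.succ.succ ⬝ᵥ v 1 + v k.succ.succ ⬝ᵥ δ 1,
        δ k.succ.succ ⬝ᵥ (v 0 ⨯₃ v 1) + v k.succ.succ ⬝ᵥ (δ 0 ⨯₃ v 1 + v 0 ⨯₃ δ 1)] :
      Fin (m + 1) → Fin 3 → K) := by
  have h1 : HasDerivAt (fun t : K => frameInv (v + t • δ)) (fderiv K frameInv v δ) 0 := by
    have h2 : HasDerivAt (fun t : K => v + t • δ) δ 0 := by
      simpa using ((hasDerivAt_id (0 : K)).smul_const δ).const_add v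
    have h3 : HasFDerivAt frameInv (fderiv K frameInv v) (v + (0 : K) • δ) := by
      rw [zero_smul, add_zero]
      exact (contDiff_frameInv.differentiable (by simp) v).hasFDerivAt
    exact h3.comp_hasDerivAt (0 : K) h2
  refine h1.unique ?_
  rw [hasDerivAt_pi]
  refine fun k => hasDerivAt_pi.2 fun b => ?_
  refine Fin.cases ?_ (fun k => ?_) k
  · fin_cases b
    · refine hasDerivAt_cubic (c := δ 0 ⬝ᵥ δ 0) (d := 0) fun t => ?_
      simp [frameInv, vec3_dotProduct]; ring
    · refine hasDerivAt_cubic (c := δ 0 ⬝ᵥ δ 1) (d := 0) fun t => ?_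
      simp [frameInv, vec3_dotProduct]; ring
    · refine hasDerivAt_cubic (c := δ 1 ⬝ᵥ δ 1) (d := 0) fun t => ?_
      simp [frameInv, vec3_dotProduct]; ring
  · fin_cases b
    · refine hasDerivAt_cubic (c := δ k.succ.succ ⬝ᵥ δ 0) (d := 0) fun t => ?_
      simp [frameInv, vec3_dotProduct]; ring
    · refine hasDerivAt_cubic (c := δ k.succ.succ ⬝ᵥ δ 1) (d := 0) fun t => ?_
      simp [frameInv, vec3_dotProduct]; ring
    · refine hasDerivAt_cubic (c := δ k.succ.succ ⬝ᵥ (δ 0 ⨯₃ v 1 + v 0 ⨯₃ δ 1) +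
        v k.succ.succ ⬝ᵥ (δ 0 ⨯₃ δ 1)) (d := δ k.succ.succ ⬝ᵥ (δ 0 ⨯₃ δ 1)) fun t => ?_
      simp [frameInv, vec3_dotProduct, cross_apply_zero, cross_apply_one, cross_apply_two]; ring

/-- The dual frame of `P`, `Q`, `P × Q`. -/
theorem exists_dual {P Q : Fin 3 → K} (h : (P ⨯₃ Q) ⬝ᵥ (P ⨯₃ Q) ≠ 0) (a b c : K) :
    ∃ R : Fin 3 → K, R ⬝ᵥ P = a ∧ R ⬝ᵥ Q = b ∧ R ⬝ᵥ (P ⨯₃ Q) = c := by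
  refine ⟨((P ⨯₃ Q) ⬝ᵥ (P ⨯₃ Q))⁻¹ • (a • (Q ⨯₃ (P ⨯₃ Q)) + b • ((P ⨯₃ Q) ⨯₃ P) +
    c • (P ⨯₃ Q)), ?_, ?_, ?_⟩ <;>
  · rw [smul_dotProduct, smul_eq_mul, inv_mul_eq_iff_eq_mul₀ h]
    simp only [vec3_dotProduct, cross_apply_zero, cross_apply_one, cross_apply_two, Pi.add_apply,
      Pi.smul_apply, smul_eq_mul]
    ring

/-- The dual frame of `v 0`, `v 1`, `v 0 × v 1` allows the equations to be solved for the variations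
of the first two vectors and then for each further vector separately. -/
theorem surjective_fderiv_frameInv {v : Fin (m + 2) → Fin 3 → K} (hv : frameDet v ≠ 0) :
    Function.Surjective (fderiv K frameInv v) := by
  intro y
  -- The halves come from `d(v·v) = 2 v·δ`; the mixed product `y 0 1` is produced by `δQ` alone.
  obtain ⟨δP, h1, h2, -⟩ := exists_dual hv (y 0 0 / 2) 0 0
  obtain ⟨δQ, h3, h4, -⟩ := exists_dual hv (y 0 1) (y 0 2 / 2) 0
  choose R hR1 hR2 hR3 using fun k : Fin m => exists_dual hv
    (y k.succ 0 - v k.succ.succ ⬝ᵥ δP) (y k.succ 1 - v k.succ.succ ⬝ᵥ δQ)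
    (y k.succ 2 - v k.succ.succ ⬝ᵥ (δP ⨯₃ v 1 + v 0 ⨯₃ δQ))
  refine ⟨Fin.cons δP (Fin.cons δQ R), ?_⟩
  rw [fderiv_frameInv]
  have e0 : (Fin.cons δP (Fin.cons δQ R : Fin (m + 1) → Fin 3 → K) :
    Fin (m + 2) → Fin 3 → K) 1 = δQ := rfl
  funext k b
  refine Fin.cases ?_ (fun k => ?_) k
  · rw [Fin.cons_zero, Fin.cons_zero, e0]
    fin_cases b
    · change 2 * (v 0 ⬝ᵥ δP) = _
      rw [dotProduct_comm, h1]; simp only [Fin.zero_eta]; ring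
    · change v 0 ⬝ᵥ δQ + δP ⬝ᵥ v 1 = _
      rw [dotProduct_comm, h3, h2, add_zero]; rfl
    · change 2 * (v 1 ⬝ᵥ δQ) = _
      rw [dotProduct_comm, h4]; simp only [Fin.reduceFinMk]; ring
  · simp only [Fin.cons_succ, Fin.cons_zero, e0, hR1, hR2, hR3, sub_add_cancel]
    fin_cases b <;> rfl

/-- The variation `ξ × v` is an infinitesimal rotation, and `frameInv` is constant on rotation
orbits. -/
theorem fderiv_frameInv_cross (v : Fin (m + 2) → Fin 3 → K) (ξ : Fin 3 → K) :
    fderiv K frameInv v (fun k => ξ ⨯₃ v k) = 0 := by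
  rw [fderiv_frameInv]
  funext k b
  refine Fin.cases ?_ (fun k => ?_) k
  · fin_cases b <;> simp [vec3_dotProduct, cross_apply_zero, cross_apply_one, cross_apply_two] <;> ring
  · fin_cases b <;> simp [vec3_dotProduct, cross_apply_zero, cross_apply_one, cross_apply_two] <;> ring

/-! ### Linear changes of a tuple that put a nondegenerate pair first -/

/-- Linear automorphisms of the space of tuples of vectors that mix the vectors. -/
def Mixing (K : Type) [RCLike K] (m : ℕ) : Type :=
  {A : (Fin m → Fin 3 → K) ≃L[K] (Fin m → Fin 3 → K) //
    ∀ (L : (Fin 3 → K) →ₗ[K] (Fin 3 → K)) v k, A (fun l => L (v l)) k = L (A v k)}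

theorem exists_perm_pair {i j : Fin (m + 2)} (hij : i ≠ j) :
    ∃ s : Equiv.Perm (Fin (m + 2)), s 0 = i ∧ s 1 = j := by
  refine ⟨Equiv.swap (Equiv.swap 0 i 1) j * Equiv.swap 0 i, ?_, by simp⟩
  simp only [Equiv.Perm.mul_apply, Equiv.swap_apply_left]
  refine Equiv.swap_apply_of_ne_of_ne (fun h => ?_) hij
  have := (Equiv.swap (0 : Fin (m + 2)) i).injective ((Equiv.swap_apply_left _ _).trans h)
  exact absurd this (by simp)

/-- Permutation of the vectors. -/
def Mixing.perm (s : Equiv.Perm (Fin m)) : Mixing K m :=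
  ⟨(LinearEquiv.funCongrLeft K (Fin 3 → K) s).toContinuousLinearEquiv, fun _ _ _ => rfl⟩

theorem Mixing.perm_apply (s : Equiv.Perm (Fin m)) (v : Fin m → Fin 3 → K) (k : Fin m) :
    (Mixing.perm s).1 v k = v (s k) := rfl

/-- Composition of mixings. -/
def Mixing.comp (B A : Mixing K m) : Mixing K m :=
  ⟨A.1.trans B.1, fun L v k => by
    rw [ContinuousLinearEquiv.trans_apply, ContinuousLinearEquiv.trans_apply,
      show A.1 (fun l => L (v l)) = fun l => L (A.1 v l) from funext (A.2 L v), B.2]⟩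

theorem exists_mixing_add (l : Fin (m + 2)) (hl : l ≠ 1) :
    ∃ A : Mixing K (m + 2), ∀ v, A.1 v 0 = v 0 ∧ A.1 v 1 = v 1 + v l := by
  let T : K → (Fin (m + 2) → Fin 3 → K) →ₗ[K] (Fin (m + 2) → Fin 3 → K) := fun c =>
    { toFun := fun v k => v k + (if k = 1 then c else 0) • v l
      map_add' := fun v w => by funext k; simp only [Pi.add_apply, smul_add]; abel
      map_smul' := fun r v => by
        funext k; simp only [Pi.smul_apply, smul_add, smul_comm _ r, RingHom.id_apply] }
  have hT : ∀ c d, c + d = 0 → (T c).comp (T d) = LinearMap.id := fun c d hcd => by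
    refine LinearMap.ext fun v => funext fun k => ?_
    simp only [T, LinearMap.comp_apply, LinearMap.coe_mk, AddHom.coe_mk, hl, if_false, zero_smul,
      add_zero, LinearMap.id_apply]
    split_ifs
    · rw [add_assoc, ← add_smul, add_comm d, hcd, zero_smul, add_zero]
    · simp
  refine ⟨⟨(LinearEquiv.ofLinearMap (T 1) (T (-1)) (hT _ _ (by simp))
    (hT _ _ (by simp))).toContinuousLinearEquiv, fun L v k => ?_⟩, fun v => ⟨?_, ?_⟩⟩
  · change L (v k) + (if k = 1 then (1 : K) else 0) • L (v l) =
      L (v k + (if k = 1 then (1 : K) else 0) • v l)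
    rw [map_add, map_smul]
  · change v 0 + (if (0 : Fin (m + 2)) = 1 then (1 : K) else 0) • v l = _
    simp
  · change v 1 + (if (1 : Fin (m + 2)) = 1 then (1 : K) else 0) • v l = _
    simp

/-- Tuples of vectors that span a nondegenerate plane or the whole space. -/
def Spanning {ι : Type} (v : ι → Fin 3 → K) : Prop :=
  (∃ i j, (v i ⨯₃ v j) ⬝ᵥ (v i ⨯₃ v j) ≠ 0) ∨ ∃ i j k, v i ⬝ᵥ (v j ⨯₃ v k) ≠ 0

/-- Expanding `u` in the basis dual to `u, v, w` and pairing with `v × w` writes the square of the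
triple product through the products of the three cross products. If their squares vanish, as can
happen over ℂ, some mixed product does not. -/
theorem exists_cross_dot_ne_zero {u v w : Fin 3 → K} (h : u ⬝ᵥ (v ⨯₃ w) ≠ 0)
    (huv : (u ⨯₃ v) ⬝ᵥ (u ⨯₃ v) = 0) (huw : (u ⨯₃ w) ⬝ᵥ (u ⨯₃ w) = 0)
    (hvw : (v ⨯₃ w) ⬝ᵥ (v ⨯₃ w) = 0) :
    (u ⨯₃ v) ⬝ᵥ (u ⨯₃ w) ≠ 0 ∨ (v ⨯₃ u) ⬝ᵥ (v ⨯₃ w) ≠ 0 ∨ (w ⨯₃ u) ⬝ᵥ (w ⨯₃ v) ≠ 0 := by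
  by_contra! hne
  obtain ⟨h1, h2, h3⟩ := hne
  have h4 : (u ⬝ᵥ (v ⨯₃ w)) ^ 2 = (u ⬝ᵥ u) * ((v ⨯₃ w) ⬝ᵥ (v ⨯₃ w)) +
      (u ⬝ᵥ v) * ((w ⨯₃ u) ⬝ᵥ (v ⨯₃ w)) + (u ⬝ᵥ w) * ((u ⨯₃ v) ⬝ᵥ (v ⨯₃ w)) := by
    simp only [vec3_dotProduct, cross_apply_zero, cross_apply_one, cross_apply_two]
    ring
  have h5 : (w ⨯₃ u) ⬝ᵥ (v ⨯₃ w) = -((w ⨯₃ u) ⬝ᵥ (w ⨯₃ v)) := by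
    rw [← cross_anticomm v w, dotProduct_neg, neg_neg]
  have h6 : (u ⨯₃ v) ⬝ᵥ (v ⨯₃ w) = -((v ⨯₃ u) ⬝ᵥ (v ⨯₃ w)) := by
    rw [← cross_anticomm u v, neg_dotProduct, neg_neg]
  rw [hvw, h5, h6, h2, h3] at h4
  exact h (pow_eq_zero_iff two_ne_zero |>.1 (h4.trans (by simp)))

/-- If every pair is degenerate, the square of `v_i × (v_j + v_k)` equals `2 (v_i × v_j)·(v_i ×
v_k)`, which is nonzero for some choice of indices. Permuting the vectors and adding one to another
therefore suffices. -/
theorem Spanning.exists_mixing {v : Fin (m + 2) → Fin 3 → K} (h : Spanning v) :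
    ∃ A : Mixing K (m + 2), frameDet (A.1 v) ≠ 0 := by
  by_cases h2 : ∃ i j, (v i ⨯₃ v j) ⬝ᵥ (v i ⨯₃ v j) ≠ 0
  · obtain ⟨i, j, hij⟩ := h2
    obtain ⟨s, hs0, hs1⟩ := exists_perm_pair (i := i) (j := j) (by rintro rfl; simp at hij)
    exact ⟨Mixing.perm s, by rwa [frameDet, Mixing.perm_apply, Mixing.perm_apply, hs0, hs1]⟩
  obtain ⟨i, j, k, hijk⟩ := h.resolve_left h2
  push Not at h2
  have key : ∀ i j k, (v i ⨯₃ v j) ⬝ᵥ (v i ⨯₃ v k) ≠ 0 →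
      ∃ A : Mixing K (m + 2), frameDet (A.1 v) ≠ 0 := by
    intro i j k hne
    have hij : i ≠ j := by rintro rfl; simp at hne
    have hjk : k ≠ j := by rintro rfl; exact hne (h2 _ _)
    have hik : k ≠ i := by rintro rfl; simp at hne
    obtain ⟨s, hs0, hs1⟩ := exists_perm_pair hij
    obtain ⟨B, hB⟩ := exists_mixing_add (K := K) (s.symm k) (fun h => hjk (by
      rw [← hs1, ← h, Equiv.apply_symm_apply]))
    refine ⟨B.comp (Mixing.perm s), ?_⟩
    have h0 : (B.comp (Mixing.perm s)).1 v 0 = v i := by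
      rw [← hs0]; exact (hB _).1
    have h1 : (B.comp (Mixing.perm s)).1 v 1 = v j + v k := by
      refine (hB _).2.trans ?_
      have e : (Mixing.perm s).1 v (s.symm k) = v k := by
        rw [Mixing.perm_apply, Equiv.apply_symm_apply]
      have e' : (Mixing.perm s).1 v 1 = v j := by rw [Mixing.perm_apply, hs1]
      exact congrArg₂ (· + ·) e' e
    rw [frameDet, h0, h1, map_add, add_dotProduct, dotProduct_add, dotProduct_add, h2, h2,
      dotProduct_comm (v i ⨯₃ v k), zero_add, add_zero, ← two_mul]
    exact mul_ne_zero two_ne_zero hne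
  rcases exists_cross_dot_ne_zero hijk (h2 _ _) (h2 _ _) (h2 _ _) with h | h | h
  exacts [key _ _ _ h, key _ _ _ h, key _ _ _ h]

end Frame

end SurfaceRep
end

noncomputable section
namespace SurfaceRep

/-! ### Inversions and orientations -/

section Inversion

variable {K : Type} [RCLike K] {m : ℕ}

/-- The inversion of `K³`, composed with the antipodal map. -/
def inversion (u : Fin 3 → K) : Fin 3 → K := -((u ⬝ᵥ u)⁻¹ • u)

/-- The derivative of the inversion. -/
def inversionDeriv (u : Fin 3 → K) : (Fin 3 → K) →ₗ[K] (Fin 3 → K) where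
  toFun δ := (-(u ⬝ᵥ u)⁻¹) • δ + (2 * ((u ⬝ᵥ u)⁻¹) ^ 2 * (u ⬝ᵥ δ)) • u
  map_add' δ η := by rw [dotProduct_add]; module
  map_smul' r δ := by rw [dotProduct_smul, RingHom.id_apply, smul_eq_mul]; module

theorem inversionDeriv_apply (u δ : Fin 3 → K) : inversionDeriv u δ =
    (-(u ⬝ᵥ u)⁻¹) • δ + (2 * ((u ⬝ᵥ u)⁻¹) ^ 2 * (u ⬝ᵥ δ)) • u := rfl

theorem contDiffAt_inversion {u : Fin 3 → K} (hu : u ⬝ᵥ u ≠ 0) :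
    ContDiffAt K ∞ (inversion : (Fin 3 → K) → _) u := by
  have h1 : ContDiff K ∞ fun v : Fin 3 → K => v ⬝ᵥ v := by
    simp only [vec3_dotProduct]; fun_prop
  exact ((h1.contDiffAt.inv hu).smul contDiffAt_id).neg

theorem hasFDerivAt_inversion {u : Fin 3 → K} (hu : u ⬝ᵥ u ≠ 0) :
    HasFDerivAt (inversion : (Fin 3 → K) → _) (LinearMap.toContinuousLinearMap (inversionDeriv u)) u := by
  have h0 := ((contDiffAt_inversion hu).differentiableAt (by simp)).hasFDerivAt
  refine h0.congr_fderiv (ContinuousLinearMap.ext fun δ => ?_)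
  have h2 : HasDerivAt (fun t : K => u + t • δ) δ 0 := by
    simpa using ((hasDerivAt_id (0 : K)).smul_const δ).const_add u
  have h1 : HasDerivAt (fun t : K => inversion (u + t • δ))
      (fderiv K inversion u δ) 0 := by
    have h3 : HasFDerivAt inversion (fderiv K inversion u) (u + (0 : K) • δ) := by
      rwa [zero_smul, add_zero]
    exact HasFDerivAt.comp_hasDerivAt (l := inversion) (f := fun t : K => u + t • δ) (0 : K) h3 h2
  have hq : HasDerivAt (fun t : K => (u + t • δ) ⬝ᵥ (u + t • δ)) (2 * (u ⬝ᵥ δ)) 0 :=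
    hasDerivAt_cubic (c := δ ⬝ᵥ δ) (d := 0) fun t => by simp [vec3_dotProduct]; ring
  have h4 := ((hq.inv (by simpa using hu)).smul h2).neg
  refine h1.unique (h4.congr_deriv ?_)
  simp only [zero_smul, add_zero, LinearMap.coe_toContinuousLinearMap', inversionDeriv_apply,
    Pi.inv_apply]
  rw [neg_add, ← neg_smul, ← neg_smul]
  congr 2
  field_simp

/-- The derivative is `-(u·u)⁻¹` times the reflection in the plane orthogonal to `u`. The antipodal
map cancels the sign of the reflection, so over ℝ the determinant is positive. -/
theorem det_inversionDeriv {u : Fin 3 → K} (hu : u ⬝ᵥ u ≠ 0) :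
    LinearMap.det (inversionDeriv u) = (u ⬝ᵥ u)⁻¹ ^ 3 := by
  rw [← LinearMap.det_toMatrix', Matrix.det_fin_three]
  simp only [LinearMap.toMatrix'_apply, inversionDeriv_apply, Pi.add_apply, Pi.smul_apply, smul_eq_mul,
    dotProduct_single, Pi.single_apply, Fin.reduceEq, if_true, if_false, mul_one, mul_zero, zero_add]
  have h := inv_mul_cancel₀ hu
  set i := (u ⬝ᵥ u)⁻¹
  rw [vec3_dotProduct] at h
  linear_combination 2 * i ^ 3 * h

/-- The transition functions between stereographic charts. -/
def chartChange (b : Fin m → Bool) (v : Fin m → Fin 3 → K) : Fin m → Fin 3 → K :=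
  fun k => if b k then inversion (v k) else v k

/-- The derivative of a transition function. -/
def chartChangeDeriv (b : Fin m → Bool) (v : Fin m → Fin 3 → K) :
    (Fin m → Fin 3 → K) →L[K] (Fin m → Fin 3 → K) :=
  LinearMap.toContinuousLinearMap (LinearMap.pi fun k =>
    (if b k then inversionDeriv (v k) else LinearMap.id).comp (LinearMap.proj k))

theorem chartChangeDeriv_apply (b : Fin m → Bool) (v δ : Fin m → Fin 3 → K) (k : Fin m) :
    chartChangeDeriv b v δ k = if b k then inversionDeriv (v k) (δ k) else δ k := by
  change (if b k then inversionDeriv (v k) else LinearMap.id) (δ k) = _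
  split_ifs <;> rfl

theorem contDiffAt_chartChange {b : Fin m → Bool} {v : Fin m → Fin 3 → K}
    (h : ∀ k, b k → v k ⬝ᵥ v k ≠ 0) : ContDiffAt K ∞ (chartChange b) v := by
  refine contDiffAt_pi.2 fun k => ?_
  by_cases hb : b k
  · simp only [chartChange, hb, if_true]
    exact ContDiffAt.comp (g := inversion) (f := fun w : Fin m → Fin 3 → K => w k) v
      (contDiffAt_inversion (h k hb)) (contDiff_apply K (Fin 3 → K) k).contDiffAt
  · simp only [chartChange, hb]
    exact (contDiff_apply K (Fin 3 → K) k).contDiffAt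

theorem hasFDerivAt_chartChange {b : Fin m → Bool} {v : Fin m → Fin 3 → K}
    (h : ∀ k, b k → v k ⬝ᵥ v k ≠ 0) : HasFDerivAt (chartChange b) (chartChangeDeriv b v) v := by
  refine hasFDerivAt_pi'' fun k => ?_
  by_cases hb : b k
  · have h1 := HasFDerivAt.comp (g := inversion) (f := fun w : Fin m → Fin 3 → K => w k) v
      (hasFDerivAt_inversion (h k hb)) (hasFDerivAt_apply k v)
    refine (h1.congr_fderiv (ContinuousLinearMap.ext fun δ => ?_)).congr_of_eventuallyEq
      (Filter.Eventually.of_forall fun w => ?_)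
    · change inversionDeriv (v k) (δ k) = chartChangeDeriv b v δ k
      rw [chartChangeDeriv_apply, if_pos hb]
    · simp [chartChange, hb]
  · refine ((hasFDerivAt_apply k v).congr_fderiv (ContinuousLinearMap.ext fun δ => ?_)).congr_of_eventuallyEq
      (Filter.Eventually.of_forall fun w => ?_)
    · change δ k = chartChangeDeriv b v δ k
      rw [chartChangeDeriv_apply, if_neg hb]
    · simp [chartChange, hb]

theorem det_chartChangeDeriv {b : Fin m → Bool} {v : Fin m → Fin 3 → K}
    (h : ∀ k, b k → v k ⬝ᵥ v k ≠ 0) :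
    (chartChangeDeriv b v).det = ∏ k, if b k then (v k ⬝ᵥ v k)⁻¹ ^ 3 else 1 := by
  refine (LinearMap.det_pi _).trans (Finset.prod_congr rfl fun k _ => ?_)
  split_ifs with hb
  · exact det_inversionDeriv (h k hb)
  · exact LinearMap.det_id

theorem surjective_of_det_ne_zero {V : Type} [NormedAddCommGroup V] [NormedSpace K V]
    [FiniteDimensional K V] {f : V →L[K] V} (hf : f.det ≠ 0) : Function.Surjective f := by
  have h : IsUnit (f : V →ₗ[K] V) := (LinearMap.isUnit_iff_isUnit_det _).2 (Ne.isUnit hf)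
  exact ((Module.End.isUnit_iff _).1 h).2

theorem det_ne_zero_of_surjective {V : Type} [NormedAddCommGroup V] [NormedSpace K V]
    [FiniteDimensional K V] {f : V →L[K] V} (hf : Function.Surjective f) : f.det ≠ 0 := by
  refine IsUnit.ne_zero ((LinearMap.isUnit_iff_isUnit_det (f : V →ₗ[K] V)).1
    ((Module.End.isUnit_iff _).2 ⟨?_, hf⟩))
  exact LinearMap.injective_iff_surjective.2 hf

theorem det_chartChangeDeriv_ne_zero {b : Fin m → Bool} {v : Fin m → Fin 3 → K}
    (h : ∀ k, b k → v k ⬝ᵥ v k ≠ 0) : (chartChangeDeriv b v).det ≠ 0 := by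
  rw [det_chartChangeDeriv h]
  refine Finset.prod_ne_zero_iff.2 fun k _ => ?_
  split_ifs with hb
  · exact pow_ne_zero _ (inv_ne_zero (h k hb))
  · exact one_ne_zero

/-- Change of the sign of the first vector. -/
def signScale (τ : ℤˣ) : (Fin (m + 1) → Fin 3 → K) ≃L[K] (Fin (m + 1) → Fin 3 → K) :=
  (LinearEquiv.ofInvolutive (LinearMap.pi fun k => (if k = 0 then sg K τ else 1) •
      LinearMap.proj (R := K) (φ := fun _ : Fin (m + 1) => Fin 3 → K) k) fun v => funext fun k => by
    simp only [LinearMap.pi_apply, LinearMap.smul_apply, LinearMap.proj_apply]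
    split_ifs <;> simp [smul_smul, sg_mul_self]).toContinuousLinearEquiv

theorem signScale_apply (τ : ℤˣ) (v : Fin (m + 1) → Fin 3 → K) (k : Fin (m + 1)) :
    signScale τ v k = (if k = 0 then sg K τ else 1) • v k := rfl

/-- Auxiliary sets that are used to select an oriented atlas among the charts of the quotient. -/
structure OrientingSets (K : Type) [RCLike K] (m : ℕ)
    (W : Mixing K (m + 2) → ℤˣ → Set (Fin (m + 2) → Fin 3 → K)) : Prop where
  isOpen : ∀ A τ, IsOpen (W A τ)
  rot_mem : ∀ A τ a p, a ^ 2 + p ⬝ᵥ p = 1 → ∀ v ∈ W A τ, (fun k => rot a p (v k)) ∈ W A τ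
  exists_mem : ∀ A v, frameDet (A.1 v) ≠ 0 → ∃ τ, v ∈ W A τ
  det : ∀ A A' τ τ' b v, (∀ k, 1 + v k ⬝ᵥ v k ≠ 0) → (∀ k, b k → v k ⬝ᵥ v k ≠ 0) →
    frameDet (A.1 v) ≠ 0 → frameDet (A'.1 (chartChange b v)) ≠ 0 → v ∈ W A τ →
    chartChange b v ∈ W A' τ' → ∀ L : (Fin (m + 1) → Fin 3 → K) →L[K] (Fin (m + 1) → Fin 3 → K),
    (∀ δ, L (signScale τ (fderiv K frameInv (A.1 v) (A.1 δ))) =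
      signScale τ' (fderiv K frameInv (A'.1 (chartChange b v)) (A'.1 (chartChangeDeriv b v δ)))) →
    ∃ s, s ≠ 0 ∧ L.det = s ^ 2

/-- The map `L` is onto because the differentials involved are, and a nonzero complex number is a
square. No chart has to be discarded. -/
theorem orientingSets_complex : OrientingSets ℂ m fun _ _ => Set.univ where
  isOpen _ _ := isOpen_univ
  rot_mem _ _ _ _ _ _ _ := trivial
  exists_mem _ _ _ := ⟨1, trivial⟩
  det A A' τ τ' b v _ hb _ hA' _ _ L hL := by
    have hs : Function.Surjective L := by
      intro y
      obtain ⟨δ, hδ⟩ := surjective_of_det_ne_zero (det_chartChangeDeriv_ne_zero hb)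
        (A'.1.symm (surjective_fderiv_frameInv hA' ((signScale τ').symm y)).choose)
      refine ⟨_, (hL δ).trans ?_⟩
      rw [hδ, A'.1.apply_symm_apply,
        (surjective_fderiv_frameInv hA' ((signScale τ').symm y)).choose_spec,
        (signScale τ').apply_symm_apply]
    have hd := det_ne_zero_of_surjective hs
    obtain ⟨s, hs⟩ := IsAlgClosed.exists_pow_nat_eq L.det two_pos
    exact ⟨s, by rintro rfl; exact hd (by rw [← hs]; simp), hs.symm⟩

end Inversion

end SurfaceRep
end

noncomputable section
namespace SurfaceRep

/-! ### The orientation of the real quotient -/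

section Orientation

variable {m : ℕ}

/-- A form that is invariant under rotations and under inversions. -/
def orientForm (v : Fin m → Fin 3 → ℝ) : (Fin m → Fin 3 → ℝ) →ₗ[ℝ] (Fin 3 → ℝ) :=
  ∑ k, ((1 + v k ⬝ᵥ v k)⁻¹ ^ 2) • (crossProduct (v k)).comp (LinearMap.proj k)

theorem orientForm_apply (v δ : Fin m → Fin 3 → ℝ) :
    orientForm v δ = ∑ k, ((1 + v k ⬝ᵥ v k)⁻¹ ^ 2) • (v k ⨯₃ δ k) := by
  simp [orientForm, LinearMap.sum_apply]

theorem dot_self_nonneg (u : Fin 3 → ℝ) : 0 ≤ u ⬝ᵥ u := by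
  rw [vec3_dotProduct]; nlinarith [mul_self_nonneg (u 0), mul_self_nonneg (u 1), mul_self_nonneg (u 2)]

theorem one_add_dot_self_pos (u : Fin 3 → ℝ) : 0 < 1 + u ⬝ᵥ u := by
  linarith [dot_self_nonneg u]

/-- With `q = u·u`, inversion replaces `q` by `1/q` and multiplies `u × δ` by `q⁻²`. The weight `(1
+ q)⁻²` in `orientForm` is chosen to compensate this factor. -/
theorem inversion_cross {u : Fin 3 → ℝ} (hu : u ⬝ᵥ u ≠ 0) (δ : Fin 3 → ℝ) :
    ((1 + inversion u ⬝ᵥ inversion u)⁻¹ ^ 2) • (inversion u ⨯₃ inversionDeriv u δ) =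
      ((1 + u ⬝ᵥ u)⁻¹ ^ 2) • (u ⨯₃ δ) := by
  have h1 : inversion u ⬝ᵥ inversion u = (u ⬝ᵥ u)⁻¹ := by
    rw [inversion, neg_dotProduct, dotProduct_neg, neg_neg, smul_dotProduct, dotProduct_smul]
    simp only [smul_eq_mul]
    field_simp
  have h2 : inversion u ⨯₃ inversionDeriv u δ = ((u ⬝ᵥ u)⁻¹ ^ 2) • (u ⨯₃ δ) := by
    rw [inversionDeriv_apply, inversion, map_add, LinearMap.map_smul, LinearMap.map_smul, map_neg,
      LinearMap.neg_apply, LinearMap.neg_apply, LinearMap.map_smul₂, LinearMap.map_smul₂, cross_self]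
    module
  rw [h1, h2, smul_smul]
  congr 1
  have h3 := (one_add_dot_self_pos u).ne'
  generalize u ⬝ᵥ u = q at *
  rw [show 1 + q⁻¹ = (1 + q) * q⁻¹ by field_simp; ring]
  field_simp

theorem orientForm_chartChange {b : Fin m → Bool} {v : Fin m → Fin 3 → ℝ}
    (h : ∀ k, b k → v k ⬝ᵥ v k ≠ 0) (δ : Fin m → Fin 3 → ℝ) :
    orientForm (chartChange b v) (chartChangeDeriv b v δ) = orientForm v δ := by
  rw [orientForm_apply, orientForm_apply]
  refine Finset.sum_congr rfl fun k _ => ?_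
  rw [chartChangeDeriv_apply, chartChange]
  split_ifs with hb
  · exact inversion_cross (h k hb) _
  · rfl

theorem orientForm_rot {a : ℝ} {p : Fin 3 → ℝ} (h : a ^ 2 + p ⬝ᵥ p = 1) (v δ : Fin m → Fin 3 → ℝ) :
    orientForm (fun k => rot a p (v k)) (fun k => rot a p (δ k)) = rot a p (orientForm v δ) := by
  rw [orientForm_apply, orientForm_apply, map_sum]
  simp only [rot_dot h, rot_cross h, map_smul]

theorem det_rot {a : ℝ} {p : Fin 3 → ℝ} (h : a ^ 2 + p ⬝ᵥ p = 1) : LinearMap.det (rot a p) = 1 := by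
  have h3 : (a ^ 2 + p ⬝ᵥ p) ^ 3 = 1 := by rw [h, one_pow]
  rw [← LinearMap.det_toMatrix', Matrix.det_fin_three, ← h3]
  simp only [LinearMap.toMatrix'_apply, rot_apply, Pi.add_apply, Pi.smul_apply, smul_eq_mul,
    dotProduct_single, Pi.single_apply, Fin.reduceEq, if_true, if_false, mul_one, mul_zero, zero_add,
    cross_apply_zero, cross_apply_one, cross_apply_two, vec3_dotProduct, sub_zero, zero_sub, add_zero]
  ring

theorem det_consMap (R : (Fin 3 → ℝ) →ₗ[ℝ] (Fin 3 → ℝ))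
    (L : (Fin (m + 1) → Fin 3 → ℝ) →ₗ[ℝ] (Fin (m + 1) → Fin 3 → ℝ))
    (C : (Fin (m + 2) → Fin 3 → ℝ) →ₗ[ℝ] (Fin (m + 2) → Fin 3 → ℝ))
    (hC : ∀ x y, C (Fin.cons x y) = Fin.cons (R x) (L y)) :
    LinearMap.det C = LinearMap.det R * LinearMap.det L := by
  rw [← LinearMap.det_prodMap, ← LinearMap.det_conj (R.prodMap L)
    (Fin.consLinearEquiv ℝ (fun _ : Fin (m + 2) => Fin 3 → ℝ))]
  congr 1
  refine LinearMap.ext fun v => ?_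
  obtain ⟨⟨x, y⟩, rfl⟩ := (Fin.consLinearEquiv ℝ (fun _ : Fin (m + 2) => Fin 3 → ℝ)).surjective v
  simp only [LinearMap.comp_apply, LinearEquiv.coe_coe, LinearEquiv.symm_apply_apply,
    LinearMap.prodMap_apply]
  exact hC x y

/-- The derivative of the rotation invariants, completed by the orientation form. -/
def orientMap (A : Mixing ℝ (m + 2)) (τ : ℤˣ) (v : Fin (m + 2) → Fin 3 → ℝ) :
    (Fin (m + 2) → Fin 3 → ℝ) →L[ℝ] (Fin (m + 2) → Fin 3 → ℝ) :=
  LinearMap.toContinuousLinearMap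
    ((Fin.consLinearEquiv ℝ (fun _ : Fin (m + 2) => Fin 3 → ℝ)).toLinearMap.comp
      ((orientForm v).prod ((signScale τ : (Fin (m + 1) → Fin 3 → ℝ) ≃L[ℝ] _).toLinearMap.comp
        ((fderiv ℝ frameInv (A.1 v)).toLinearMap.comp A.1.toLinearMap))))

theorem orientMap_apply (A : Mixing ℝ (m + 2)) (τ : ℤˣ) (v δ : Fin (m + 2) → Fin 3 → ℝ) :
    orientMap A τ v δ =
      Fin.cons (orientForm v δ) (signScale τ (fderiv ℝ frameInv (A.1 v) (A.1 δ))) := rfl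

/-- By equivariance, rotating all vectors before `orientMap` amounts to rotating only the first
component after it; both operations have determinant 1. -/
theorem orientMap_rot {a : ℝ} {p : Fin 3 → ℝ} (h : a ^ 2 + p ⬝ᵥ p = 1) (A : Mixing ℝ (m + 2)) (τ : ℤˣ)
    (v : Fin (m + 2) → Fin 3 → ℝ) :
    (orientMap A τ (fun k => rot a p (v k))).det = (orientMap A τ v).det := by
  let ρ : (Fin (m + 2) → Fin 3 → ℝ) →ₗ[ℝ] (Fin (m + 2) → Fin 3 → ℝ) :=
    LinearMap.pi fun k => (rot a p).comp (LinearMap.proj k)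
  have hρ : LinearMap.det ρ = 1 := (LinearMap.det_pi _).trans (by simp [det_rot h])
  let ρc := LinearMap.toContinuousLinearMap ρ
  let C : (Fin (m + 2) → Fin 3 → ℝ) →ₗ[ℝ] (Fin (m + 2) → Fin 3 → ℝ) :=
    LinearMap.pi (Fin.cons ((rot a p).comp (LinearMap.proj 0)) fun k => LinearMap.proj k.succ)
  have hC : LinearMap.det C = 1 := by
    rw [det_consMap (rot a p) LinearMap.id C, det_rot h, LinearMap.det_id, one_mul]
    intro x y
    funext k
    refine Fin.cases ?_ (fun k => ?_) k <;> simp [C]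
  have hA : ∀ w : Fin (m + 2) → Fin 3 → ℝ, A.1 (ρ w) = ρ (A.1 w) := fun w => funext (A.2 (rot a p) w)
  have hf : ∀ w δ : Fin (m + 2) → Fin 3 → ℝ,
      fderiv ℝ frameInv (ρ w) (ρ δ) = fderiv ℝ frameInv w δ := by
    intro w δ
    have h1 : frameInv ∘ ρc = (frameInv : (Fin (m + 2) → Fin 3 → ℝ) → _) := funext fun w => frameInv_rot h w
    have h2 := fderiv_comp w (g := frameInv) (f := ρc) (contDiff_frameInv.differentiable (by simp) _)
      ρc.differentiableAt
    rw [h1, ρc.fderiv] at h2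
    rw [h2]; rfl
  have key : (orientMap A τ (ρ v)).toLinearMap.comp ρ = C.comp (orientMap A τ v).toLinearMap := by
    refine LinearMap.ext fun δ => ?_
    simp only [LinearMap.comp_apply, ContinuousLinearMap.coe_coe]
    rw [orientMap_apply, orientMap_apply, hA, hA, hf]
    funext k
    refine Fin.cases ?_ (fun k => ?_) k
    · exact congrFun (congrArg (fun x => (Fin.cons x _ : Fin (m + 2) → Fin 3 → ℝ)) (orientForm_rot h v δ)) 0
    · rfl
  have := congrArg LinearMap.det key
  rw [LinearMap.det_comp, LinearMap.det_comp, hρ, hC, mul_one, one_mul] at this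
  exact this

theorem cross_eq_zero_of_frame {ξ P Q : Fin 3 → ℝ} (hP : ξ ⨯₃ P = 0) (hQ : ξ ⨯₃ Q = 0)
    (h : (P ⨯₃ Q) ⬝ᵥ (P ⨯₃ Q) ≠ 0) : ξ = 0 := by
  have p0 := congrFun hP 0
  have p1 := congrFun hP 1
  have p2 := congrFun hP 2
  have q0 := congrFun hQ 0
  have q1 := congrFun hQ 1
  have q2 := congrFun hQ 2
  simp only [vec3_dotProduct, cross_apply_zero, cross_apply_one, cross_apply_two,
    Pi.zero_apply] at p0 p1 p2 q0 q1 q2 h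
  apply vec3_ext <;> refine mul_right_cancel₀ h ?_ <;> rw [Pi.zero_apply] <;> grind

/-- On orbit directions `ξ × v` the form is injective, since `ξ · orientForm v (ξ × v)` is a
positively weighted sum of the squares `|ξ × v_k|²`; positivity is a feature of ℝ. The differential
of `frameInv` kills these directions and is onto, so the two components together are onto. -/
theorem det_orientMap_ne_zero {A : Mixing ℝ (m + 2)} (τ : ℤˣ) {v : Fin (m + 2) → Fin 3 → ℝ}
    (h : frameDet (A.1 v) ≠ 0) : (orientMap A τ v).det ≠ 0 := by
  refine det_ne_zero_of_surjective fun y => ?_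
  let c : (Fin 3 → ℝ) →ₗ[ℝ] (Fin (m + 2) → Fin 3 → ℝ) := LinearMap.pi fun k => crossProduct.flip (v k)
  have hc : ∀ ξ k, c ξ k = ξ ⨯₃ v k := fun _ _ => rfl
  have hAc : ∀ ξ, A.1 (c ξ) = fun k => ξ ⨯₃ A.1 v k := fun ξ => funext (A.2 (crossProduct ξ) v)
  have hinj : Function.Injective ((orientForm v).comp c) := by
    rw [← LinearMap.ker_eq_bot, LinearMap.ker_eq_bot']
    intro ξ hξ
    have h1 : ∑ k, (1 + v k ⬝ᵥ v k)⁻¹ ^ 2 * ((ξ ⨯₃ v k) ⬝ᵥ (ξ ⨯₃ v k)) = 0 := by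
      have h2 : ξ ⬝ᵥ orientForm v (c ξ) = 0 := by
        rw [← LinearMap.comp_apply, hξ, dotProduct_zero]
      rw [orientForm_apply, dotProduct_sum] at h2
      rw [← h2]
      refine Finset.sum_congr rfl fun k _ => ?_
      rw [dotProduct_smul, smul_eq_mul, hc]
      congr 1
      simp only [vec3_dotProduct, cross_apply_zero, cross_apply_one, cross_apply_two]
      ring
    have h3 : ∀ k, ξ ⨯₃ v k = 0 := fun k => by
      have h4 := (Finset.sum_eq_zero_iff_of_nonneg fun k _ =>
        mul_nonneg (sq_nonneg _) (dot_self_nonneg _)).1 h1 k (Finset.mem_univ k)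
      have h5 := (mul_eq_zero.1 h4).resolve_left
        (pow_ne_zero _ (inv_ne_zero (one_add_dot_self_pos _).ne'))
      exact dotProduct_self_eq_zero.1 h5
    have h4 : ∀ k, ξ ⨯₃ A.1 v k = 0 := fun k => by
      rw [← congrFun (hAc ξ) k, show c ξ = 0 from funext h3, map_zero]; rfl
    exact cross_eq_zero_of_frame (h4 0) (h4 1) h
  obtain ⟨w, hw⟩ := surjective_fderiv_frameInv h ((signScale τ).symm (Fin.tail y))
  obtain ⟨ξ, hξ⟩ := LinearMap.injective_iff_surjective.1 hinj (y 0 - orientForm v (A.1.symm w))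
  refine ⟨A.1.symm w + c ξ, ?_⟩
  have e1 : orientForm v (A.1.symm w + c ξ) = y 0 := by
    rw [map_add, ← LinearMap.comp_apply, hξ, add_sub_cancel]
  rw [orientMap_apply, e1, map_add, A.1.apply_symm_apply, map_add, hw, hAc, fderiv_frameInv_cross,
    add_zero, (signScale τ).apply_symm_apply, Fin.cons_self_tail]

theorem continuous_det_orientMap (A : Mixing ℝ (m + 2)) (τ : ℤˣ) :
    Continuous fun v => (orientMap A τ v).det := by
  refine ContinuousLinearMap.continuous_det.comp (continuous_clm_apply.2 fun δ => ?_)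
  refine continuous_pi fun k => ?_
  refine Fin.cases ?_ (fun k => ?_) k
  · have : Continuous fun v => orientForm v δ := by
      simp only [orientForm_apply]
      refine continuous_finsetSum _ fun k _ => ?_
      refine Continuous.smul (Continuous.pow (Continuous.inv₀ ?_ fun v => (one_add_dot_self_pos _).ne') 2)
        (continuous_pi fun b => ?_)
      · simp only [vec3_dotProduct]; fun_prop
      · fin_cases b <;> simp [cross_apply_zero, cross_apply_one, cross_apply_two] <;> fun_prop
    exact this
  · have h1 : Continuous fun v => fderiv ℝ frameInv (A.1 v) (A.1 δ) :=
      ((contDiff_frameInv.continuous_fderiv (by simp)).comp A.1.continuous).clm_apply continuous_const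
    exact (continuous_apply k).comp ((signScale τ).continuous.comp h1)

/-- Reversing one vector of ℝ³ has determinant `(-1)³`, so one of the two signs of `τ` makes a
nonzero determinant positive. -/
theorem signScale_det_neg (A : Mixing ℝ (m + 2)) (τ : ℤˣ) (v : Fin (m + 2) → Fin 3 → ℝ) :
    (orientMap A (-τ) v).det = -(orientMap A τ v).det := by
  let C : (Fin (m + 2) → Fin 3 → ℝ) →ₗ[ℝ] (Fin (m + 2) → Fin 3 → ℝ) :=
    LinearMap.pi fun k => (if k = 1 then -LinearMap.id else LinearMap.id).comp (LinearMap.proj k)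
  have hC : LinearMap.det C = -1 := by
    refine (LinearMap.det_pi _).trans ?_
    rw [Finset.prod_eq_single 1 (fun k _ hk => by rw [if_neg hk, LinearMap.det_id]) (by simp),
      if_pos rfl, ← neg_one_smul ℝ, LinearMap.det_smul, LinearMap.det_id]
    norm_num [Module.finrank_fin_fun]
  have key : (orientMap A (-τ) v).toLinearMap = C.comp (orientMap A τ v).toLinearMap := by
    refine LinearMap.ext fun δ => ?_
    simp only [LinearMap.comp_apply, ContinuousLinearMap.coe_coe]
    rw [orientMap_apply, orientMap_apply]
    funext k
    refine Fin.cases ?_ (fun k => Fin.cases ?_ (fun k => ?_) k) k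
    · rfl
    · simp [C, signScale_apply, sg]
    · simp [C, signScale_apply, Fin.ext_iff]
  have := congrArg LinearMap.det key
  rw [LinearMap.det_comp, hC, neg_one_mul] at this
  exact this

/-- The selected charts are those with `det (orientMap A τ v) > 0`. As `chartChange` preserves
`orientForm`, the determinant of `L` times that of `orientMap` before the change equals that of
`orientMap` after it times that of `chartChangeDeriv`, which is positive. Hence `det L > 0`. -/
theorem orientingSets_real : OrientingSets ℝ m fun A τ => {v | 0 < (orientMap A τ v).det} where
  isOpen A τ := isOpen_lt continuous_const (continuous_det_orientMap A τ)
  rot_mem A τ a p h v hv := by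
    rw [Set.mem_ofPred_eq, orientMap_rot h]
    exact hv
  exists_mem A v h := by
    rcases (det_orientMap_ne_zero 1 h).lt_or_gt with h1 | h1
    · exact ⟨-1, by rw [Set.mem_ofPred_eq, signScale_det_neg]; linarith⟩
    · exact ⟨1, h1⟩
  det A A' τ τ' b v _ hb _ _ hv hv' L hL := by
    let C : (Fin (m + 2) → Fin 3 → ℝ) →ₗ[ℝ] (Fin (m + 2) → Fin 3 → ℝ) :=
      (Fin.consLinearEquiv ℝ (fun _ : Fin (m + 2) => Fin 3 → ℝ)).toLinearMap.comp
        ((LinearMap.id.prodMap L.toLinearMap).comp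
          (Fin.consLinearEquiv ℝ (fun _ : Fin (m + 2) => Fin 3 → ℝ)).symm.toLinearMap)
    have hC : LinearMap.det C = L.det := by
      rw [det_consMap LinearMap.id L.toLinearMap C, LinearMap.det_id, one_mul]
      intro x y; rfl
    have key : (orientMap A' τ' (chartChange b v)).toLinearMap.comp (chartChangeDeriv b v).toLinearMap =
        C.comp (orientMap A τ v).toLinearMap := by
      refine LinearMap.ext fun δ => ?_
      simp only [LinearMap.comp_apply, ContinuousLinearMap.coe_coe]
      rw [orientMap_apply, orientMap_apply, orientForm_chartChange hb, ← hL]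
      rfl
    have h1 := congrArg LinearMap.det key
    rw [LinearMap.det_comp, LinearMap.det_comp, hC] at h1
    have h2 : 0 < (chartChangeDeriv b v).det := by
      rw [det_chartChangeDeriv hb]
      refine Finset.prod_pos fun k _ => ?_
      split_ifs with hk
      · exact pow_pos (inv_pos.2 ((dot_self_nonneg _).lt_of_ne' (hb k hk))) 3
      · exact one_pos
    have h3 : 0 < L.det := by
      refine pos_of_mul_pos_left (b := (orientMap A τ v).det) ?_ hv.le
      rw [show L.det * (orientMap A τ v).det = _ from h1.symm]
      exact mul_pos hv' h2
    exact ⟨√L.det, (Real.sqrt_pos.2 h3).ne', (Real.sq_sqrt h3.le).symm⟩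

end Orientation

end SurfaceRep
end

noncomputable section
namespace SurfaceRep

/-! ### Stereographic charts -/

namespace QuatModel

open Topology

variable {K G : Type} [RCLike K] [Group G] [TopologicalSpace G] (Q : QuatModel K G) {m : ℕ}

/-- The stereographic chart of `G ^ m`. -/
def stereoChart (ε : Fin m → ℤˣ) : OpenPartialHomeomorph (Fin m → G) (Fin m → Fin 3 → K) where
  toFun z k := Q.stereo (ε k) (z k)
  invFun := Q.chartInv ε
  source := {z | ∀ k, 1 + sg K (ε k) * Q.re (z k) ≠ 0}
  target := {v | ∀ k, 1 + v k ⬝ᵥ v k ≠ 0}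
  map_source' _ hz k := one_add_stereo_ne (hz k)
  map_target' _ hv k := one_add_re_stereoInv_ne (hv k)
  left_inv' _ hz := funext fun k => stereoInv_stereo (hz k)
  right_inv' _ hv := funext fun k => stereo_stereoInv (hv k)
  continuousOn_toFun z hz := ContinuousAt.continuousWithinAt <| continuousAt_pi.2 fun k =>
    ContinuousAt.comp (f := fun z : Fin m → G => z k) (continuousAt_stereo (hz k))
      (continuous_apply k).continuousAt
  continuousOn_invFun _ hv :=
    (Q.continuousAt_chartInv (denom_ne_zero.2 hv)).continuousWithinAt
  open_source := by
    simp only [Set.ofPred_forall]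
    refine isOpen_iInter_of_finite fun k => isOpen_ne_fun ?_ continuous_const
    exact continuous_const.add (continuous_const.mul (Q.continuous_re.comp (continuous_apply k)))
  open_target := by
    simp only [Set.ofPred_forall]
    refine isOpen_iInter_of_finite fun k => isOpen_ne_fun ?_ continuous_const
    simp only [vec3_dotProduct]; fun_prop

variable {E : Type} [NormedAddCommGroup E] [NormedSpace K E] {M : Type} [TopologicalSpace M]
  [Nonempty M] {h : M → Fin m → G}

/-- The stereographic charts of an open subspace of `G ^ m`. -/
def locusChart (hh : IsOpenEmbedding h) (LE : (Fin m → Fin 3 → K) ≃L[K] E) (ε : Fin m → ℤˣ) :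
    OpenPartialHomeomorph M E :=
  (hh.toOpenPartialHomeomorph h).trans
    ((Q.stereoChart ε).trans LE.toHomeomorph.toOpenPartialHomeomorph)

variable (hh : IsOpenEmbedding h) (LE : (Fin m → Fin 3 → K) ≃L[K] E)

theorem locusChart_apply (ε : Fin m → ℤˣ) (x : M) :
    Q.locusChart hh LE ε x = LE fun k => Q.stereo (ε k) (h x k) := rfl

theorem mem_locusChart_source {ε : Fin m → ℤˣ} {x : M} :
    x ∈ (Q.locusChart hh LE ε).source ↔ ∀ k, 1 + sg K (ε k) * Q.re (h x k) ≠ 0 := by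
  simp [locusChart, stereoChart]

theorem of_mem_locusChart_target {ε : Fin m → ℤˣ} {y : E} (hy : y ∈ (Q.locusChart hh LE ε).target) :
    (∀ k, 1 + LE.symm y k ⬝ᵥ LE.symm y k ≠ 0) ∧
      h ((Q.locusChart hh LE ε).symm y) = Q.chartInv ε (LE.symm y) := by
  have h1 := (Q.locusChart hh LE ε).map_target hy
  have h2 := (Q.locusChart hh LE ε).right_inv hy
  rw [mem_locusChart_source] at h1
  rw [locusChart_apply] at h2
  have h3 : LE.symm y = fun k => Q.stereo (ε k) (h ((Q.locusChart hh LE ε).symm y) k) := by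
    rw [← h2, LE.symm_apply_apply, h2]
  exact ⟨fun k => by rw [h3]; exact one_add_stereo_ne (h1 k),
    funext fun k => by rw [h3]; exact (stereoInv_stereo (h1 k)).symm⟩

/-- The charted space structure of an open subspace of `G ^ m`. -/
@[reducible] def locusChartedSpace : ChartedSpace E M :=
  chartedSpaceOfFamily (Q.locusChart hh LE)
    (fun x => Classical.choose (Classical.axiomOfChoice fun k => exists_sign (Q := Q) (h x k)))
    fun x => (Q.mem_locusChart_source hh LE).2
      (Classical.choose_spec (Classical.axiomOfChoice fun k => exists_sign (Q := Q) (h x k)))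

/-- The coordinates in which two stereographic charts differ. -/
def flips (ε ε' : Fin m → ℤˣ) (k : Fin m) : Bool := decide (ε k ≠ ε' k)

variable {Q}

theorem stereo_eq_chartChange {ε ε' : Fin m → ℤˣ} {y : E} (hy : y ∈ (Q.locusChart hh LE ε).target) :
    (fun k => Q.stereo (ε' k) (h ((Q.locusChart hh LE ε).symm y) k)) =
      chartChange (flips ε ε') (LE.symm y) := by
  obtain ⟨h1, h2⟩ := Q.of_mem_locusChart_target hh LE hy
  funext k
  rw [h2, chartInv, chartChange, flips]
  by_cases he : ε k = ε' k
  · rw [if_neg (by simpa using he), ← he, stereo_stereoInv (h1 k)]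
  · have he' : ε' k = -ε k := by
      rcases Int.units_eq_one_or (ε k) with h | h <;> rcases Int.units_eq_one_or (ε' k) with h' | h' <;>
        simp_all
    rw [if_pos (by simpa using he), he', stereo_neg_stereoInv (h1 k)]
    rfl

theorem stereo_dot_ne {e e' : ℤˣ} (hne : e ≠ e') {x : G} (h : 1 + sg K e * Q.re x ≠ 0)
    (h' : 1 + sg K e' * Q.re x ≠ 0) : Q.stereo e x ⬝ᵥ Q.stereo e x ≠ 0 := by
  have hs : sg K e' = - sg K e := by
    rcases Int.units_eq_one_or e with rfl | rfl <;> rcases Int.units_eq_one_or e' with rfl | rfl <;>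
      simp_all [sg]
  have h1 : (1 + sg K e * Q.re x) * (Q.stereo e x ⬝ᵥ Q.stereo e x) = 1 + sg K e' * Q.re x := by
    have h2 := one_add_stereo h
    rw [eq_div_iff h] at h2
    rw [hs]; linear_combination h2
  exact right_ne_zero_of_mul (h1 ▸ h')

theorem dot_ne_of_flips {ε ε' : Fin m → ℤˣ} {x : M} (hx : x ∈ (Q.locusChart hh LE ε).source)
    (hx' : x ∈ (Q.locusChart hh LE ε').source) (k : Fin m) (hk : flips ε ε' k) :
    LE.symm (Q.locusChart hh LE ε x) k ⬝ᵥ LE.symm (Q.locusChart hh LE ε x) k ≠ 0 := by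
  rw [locusChart_apply, LE.symm_apply_apply]
  exact stereo_dot_ne (by simpa [flips] using hk) ((Q.mem_locusChart_source hh LE).1 hx k)
    ((Q.mem_locusChart_source hh LE).1 hx' k)

theorem stereo_eventuallyEq {ε : Fin m → ℤˣ} (ε' : Fin m → ℤˣ) {x : M}
    (hx : x ∈ (Q.locusChart hh LE ε).source) :
    (fun y => fun k => Q.stereo (ε' k) (h ((Q.locusChart hh LE ε).symm y) k))
      =ᶠ[𝓝 (Q.locusChart hh LE ε x)] fun y => chartChange (flips ε ε') (LE.symm y) := by
  filter_upwards [(Q.locusChart hh LE ε).open_target.mem_nhds ((Q.locusChart hh LE ε).map_source hx)]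
    with y hy
  exact stereo_eq_chartChange hh LE hy

/-- Functions of stereographic coordinates, in a stereographic chart. -/
theorem contDiffAt_comp_stereo {V : Type} [NormedAddCommGroup V] [NormedSpace K V]
    {ε ε' : Fin m → ℤˣ} {x : M} (hx : x ∈ (Q.locusChart hh LE ε).source)
    (hx' : x ∈ (Q.locusChart hh LE ε').source) {f : (Fin m → Fin 3 → K) → V}
    {f' : (Fin m → Fin 3 → K) →L[K] V}
    (hf : ContDiffAt K ∞ f fun k => Q.stereo (ε' k) (h x k))
    (hf' : HasFDerivAt f f' fun k => Q.stereo (ε' k) (h x k)) :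
    ContDiffAt K ∞ ((fun x => f fun k => Q.stereo (ε' k) (h x k)) ∘ (Q.locusChart hh LE ε).symm)
        (Q.locusChart hh LE ε x) ∧
      fderiv K ((fun x => f fun k => Q.stereo (ε' k) (h x k)) ∘ (Q.locusChart hh LE ε).symm)
        (Q.locusChart hh LE ε x) =
      f'.comp ((chartChangeDeriv (flips ε ε') (LE.symm (Q.locusChart hh LE ε x))).comp
        (LE.symm : E →L[K] (Fin m → Fin 3 → K))) := by
  have hd := dot_ne_of_flips hh LE hx hx'
  have he := stereo_eventuallyEq hh LE ε' hx
  have he0 := he.eq_of_nhds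
  simp only [(Q.locusChart hh LE ε).left_inv hx] at he0
  rw [he0] at hf hf'
  have he2 : (fun x => f fun k => Q.stereo (ε' k) (h x k)) ∘ (Q.locusChart hh LE ε).symm
      =ᶠ[𝓝 (Q.locusChart hh LE ε x)] (f ∘ chartChange (flips ε ε')) ∘ LE.symm :=
    he.fun_comp f
  constructor
  · refine ContDiffAt.congr_of_eventuallyEq ?_ he2
    exact ContDiffAt.comp _ (ContDiffAt.comp _ hf (contDiffAt_chartChange hd))
      LE.symm.contDiff.contDiffAt
  · rw [he2.fderiv_eq]
    exact ((hf'.comp _ (hasFDerivAt_chartChange hd)).comp _ LE.symm.hasFDerivAt).fderiv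

-- Each inversion has determinant `(u·u)⁻³`, the square of `s⁻³` for a root `s` of `u·u` in `K`. So
-- all transitions have square determinants, which `hdet` converts into positive real ones.
variable (Q) in
theorem isManifold_locus (hK : IsSpinField K) [NormedSpace ℝ E] [IsScalarTower ℝ K E]
    (hdet : ∀ L : E →L[K] E, (∃ s, s ≠ 0 ∧ L.det = s ^ 2) → 0 < (L.restrictScalars ℝ).det) :
    letI := Q.locusChartedSpace hh LE
    IsManifold 𝓘(K, E) ∞ M ∧ IsOrientedAtlas E M := by
  letI := Q.locusChartedSpace hh LE
  have key : ∀ ε ε' : Fin m → ℤˣ, ∀ y ∈ ((Q.locusChart hh LE ε).symm.trans (Q.locusChart hh LE ε')).source,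
      ∃ v, (∀ k, flips ε ε' k → v k ⬝ᵥ v k ≠ 0) ∧
      ContDiffAt K ∞ ((Q.locusChart hh LE ε).symm.trans (Q.locusChart hh LE ε')) y ∧
      fderiv K ((Q.locusChart hh LE ε).symm.trans (Q.locusChart hh LE ε')) y =
        (LE : _ →L[K] E).comp ((chartChangeDeriv (flips ε ε') v).comp
        (LE.symm : E →L[K] (Fin m → Fin 3 → K))) := by
    rintro ε ε' y ⟨hy, hy'⟩
    have hx := (Q.locusChart hh LE ε).map_target hy
    have h1 := contDiffAt_comp_stereo hh LE hx hy' (f := LE) LE.contDiff.contDiffAt LE.hasFDerivAt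
    have h2 := dot_ne_of_flips hh LE hx hy'
    have h3 : Q.locusChart hh LE ε ((Q.locusChart hh LE ε).symm y) = y :=
      (Q.locusChart hh LE ε).right_inv hy
    rw [h3] at h1 h2
    exact ⟨_, h2, h1⟩
  refine ⟨isManifold_of_transitions ?_, ?_⟩
  · rintro _ ⟨ε, rfl⟩ _ ⟨ε', rfl⟩ y hy
    obtain ⟨v, -, h1, -⟩ := key ε ε' y hy
    exact h1
  · rintro _ ⟨ε, rfl⟩ _ ⟨ε', rfl⟩ y hy
    obtain ⟨v, hv, h1, h2⟩ := key ε ε' y hy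
    rw [(h1.differentiableAt (by simp)).fderiv_restrictScalars ℝ]
    refine hdet _ ?_
    have h3 : (fderiv K ((Q.locusChart hh LE ε).symm.trans (Q.locusChart hh LE ε')) y).det =
        (chartChangeDeriv (flips ε ε') v).det := by
      rw [h2]
      exact LinearMap.det_conj (chartChangeDeriv (flips ε ε') v).toLinearMap LE.toLinearEquiv
    rw [h3, det_chartChangeDeriv hv]
    choose s hs using fun k => hK.sqrt 0 (v k)
    simp only [zero_pow two_ne_zero, zero_add] at hs
    refine ⟨∏ k, if flips ε ε' k then (s k)⁻¹ ^ 3 else 1, ?_, ?_⟩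
    · refine Finset.prod_ne_zero_iff.2 fun k _ => ?_
      split_ifs with hk
      · refine pow_ne_zero _ (inv_ne_zero fun h0 => hv k hk ?_)
        rw [← hs, h0]; simp
      · exact one_ne_zero
    · rw [← Finset.prod_pow]
      refine Finset.prod_congr rfl fun k _ => ?_
      split_ifs
      · rw [← hs k, inv_pow, inv_pow, inv_pow, ← pow_mul, ← pow_mul]
      · rw [one_pow]

end QuatModel

end SurfaceRep
end

noncomputable section
namespace SurfaceRep

/-! ### The quotient manifold and the submanifold -/

namespace QuatModel

open Topology

variable {K G : Type} [RCLike K] [Group G] [TopologicalSpace G] (Q : QuatModel K G)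

theorem spanning_stereo {m : ℕ} {ε : Fin m → ℤˣ} {z : Fin m → G}
    (hε : ∀ k, 1 + sg K (ε k) * Q.re (z k) ≠ 0) (hz : z ∈ Q.irreducible m) :
    Spanning fun k => Q.stereo (ε k) (z k) := by
  have hc : ∀ k, sg K (ε k) / (1 + sg K (ε k) * Q.re (z k)) ≠ 0 := fun k =>
    div_ne_zero (left_ne_zero_of_mul_eq_one (sg_mul_self K _)) (hε k)
  rcases hz with ⟨i, j, h⟩ | ⟨i, j, k, h⟩
  · refine Or.inl ⟨i, j, ?_⟩
    simp only [stereo, LinearMap.map_smul₂, LinearMap.map_smul, smul_dotProduct, dotProduct_smul,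
      smul_eq_mul, LinearMap.smul_apply]
    exact mul_ne_zero (hc _) (mul_ne_zero (hc _) (mul_ne_zero (hc _) (mul_ne_zero (hc _) h)))
  · refine Or.inr ⟨i, j, k, ?_⟩
    simp only [stereo, LinearMap.map_smul₂, LinearMap.map_smul, smul_dotProduct, dotProduct_smul,
      smul_eq_mul, LinearMap.smul_apply]
    exact mul_ne_zero (hc _) (mul_ne_zero (hc _) (mul_ne_zero (hc _) h))

variable {m : ℕ} {E F : Type} [NormedAddCommGroup E] [NormedSpace K E] [NormedAddCommGroup F]
  [NormedSpace K F] {M T : Type} [TopologicalSpace M] [TopologicalSpace T]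
  [Nonempty M] {h : M → Fin (m + 2) → G} (hh : IsOpenEmbedding h)
  (LE : (Fin (m + 2) → Fin 3 → K) ≃L[K] E) (LF : (Fin (m + 1) → Fin 3 → K) ≃L[K] F)

/-- The indices of the charts of the quotient. -/
abbrev QuotIndex (K : Type) [RCLike K] (m : ℕ) : Type :=
  (Fin (m + 2) → ℤˣ) × Mixing K (m + 2) × ℤˣ

/-- The domains of the charts of the quotient. -/
def quotDomain (h : M → Fin (m + 2) → G) (W : Mixing K (m + 2) → ℤˣ → Set (Fin (m + 2) → Fin 3 → K))
    (i : QuotIndex K m) : Set M :=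
  {x | (∀ k, 1 + sg K (i.1 k) * Q.re (h x k) ≠ 0) ∧
    frameDet (i.2.1.1 fun k => Q.stereo (i.1 k) (h x k)) ≠ 0 ∧
    (fun k => Q.stereo (i.1 k) (h x k)) ∈ W i.2.1 i.2.2}

/-- The charts of the quotient. -/
def quotFun (h : M → Fin (m + 2) → G) (i : QuotIndex K m) (x : M) : F :=
  LF (signScale i.2.2 (frameInv (i.2.1.1 fun k => Q.stereo (i.1 k) (h x k))))

theorem hasFDerivAt_quotCoord (A : Mixing K (m + 2)) (τ : ℤˣ) (v : Fin (m + 2) → Fin 3 → K) :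
    HasFDerivAt (fun v => LF (signScale τ (frameInv (A.1 v))))
      ((LF : _ →L[K] F).comp ((signScale (K := K) (m := m) τ).toContinuousLinearMap.comp
        ((fderiv K frameInv (A.1 v)).comp (A.1 : _ →L[K] (Fin (m + 2) → Fin 3 → K))))) v :=
  LF.hasFDerivAt.comp v ((signScale (K := K) (m := m) τ).hasFDerivAt.comp v
    ((contDiff_frameInv.differentiable (by simp) _).hasFDerivAt.comp v A.1.hasFDerivAt))

theorem contDiff_quotCoord (A : Mixing K (m + 2)) (τ : ℤˣ) :
    ContDiff K ∞ (fun v => LF (signScale τ (frameInv (A.1 v)))) :=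
  LF.contDiff.comp ((signScale (K := K) (m := m) τ).contDiff.comp (contDiff_frameInv.comp A.1.contDiff))

theorem stereo_conj_tuple (ε : Fin m → ℤˣ) (g : G) (z : Fin m → G) :
    (fun k => Q.stereo (ε k) (g * z k * g⁻¹)) =
      fun k => rot (Q.re g) (Q.im g) (Q.stereo (ε k) (z k)) :=
  funext fun _ => stereo_conj _ _ _

theorem mem_quotDomain_conj {W : Mixing K (m + 2) → ℤˣ → Set (Fin (m + 2) → Fin 3 → K)}
    (hW : OrientingSets K m W) {i : QuotIndex K m} {x y : M} (hx : x ∈ Q.quotDomain h W i) {g : G}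
    (hg : h y = fun k => g * h x k * g⁻¹) : y ∈ Q.quotDomain h W i := by
  obtain ⟨h1, h2, h3⟩ := hx
  refine ⟨fun k => by rw [hg, re_conj]; exact h1 k, ?_, ?_⟩
  · rw [hg, stereo_conj_tuple, show (i.2.1.1 fun k => rot (Q.re g) (Q.im g) (Q.stereo (i.1 k) (h x k))) =
      fun k => rot (Q.re g) (Q.im g) (i.2.1.1 (fun k => Q.stereo (i.1 k) (h x k)) k) from
      funext (i.2.1.2 _ _), frameDet_rot (Q.norm_eq g)]
    exact h2
  · rw [hg, stereo_conj_tuple]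
    exact hW.rot_mem _ _ _ _ (Q.norm_eq g) _ h3

theorem quotFun_conj {i : QuotIndex K m} {x y : M} {g : G} (hg : h y = fun k => g * h x k * g⁻¹) :
    Q.quotFun LF h i y = Q.quotFun LF h i x := by
  rw [quotFun, quotFun, hg, stereo_conj_tuple,
    show (i.2.1.1 fun k => rot (Q.re g) (Q.im g) (Q.stereo (i.1 k) (h x k))) =
      fun k => rot (Q.re g) (Q.im g) (i.2.1.1 (fun k => Q.stereo (i.1 k) (h x k)) k) from
      funext (i.2.1.2 _ _), frameInv_rot (Q.norm_eq g)]

/-- Equal invariants yield a rotation between the mixed tuples. The mixing is invertible and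
commutes with rotations, so the same rotation relates the stereographic vectors, and hence a
conjugation relates the group elements. -/
theorem exists_conj_of_quotFun_eq (hK : IsSpinField K)
    {W : Mixing K (m + 2) → ℤˣ → Set (Fin (m + 2) → Fin 3 → K)}
    {i : QuotIndex K m} {x y : M} (hx : x ∈ Q.quotDomain h W i) (hy : y ∈ Q.quotDomain h W i)
    (hxy : Q.quotFun LF h i x = Q.quotFun LF h i y) : ∃ g, h y = fun k => g * h x k * g⁻¹ := by
  obtain ⟨a, p, hap, hr⟩ := exists_rot_of_frameInv_eq hK.sqrt hx.2.1
    ((signScale i.2.2).injective (LF.injective hxy))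
  rw [← show (i.2.1.1 fun k => rot a p (Q.stereo (i.1 k) (h x k))) =
      fun k => rot a p (i.2.1.1 (fun k => Q.stereo (i.1 k) (h x k)) k) from
      funext (i.2.1.2 _ _)] at hr
  have hr' := i.2.1.1.injective hr
  refine ⟨Q.ofCoords a p hap, funext fun k => ?_⟩
  have h1 : 1 + sg K (i.1 k) * Q.re (Q.ofCoords a p hap * h x k * (Q.ofCoords a p hap)⁻¹) ≠ 0 := by
    rw [re_conj]; exact hx.1 k
  rw [← stereoInv_stereo (hy.1 k), ← stereoInv_stereo h1, stereo_conj, re_ofCoords, im_ofCoords]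
  exact congrArg _ (congrFun hr' k)

variable [FiniteDimensional K E] [FiniteDimensional K F]

theorem quotientCharts (hK : IsSpinField K)
    {W : Mixing K (m + 2) → ℤˣ → Set (Fin (m + 2) → Fin 3 → K)} (hW : OrientingSets K m W)
    {p : M → T} (hp : IsOpenQuotientMap p)
    (hfib : ∀ x y, p x = p y ↔ ∃ g, h y = fun k => g * h x k * g⁻¹)
    (hirr : ∀ x, h x ∈ Q.irreducible (m + 2)) :
    letI := Q.locusChartedSpace hh LE
    QuotientCharts K E F p (Q.quotDomain h W) (Q.quotFun LF h) := by
  letI := Q.locusChartedSpace hh LE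
  have hsm : ∀ i x, x ∈ Q.quotDomain h W i → ∀ ε, x ∈ (Q.locusChart hh LE ε).source → _ :=
    fun i x hx ε hε => contDiffAt_comp_stereo hh LE (ε := ε) (ε' := i.1) (x := x) hε
      ((Q.mem_locusChart_source hh LE).2 hx.1)
      (f := fun v => LF (signScale i.2.2 (frameInv (i.2.1.1 v))))
      (contDiff_quotCoord LF i.2.1 i.2.2).contDiffAt (hasFDerivAt_quotCoord LF i.2.1 i.2.2 _)
  refine ⟨hp, ?_, ?_, ?_, ?_, ?_, ?_⟩
  · intro i
    have h1 : IsOpen {v : Fin (m + 2) → Fin 3 → K | frameDet (i.2.1.1 v) ≠ 0 ∧ v ∈ W i.2.1 i.2.2} :=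
      (isOpen_ne_fun (continuous_frameDet.comp i.2.1.1.continuous) continuous_const).inter
        (hW.isOpen _ _)
    have h2 := (Q.locusChart hh LE i.1).isOpen_inter_preimage (h1.preimage LE.symm.continuous)
    convert h2 using 1
    ext x
    rw [Set.mem_inter_iff, mem_locusChart_source, Set.mem_preimage, locusChart_apply, Set.mem_preimage,
      LE.symm_apply_apply]
    rfl
  · intro x
    choose ε hε using fun k => exists_sign (Q := Q) (h x k)
    obtain ⟨A, hA⟩ := (Q.spanning_stereo hε (hirr x)).exists_mixing
    obtain ⟨τ, hτ⟩ := hW.exists_mem A _ hA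
    exact ⟨(ε, A, τ), hε, hA, hτ⟩
  · intro i x y hx hxy
    obtain ⟨g, hg⟩ := (hfib x y).1 hxy
    exact Q.mem_quotDomain_conj hW hx hg
  · intro i x y hx hy
    rw [hfib]
    constructor
    · exact Q.exists_conj_of_quotFun_eq LF hK hx hy
    · rintro ⟨g, hg⟩
      exact (Q.quotFun_conj LF hg).symm
  · rintro i x hx _ ⟨ε, rfl⟩ hε
    exact (hsm i x hx ε hε).1
  · rintro i x hx _ ⟨ε, rfl⟩ hε
    erw [(hsm i x hx ε hε).2]
    have hb := dot_ne_of_flips hh LE hε ((Q.mem_locusChart_source hh LE).2 hx.1)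
    simp only [ContinuousLinearMap.coe_comp]
    exact ((LF.surjective.comp ((signScale i.2.2).surjective.comp
      ((surjective_fderiv_frameInv hx.2.1).comp i.2.1.1.surjective)))).comp
      ((surjective_of_det_ne_zero (det_chartChangeDeriv_ne_zero hb)).comp LE.symm.surjective)

include LF in
theorem exists_quotient_manifold (hK : IsSpinField K)
    {W : Mixing K (m + 2) → ℤˣ → Set (Fin (m + 2) → Fin 3 → K)} (hW : OrientingSets K m W)
    {p : M → T} (hp : IsOpenQuotientMap p)
    (hfib : ∀ x y, p x = p y ↔ ∃ g, h y = fun k => g * h x k * g⁻¹)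
    (hirr : ∀ x, h x ∈ Q.irreducible (m + 2)) [NormedSpace ℝ F] [IsScalarTower ℝ K F]
    (hdet : ∀ L : F →L[K] F, (∃ s, s ≠ 0 ∧ L.det = s ^ 2) → 0 < (L.restrictScalars ℝ).det) :
    letI := Q.locusChartedSpace hh LE
    ∃ _ : ChartedSpace F T, IsManifold 𝓘(K, F) ∞ T ∧ IsOrientedAtlas F T ∧
      IsSmoothSubmersion K E F p := by
  letI := Q.locusChartedSpace hh LE
  have : Nonempty T := ⟨p (Classical.arbitrary M)⟩
  refine (Q.quotientCharts hh LE LF hK hW hp hfib hirr).exists_chartedSpace ?_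
  rintro ⟨ε, A, τ⟩ ⟨ε', A', τ'⟩ x ⟨hx, hx'⟩
  have hε := (Q.mem_locusChart_source hh LE).2 hx.1
  have hε' := (Q.mem_locusChart_source hh LE).2 hx'.1
  -- The comparison takes place in the stereographic chart `ε` that underlies the first quotient
  -- chart; only the second derivative then involves a chart change.
  refine ⟨_, ⟨ε, rfl⟩, hε, fun L hL => hdet L ?_⟩
  have e1 := (contDiffAt_comp_stereo hh LE hε hε
      (f := fun v => LF (signScale τ (frameInv (A.1 v))))
      (contDiff_quotCoord LF A τ).contDiffAt (hasFDerivAt_quotCoord LF A τ _)).2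
  have e2 := (contDiffAt_comp_stereo hh LE hε hε'
      (f := fun v => LF (signScale τ' (frameInv (A'.1 v))))
      (contDiff_quotCoord LF A' τ').contDiffAt (hasFDerivAt_quotCoord LF A' τ' _)).2
  have hb := dot_ne_of_flips hh LE hε hε'
  have he0 := (stereo_eventuallyEq hh LE ε' hε).eq_of_nhds
  simp only [(Q.locusChart hh LE ε).left_inv hε] at he0
  have hv : LE.symm (Q.locusChart hh LE ε x) = fun k => Q.stereo (ε k) (h x k) := by
    rw [locusChart_apply, LE.symm_apply_apply]
  rw [hv] at e1 e2 hb he0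
  have hid : chartChangeDeriv (flips ε ε) (fun k => Q.stereo (ε k) (h x k)) =
      ContinuousLinearMap.id K _ := by
    refine ContinuousLinearMap.ext fun δ => funext fun k => ?_
    rw [chartChangeDeriv_apply, if_neg (by simp [flips])]; rfl
  rw [hid] at e1
  let L0 : (Fin (m + 1) → Fin 3 → K) →L[K] (Fin (m + 1) → Fin 3 → K) :=
    (LF.symm : F →L[K] _).comp (L.comp (LF : _ →L[K] F))
  have hL0 : L0.det = L.det := LinearMap.det_conj L.toLinearMap LF.symm.toLinearEquiv
  rw [← hL0]
  refine hW.det A A' τ τ' (flips ε ε') _ (fun k => one_add_stereo_ne (hx.1 k)) hb hx.2.1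
    (by rw [← he0]; exact hx'.2.1) hx.2.2 (by rw [← he0]; exact hx'.2.2) L0 fun δ => ?_
  have h1 := DFunLike.congr_fun hL (LE δ)
  rw [ContinuousLinearMap.comp_apply] at h1
  erw [e1, e2] at h1
  simp only [ContinuousLinearMap.comp_apply, ContinuousLinearEquiv.coe_coe,
    ContinuousLinearMap.id_apply, LE.symm_apply_apply] at h1
  simp only [L0, ContinuousLinearMap.comp_apply, ContinuousLinearEquiv.coe_coe]
  rw [h1, LF.symm_apply_apply, he0]

end QuatModel

end SurfaceRep
end

noncomputable section
namespace SurfaceRep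

/-! ### Separation of irreducible tuples by invariants, and the matrix entries -/

/-- The parameter is `t = 0` if some pair is nondegenerate, with a dummy third index, and `t = 1`
otherwise, as in the construction of mixings. The form with indices spares any reordering of the
tuple. -/
theorem Spanning.exists_frame {K : Type} [RCLike K] {ι : Type} {v : ι → Fin 3 → K} (h : Spanning v) :
    ∃ i j k, ∃ t : K, (v i ⨯₃ (v j + t • v k)) ⬝ᵥ (v i ⨯₃ (v j + t • v k)) ≠ 0 := by
  by_cases h2 : ∃ i j, (v i ⨯₃ v j) ⬝ᵥ (v i ⨯₃ v j) ≠ 0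
  · obtain ⟨i, j, hij⟩ := h2
    exact ⟨i, j, i, 0, by simpa using hij⟩
  obtain ⟨i, j, k, hijk⟩ := h.resolve_left h2
  push Not at h2
  have key : ∀ i j k, (v i ⨯₃ v j) ⬝ᵥ (v i ⨯₃ v k) ≠ 0 → ∃ i j k, ∃ t : K,
      (v i ⨯₃ (v j + t • v k)) ⬝ᵥ (v i ⨯₃ (v j + t • v k)) ≠ 0 := by
    intro i j k hne
    refine ⟨i, j, k, 1, ?_⟩
    rw [one_smul, map_add, add_dotProduct, dotProduct_add, dotProduct_add, h2, h2,
      dotProduct_comm (v i ⨯₃ v k), zero_add, add_zero, ← two_mul]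
    exact mul_ne_zero two_ne_zero hne
  rcases exists_cross_dot_ne_zero hijk (h2 _ _) (h2 _ _) (h2 _ _) with h | h | h
  exacts [key _ _ _ h, key _ _ _ h, key _ _ _ h]

namespace QuatModel

open Topology

variable {K G : Type} [RCLike K] [Group G] [TopologicalSpace G] (Q : QuatModel K G) {m : ℕ}

/-- The basic conjugation invariants of a tuple. -/
def invMap (z : Fin m → G) : (Fin m → K) × (Fin m → Fin m → K) × (Fin m → Fin m → Fin m → K) :=
  (fun k => Q.re (z k), fun i j => Q.im (z i) ⬝ᵥ Q.im (z j),
    fun i j k => Q.im (z i) ⬝ᵥ (Q.im (z j) ⨯₃ Q.im (z k)))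

theorem continuous_invMap : Continuous (Q.invMap (m := m)) := by
  have h1 : ∀ k, Continuous fun z : Fin m → G => Q.re (z k) := fun k =>
    Q.continuous_re.comp (continuous_apply k)
  have h2 : ∀ k b, Continuous fun z : Fin m → G => Q.im (z k) b := fun k b =>
    (continuous_apply b).comp (Q.continuous_im.comp (continuous_apply k))
  unfold invMap
  simp only [vec3_dotProduct, cross_apply_zero, cross_apply_one, cross_apply_two]
  fun_prop

theorem invMap_conj (g : G) (z : Fin m → G) : Q.invMap (fun k => g * z k * g⁻¹) = Q.invMap z := by
  simp [invMap, rot_cross (Q.norm_eq g), rot_dot (Q.norm_eq g)]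

/-- For the nondegenerate pair `P = im z_i`, `Q = im z_j + t im z_k`, multilinearity shows that the
invariants determine the products of every vector with `P`, `Q` and `P × Q`. One rotation therefore
moves the whole tuple. -/
theorem exists_conj_of_invMap_eq (hK : IsSpinField K) {z w : Fin m → G} (hz : z ∈ Q.irreducible m)
    (h : Q.invMap z = Q.invMap w) : ∃ g : G, w = fun k => g * z k * g⁻¹ := by
  simp only [invMap, Prod.mk.injEq, funext_iff] at h
  obtain ⟨h1, h2, h3⟩ := h
  obtain ⟨i, j, k, t, hD⟩ := Spanning.exists_frame (v := fun k => Q.im (z k)) hz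
  obtain ⟨a, p, hap, hrot⟩ := exists_rot_of_gram_eq hK.sqrt two_ne_zero
    (P := Q.im (z i)) (Q := Q.im (z j) + t • Q.im (z k))
    (P' := Q.im (w i)) (Q' := Q.im (w j) + t • Q.im (w k)) (h2 i i)
    (by simp only [dotProduct_add, dotProduct_smul, h2])
    (by simp only [dotProduct_add, dotProduct_smul, add_dotProduct, smul_dotProduct, h2]) hD
  refine ⟨Q.ofCoords a p hap, funext fun l => Q.ext _ _ ?_ ?_⟩
  · rw [re_conj, h1]
  · rw [im_conj, re_ofCoords, im_ofCoords]
    refine hrot _ _ (h2 l i) ?_ ?_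
    · simp only [dotProduct_add, dotProduct_smul, h2]
    · simp only [map_add, map_smul, dotProduct_add, dotProduct_smul, h3]

theorem conj_mem_irreducible {z : Fin m → G} (hz : z ∈ Q.irreducible m) (g : G) :
    (fun k => g * z k * g⁻¹) ∈ Q.irreducible m := by
  rcases hz with ⟨i, j, h⟩ | ⟨i, j, k, h⟩
  · exact Or.inl ⟨i, j, by simpa [rot_cross (Q.norm_eq g), rot_dot (Q.norm_eq g)] using h⟩
  · exact Or.inr ⟨i, j, k, by simpa [rot_cross (Q.norm_eq g), rot_dot (Q.norm_eq g)] using h⟩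

theorem isOpen_irreducible : IsOpen (Q.irreducible m) := by
  have h2 : ∀ k b, Continuous fun z : Fin m → G => Q.im (z k) b := fun k b =>
    (continuous_apply b).comp (Q.continuous_im.comp (continuous_apply k))
  simp only [irreducible, Set.ofPred_or, Set.ofPred_exists, vec3_dotProduct, cross_apply_zero,
    cross_apply_one, cross_apply_two]
  refine IsOpen.union (isOpen_iUnion fun i => isOpen_iUnion fun j => ?_)
    (isOpen_iUnion fun i => isOpen_iUnion fun j => isOpen_iUnion fun k => ?_)
  all_goals exact isOpen_ne_fun (by fun_prop) continuous_const

theorem isClosed_commuting : IsClosed (Q.commuting m) := by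
  have h2 : ∀ k, Continuous fun z : Fin m → G => Q.im (z k) := fun k =>
    Q.continuous_im.comp (continuous_apply k)
  simp only [commuting, Set.ofPred_forall]
  refine isClosed_iInter fun i => isClosed_iInter fun j => isClosed_eq ?_ continuous_const
  have h3 : ∀ k b, Continuous fun z : Fin m → G => Q.im (z k) b := fun k b =>
    (continuous_apply b).comp (h2 k)
  refine continuous_pi fun b => ?_
  fin_cases b <;> simp only [Fin.zero_eta, Fin.mk_one, Fin.reduceFinMk, cross_apply_zero,
    cross_apply_one, cross_apply_two] <;> fun_prop

/-- The imaginary part of `g` is parallel to two vectors that are not parallel to each other, so it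
vanishes. -/
theorem mem_center_of_commute {z : Fin m → G} (hz : z ∉ Q.commuting m) {g : G}
    (hg : ∀ k, g * z k = z k * g) : g ∈ Subgroup.center G := by
  refine Q.mem_center_of_im_eq_zero ?_
  simp only [commuting, Set.mem_ofPred_eq, not_forall] at hz
  obtain ⟨i, j, hij⟩ := hz
  obtain ⟨b, hb⟩ := Function.ne_iff.1 hij
  have hi := (Q.mul_comm_iff _ _).1 (hg i)
  have hj := (Q.mul_comm_iff _ _).1 (hg j)
  have p0 := congrFun hi 0
  have p1 := congrFun hi 1
  have p2 := congrFun hi 2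
  have q0 := congrFun hj 0
  have q1 := congrFun hj 1
  have q2 := congrFun hj 2
  simp only [cross_apply_zero, cross_apply_one, cross_apply_two, Pi.zero_apply] at p0 p1 p2 q0 q1 q2 hb
  apply vec3_ext <;> refine mul_right_cancel₀ hb ?_ <;> rw [Pi.zero_apply] <;>
    fin_cases b <;> simp only [Fin.zero_eta, Fin.mk_one, Fin.reduceFinMk, cross_apply_zero,
      cross_apply_one, cross_apply_two] <;> grind

theorem contDiffAt_coordAlg {ε : Fin m → ℤˣ} {v : Fin m → Fin 3 → K} (hv : denom v ≠ 0)
    {f : (Fin m → G) → K} (hf : f ∈ Q.coordAlg (id : (Fin m → G) → _)) :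
    ContDiffAt K ∞ (fun v => f (Q.chartInv ε v)) v := by
  have hd : ∀ k, ContDiff K ∞ fun v : Fin m → Fin 3 → K => v k ⬝ᵥ v k := fun k => by
    simp only [vec3_dotProduct]; fun_prop
  have hev : ∀ᶠ w : Fin m → Fin 3 → K in 𝓝 v, denom w ≠ 0 :=
    ContinuousAt.eventually_ne (Continuous.continuousAt (by
      unfold denom
      exact continuous_finsetProd _ fun k _ => continuous_const.add (hd k).continuous)) hv
  induction hf using Algebra.adjoin_induction with
  | mem f hf =>
    rcases hf with ⟨k, rfl⟩ | ⟨⟨k, b⟩, rfl⟩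
    · have h1 : ContDiffAt K ∞ (fun v : Fin m → Fin 3 → K =>
          sg K (ε k) * (1 - v k ⬝ᵥ v k) / (1 + v k ⬝ᵥ v k)) v :=
        (contDiffAt_const.mul (contDiffAt_const.sub (hd k).contDiffAt)).div
          (contDiffAt_const.add (hd k).contDiffAt) (denom_ne_zero.1 hv k)
      refine h1.congr_of_eventuallyEq (hev.mono fun w hw => ?_)
      exact re_stereoInv (denom_ne_zero.1 hw k)
    · have h1 : ContDiffAt K ∞ (fun v : Fin m → Fin 3 → K =>
          (2 * sg K (ε k) / (1 + v k ⬝ᵥ v k)) * v k b) v :=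
        (contDiffAt_const.div (contDiffAt_const.add (hd k).contDiffAt) (denom_ne_zero.1 hv k)).mul
          (ContDiff.contDiffAt (by fun_prop))
      refine h1.congr_of_eventuallyEq (hev.mono fun w hw => ?_)
      exact congrFun (im_stereoInv (denom_ne_zero.1 hw k)) b
  | algebraMap r => exact contDiffAt_const
  | add f f' _ _ hf hf' => exact hf.add hf'
  | mul f f' _ _ hf hf' => exact hf.mul hf'

variable {E : Type} [NormedAddCommGroup E] [NormedSpace K E] {M : Type} [TopologicalSpace M]
  [Nonempty M] {h : M → Fin m → G} (hh : IsOpenEmbedding h) (LE : (Fin m → Fin 3 → K) ≃L[K] E)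

/-- Smoothness holds because words are polynomial in the coordinates. The differential is injective
because the chart extends to a differentiable function `H` of the ambient entries, defined through
`J'`, and `H` is a left inverse of the map read in the chart. -/
theorem isSmoothImmersion_locus {V : Type} [NormedAddCommGroup V] [NormedSpace K V] {σ : Type}
    [Fintype σ] (J : (K × (Fin 3 → K)) →L[K] V) (J' : V →L[K] (K × (Fin 3 → K)))
    (hJ : ∀ q, J' (J q) = q) (Z : M → σ → G) (ι : Fin m → σ) (hι : ∀ x k, Z x (ι k) = h x k)
    (hZ : ∀ s, ∃ w : FreeGroup (Fin m), ∀ x, Z x s = FreeGroup.lift (h x) w) :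
    letI := Q.locusChartedSpace hh LE
    IsSmoothImmersion K E (fun x s => J (Q.re (Z x s), Q.im (Z x s))) := by
  letI := Q.locusChartedSpace hh LE
  set f : M → σ → V := fun x s => J (Q.re (Z x s), Q.im (Z x s)) with hf
  have key : ∀ ε x, x ∈ (Q.locusChart hh LE ε).source →
      ContDiffAt K ∞ (f ∘ (Q.locusChart hh LE ε).symm) (Q.locusChart hh LE ε x) ∧
      Function.Injective (fderiv K (f ∘ (Q.locusChart hh LE ε).symm) (Q.locusChart hh LE ε x)) := by
    intro ε x hx
    have htgt := (Q.locusChart hh LE ε).map_source hx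
    have hev := (Q.locusChart hh LE ε).open_target.mem_nhds htgt
    have hsm : ContDiffAt K ∞ (f ∘ (Q.locusChart hh LE ε).symm) (Q.locusChart hh LE ε x) := by
      refine contDiffAt_pi.2 fun s => J.contDiff.contDiffAt.comp _ ?_
      obtain ⟨w, hw⟩ := hZ s
      obtain ⟨h1, h2⟩ := Q.word_mem (id : (Fin m → G) → _) w
      have hd := denom_ne_zero.2 (Q.of_mem_locusChart_target hh LE htgt).1
      have hsymm : ∀ᶠ y in 𝓝 (Q.locusChart hh LE ε x),
          Z ((Q.locusChart hh LE ε).symm y) s = FreeGroup.lift (Q.chartInv ε (LE.symm y)) w := by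
        filter_upwards [hev] with y hy
        rw [hw, (Q.of_mem_locusChart_target hh LE hy).2]
      refine ContDiffAt.prodMk ?_ (contDiffAt_pi.2 fun b => ?_)
      · refine ((Q.contDiffAt_coordAlg (ε := ε) hd h1).comp _
          LE.symm.contDiff.contDiffAt).congr_of_eventuallyEq (hsymm.mono fun y hy => ?_)
        exact congrArg Q.re hy
      · refine ((Q.contDiffAt_coordAlg (ε := ε) hd (h2 b)).comp _
          LE.symm.contDiff.contDiffAt).congr_of_eventuallyEq (hsymm.mono fun y hy => ?_)
        exact congrFun (congrArg Q.im hy) b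
    refine ⟨hsm, ?_⟩
    let H : (σ → V) → E := fun w => LE fun k =>
      (sg K (ε k) / (1 + sg K (ε k) * (J' (w (ι k))).1)) • (J' (w (ι k))).2
    have hH : ∀ y, H (f y) = Q.locusChart hh LE ε y := fun y => by
      simp only [H, hf, hJ, hι]
      rfl
    have hHd : DifferentiableAt K H (f x) := by
      refine LE.differentiableAt.comp (f x) (differentiableAt_pi.2 fun k => ?_)
      have h2 : 1 + sg K (ε k) * (J' (f x (ι k))).1 ≠ 0 := by
        simp only [hf, hJ, hι]
        exact (Q.mem_locusChart_source hh LE).1 hx k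
      have h1 : DifferentiableAt K (fun w : σ → V => J' (w (ι k))) (f x) :=
        (J'.differentiable.comp (differentiable_apply (𝕜 := K) (F' := fun _ : σ => V) (ι k))) (f x)
      have ha : DifferentiableAt K
          (fun w : σ → V => sg K (ε k) / (1 + sg K (ε k) * (J' (w (ι k))).1)) (f x) := by
        simp only [div_eq_mul_inv]
        exact (differentiableAt_const _).fun_mul (((differentiableAt_const _).fun_add
          ((differentiableAt_const _).fun_mul h1.fst)).fun_inv h2)
      exact ha.fun_smul h1.snd
    have hid : H ∘ (f ∘ (Q.locusChart hh LE ε).symm) =ᶠ[𝓝 (Q.locusChart hh LE ε x)] id := by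
      filter_upwards [hev] with y hy
      simp only [Function.comp_apply, hH, id]
      exact (Q.locusChart hh LE ε).right_inv hy
    have hfx : (f ∘ (Q.locusChart hh LE ε).symm) (Q.locusChart hh LE ε x) = f x := by
      rw [Function.comp_apply, (Q.locusChart hh LE ε).left_inv hx]
    have hcomp := fderiv_comp (Q.locusChart hh LE ε x) (by rwa [hfx]) (hsm.differentiableAt (by simp))
    rw [hid.fderiv_eq, fderiv_id] at hcomp
    intro a b hab
    have h1 := DFunLike.congr_fun hcomp a
    have h2 := DFunLike.congr_fun hcomp b
    rw [ContinuousLinearMap.comp_apply] at h1 h2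
    rw [hab] at h1
    exact h1.trans h2.symm
  have hc : ∀ x, ∃ ε, chartAt E x = Q.locusChart hh LE ε := fun x => ⟨_, rfl⟩
  have hcont : Continuous f := by
    refine continuous_pi fun s => J.continuous.comp ?_
    obtain ⟨w, hw⟩ := hZ s
    obtain ⟨h1, h2⟩ := Q.word_mem (id : (Fin m → G) → _) w
    simp only [hw]
    refine Continuous.prodMk ?_ (continuous_pi fun b => ?_)
    · exact (Q.continuous_of_mem_coordAlg (fun k => continuous_apply k) h1).comp hh.continuous
    · exact (Q.continuous_of_mem_coordAlg (fun k => continuous_apply k) (h2 b)).comp hh.continuous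
  have hsm : ContMDiff 𝓘(K, E) 𝓘(K, σ → V) ∞ f := fun x => by
    obtain ⟨ε, hε⟩ := hc x
    rw [contMDiffAt_iff_charts, hε]
    exact ⟨hcont.continuousAt, (key ε x (hε ▸ mem_chart_source E x)).1⟩
  refine ⟨hsm, fun x => ?_⟩
  obtain ⟨ε, hε⟩ := hc x
  rw [mfderiv_eq_fderiv_charts (hsm x), hε]
  exact (key ε x (hε ▸ mem_chart_source E x)).2

end QuatModel

end SurfaceRep
end

noncomputable section
namespace SurfaceRep

/-! ### The homomorphism space in coordinates -/

open Topology

/-- An identification of the homomorphism space with a power of `G` by some of the values on the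
generators. -/
structure Coordinates (g n m : ℕ) (G : Type) [Group G] [TopologicalSpace G] where
  equiv : HomSpace g n G ≃ₜ (Fin m → G)
  gen : Fin m → Gen g n
  apply_eq : ∀ ρ k, equiv ρ k = genValues ρ (gen k)
  word : ∀ γ : SurfaceGroup g n, ∃ w : FreeGroup (Fin m), ∀ ρ,
    toHom ρ γ = FreeGroup.lift (equiv ρ) w

theorem nonempty_coordinates {g n m : ℕ} {G : Type} [Group G] [TopologicalSpace G]
    [IsTopologicalGroup G] (hn : 0 < n) (hm : 2 * g + n - 1 = m) :
    Nonempty (Coordinates g n m G) := by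
  obtain ⟨e, ι, h1, h2⟩ := exists_coordinates (G := G) hn hm
  exact ⟨⟨e, ι, h1, h2⟩⟩

/-- Homomorphisms with commutative image. -/
def abelianLocus (g n : ℕ) (G : Type) [Group G] : Set (HomSpace g n G) :=
  {ρ | ∀ γ γ', toHom ρ γ * toHom ρ γ' = toHom ρ γ' * toHom ρ γ}

theorem lift_commute {G σ : Type} [Group G] {z : σ → G} {x : G} (h : ∀ s, x * z s = z s * x)
    (w : FreeGroup σ) : x * FreeGroup.lift z w = FreeGroup.lift z w * x := by
  change Commute x _
  induction w using FreeGroup.induction_on with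
  | C1 => simp
  | of s => rw [FreeGroup.lift_apply_of]; exact h s
  | inv_of s _ => simpa using (show Commute x (z s) from h s).inv_right
  | mul a b ha hb => rw [map_mul]; exact ha.mul_right hb

/-- A matrix realisation of a group of unit quaternions, for which the polynomial functions in the
matrix entries are the polynomial functions in the coordinates. -/
structure IsMatrixModel {K G : Type} [RCLike K] [NormedSpace K ℂ] [Group G] [TopologicalSpace G]
    (Q : QuatModel K G) (j : G →* Matrix (Fin 2) (Fin 2) ℂ)
    (P : ∀ σ : Type, Subalgebra K ((σ → Matrix (Fin 2) (Fin 2) ℂ) → K)) : Prop where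
  map_eq : ∀ {σ X : Type} (φ : X → σ → G),
    (P σ).map (pullback K fun x s => j (φ x s)) = Q.coordAlg φ
  entries : ∃ (J : (K × (Fin 3 → K)) →L[K] (Fin 2 → Fin 2 → ℂ))
    (J' : (Fin 2 → Fin 2 → ℂ) →L[K] (K × (Fin 3 → K))), (∀ q, J' (J q) = q) ∧
      ∀ x a b, j x a b = J (Q.re x, Q.im x) a b
  trace : ∀ {σ : Type} (s : σ), ∃ f ∈ invariants j (P σ), ∀ x : σ → G,
    f (fun s => j (x s)) = Q.re (x s)

namespace Coordinates

variable {K G : Type} [RCLike K] [Group G] [TopologicalSpace G]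
  {Q : QuatModel K G} {g n m : ℕ} (c : Coordinates g n m G)

theorem equiv_smul (x : G) (ρ : HomSpace g n G) :
    c.equiv ((x : G ⧸ Subgroup.center G) • ρ) = fun k => x * c.equiv ρ k * x⁻¹ :=
  funext fun k => by rw [c.apply_eq, c.apply_eq, genValues_smul]

theorem equiv_symm_conj (x : G) (z : Fin m → G) :
    c.equiv.symm (fun k => x * z k * x⁻¹) = (x : G ⧸ Subgroup.center G) • c.equiv.symm z := by
  rw [Homeomorph.symm_apply_eq, c.equiv_smul, Homeomorph.apply_symm_apply]

theorem mem_abelianLocus_iff {ρ : HomSpace g n G} :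
    ρ ∈ abelianLocus g n G ↔ c.equiv ρ ∈ Q.commuting m := by
  constructor
  · intro h i j
    rw [← Q.mul_comm_iff, c.apply_eq, c.apply_eq]
    exact h _ _
  · intro h γ γ'
    obtain ⟨w, hw⟩ := c.word γ
    obtain ⟨w', hw'⟩ := c.word γ'
    rw [hw, hw']
    exact lift_commute (fun s => (lift_commute (fun s' => ((Q.mul_comm_iff _ _).2 (h s s'))) w).symm) w'

variable (Q) in
theorem abelianLocus_eq : abelianLocus g n G = c.equiv ⁻¹' Q.commuting m :=
  Set.ext fun _ => c.mem_abelianLocus_iff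

variable (Q) in
theorem image_commuting : c.equiv.symm '' Q.commuting m = abelianLocus g n G := by
  rw [c.abelianLocus_eq Q, Homeomorph.image_symm]

variable (Q) in
include c Q in
theorem stabilizer_eq_bot {ρ : HomSpace g n G} (hρ : ρ ∈ (abelianLocus g n G)ᶜ) :
    MulAction.stabilizer (G ⧸ Subgroup.center G) ρ = ⊥ := by
  refine (Subgroup.eq_bot_iff_forall _).2 fun y hy => ?_
  induction y using QuotientGroup.induction_on with
  | H x =>
    rw [MulAction.mem_stabilizer_iff] at hy
    refine (QuotientGroup.eq_one_iff x).2 (Q.mem_center_of_commute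
      (fun h => hρ (c.mem_abelianLocus_iff.2 h)) fun k => ?_)
    have h := congrFun (c.equiv_smul x ρ) k
    rw [hy] at h
    exact (eq_mul_inv_iff_mul_eq.1 h).symm

variable (Q) in
include c Q in
theorem isConnected_abelianLocus (hK : IsSpinField K) : IsConnected (abelianLocus g n G) := by
  rw [← c.image_commuting Q]
  exact (Q.isConnected_commuting hK).image _ c.equiv.symm.continuous.continuousOn

variable [NormedSpace K ℂ] {j : G →* Matrix (Fin 2) (Fin 2) ℂ}
  {P : ∀ σ : Type, Subalgebra K ((σ → Matrix (Fin 2) (Fin 2) ℂ) → K)}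

-- The values on all generators are words in the coordinates, and the coordinates are among these
-- values, so both families generate the same algebra.
include c in
theorem regHom_eq (hP : IsMatrixModel Q j P) :
    regHom j (P (Gen g n)) = Q.coordAlg (c.equiv : HomSpace g n G → _) := by
  refine (hP.map_eq (fun ρ : HomSpace g n G => genValues ρ)).trans (le_antisymm ?_ ?_)
  · exact Q.coordAlg_le_of_words _ _ fun s => c.word (PresentedGroup.of s)
  · exact Q.coordAlg_le_of_words _ _ fun k => ⟨FreeGroup.of (c.gen k), fun ρ => by
      rw [FreeGroup.lift_apply_of, c.apply_eq]⟩

theorem comp_symm_mem (hP : IsMatrixModel Q j P) {f : HomSpace g n G → K}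
    (hf : f ∈ regHom j (P (Gen g n))) :
    f ∘ c.equiv.symm ∈ Q.coordAlg (id : (Fin m → G) → _) := by
  rw [c.regHom_eq hP] at hf
  have h := Q.map_coordAlg (c.equiv : HomSpace g n G → _) c.equiv.symm
  rw [show (c.equiv : HomSpace g n G → _) ∘ c.equiv.symm = id from
    funext fun z => c.equiv.apply_symm_apply z] at h
  rw [← h]
  exact ⟨f, hf, rfl⟩

theorem mem_regPow_iff (hP : IsMatrixModel Q j P) (f : (Fin m → G) → K) :
    f ∈ regPow j (P (Fin m)) ↔ f ∘ c.equiv ∈ regHom j (P (Gen g n)) := by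
  rw [show regPow j (P (Fin m)) = Q.coordAlg (id : (Fin m → G) → _) from hP.map_eq _]
  constructor
  · intro hf
    rw [c.regHom_eq hP, ← Function.id_comp (c.equiv : HomSpace g n G → _), ← Q.map_coordAlg]
    exact ⟨f, hf, rfl⟩
  · intro hf
    convert c.comp_symm_mem hP hf using 1
    exact funext fun z => by simp

include c in
theorem isZariskiIrreducible_abelianLocus (hP : IsMatrixModel Q j P) :
    IsZariskiIrreducible (regHom j (P (Gen g n))) (abelianLocus g n G) := by
  rw [← c.image_commuting Q]
  exact Q.isZariskiIrreducible_commuting.image _ fun f hf => c.comp_symm_mem hP hf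

end Coordinates

end SurfaceRep
end

noncomputable section
namespace SurfaceRep

/-! ### The loci of the homomorphism space and of its quotients -/

open Topology

/-- Determinants with a square root over `K` are positive over `ℝ`. -/
def HasPositiveSquares (K : Type) [RCLike K] (E : Type) [NormedAddCommGroup E] [NormedSpace K E]
    [NormedSpace ℝ E] [IsScalarTower ℝ K E] : Prop :=
  ∀ L : E →L[K] E, (∃ s, s ≠ 0 ∧ L.det = s ^ 2) → 0 < (L.restrictScalars ℝ).det

namespace Coordinates

variable {K G : Type} [RCLike K] [Group G] [TopologicalSpace G]
  {Q : QuatModel K G} {g n m : ℕ}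

theorem nonempty_equiv (m d : ℕ) (h : 3 * m = d) :
    Nonempty ((Fin m → Fin 3 → K) ≃L[K] EuclideanSpace K (Fin d)) := by
  refine ⟨ContinuousLinearEquiv.ofFinrankEq ?_⟩
  simp [Module.finrank_pi_fintype, ← h, mul_comm]

section Basic

variable (c : Coordinates g n m G)

theorem isOpenEmbedding_restrict {S : Set (HomSpace g n G)} (hS : IsOpen S) :
    IsOpenEmbedding fun ρ : S => c.equiv ρ.1 :=
  c.equiv.isOpenEmbedding.comp hS.isOpenEmbedding_subtypeVal

include c Q in
variable (Q) in
theorem isOpen_abelianLocus_compl : IsOpen (abelianLocus g n G)ᶜ := by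
  rw [isOpen_compl_iff, c.abelianLocus_eq Q]
  exact Q.isClosed_commuting.preimage c.equiv.continuous

include c Q in
variable (Q) in
theorem t2Space_homSpace : T2Space (HomSpace g n G) := by
  have := Q.t2Space
  exact c.equiv.isEmbedding.t2Space

include c Q in
variable (Q) in
theorem secondCountableTopology_homSpace : SecondCountableTopology (HomSpace g n G) := by
  have := Q.secondCountableTopology
  exact c.equiv.isEmbedding.secondCountableTopology

section Manifold

variable [NormedSpace K ℂ] {j : G →* Matrix (Fin 2) (Fin 2) ℂ}
  {P : ∀ σ : Type, Subalgebra K ((σ → Matrix (Fin 2) (Fin 2) ℂ) → K)}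

theorem isOrientedManifold_locus (hP : IsMatrixModel Q j P) (hK : IsSpinField K) {E : Type} [NormedAddCommGroup E]
    [NormedSpace K E] [NormedSpace ℝ E] [IsScalarTower ℝ K E] (hE : HasPositiveSquares K E)
    (LE : (Fin m → Fin 3 → K) ≃L[K] E) {S : Set (HomSpace g n G)} (hS : IsOpen S) [Nonempty S] :
    letI := Q.locusChartedSpace (c.isOpenEmbedding_restrict hS) LE
    IsOrientedManifold K E S ∧ IsSmoothImmersion K E (lamEntries j S) := by
  letI := Q.locusChartedSpace (c.isOpenEmbedding_restrict hS) LE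
  have := c.t2Space_homSpace Q
  have := c.secondCountableTopology_homSpace Q
  obtain ⟨h1, h2⟩ := Q.isManifold_locus (c.isOpenEmbedding_restrict hS) LE hK hE
  refine ⟨⟨inferInstance, inferInstance, h1, h2⟩, ?_⟩
  obtain ⟨J, J', hJ, hj⟩ := hP.entries
  have h3 := Q.isSmoothImmersion_locus (c.isOpenEmbedding_restrict hS) LE J J' hJ
    (fun ρ : S => genValues ρ.1) c.gen (fun ρ k => (c.apply_eq ρ.1 k).symm)
    fun s => (c.word (PresentedGroup.of s)).imp fun w hw ρ => hw ρ.1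
  convert h3 using 1
  funext ρ s a b
  exact hj _ _ _

include c in
theorem isOrientedSubmanifold (hP : IsMatrixModel Q j P) (hK : IsSpinField K) {d : ℕ}
    [NormedSpace ℝ (EuclideanSpace K (Fin d))] [IsScalarTower ℝ K (EuclideanSpace K (Fin d))]
    (hE : HasPositiveSquares K (EuclideanSpace K (Fin d))) (hd : 3 * m = d)
    {S : Set (HomSpace g n G)} (hS : IsOpen S) (hne : S.Nonempty) :
    IsOrientedSubmanifold K j d S := by
  have := hne.to_subtype
  obtain ⟨LE⟩ := nonempty_equiv (K := K) m d hd
  exact ⟨_, c.isOrientedManifold_locus hP hK hE LE hS⟩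

theorem algDim_abelianLocus (c : Coordinates g n (m + 1) G) (hP : IsMatrixModel Q j P)
    (hK : IsSpinField K) :
    algDim (regHom j (P (Gen g n))) (abelianLocus g n G) = (m + 3 : ℕ) := by
  have hirr := c.isZariskiIrreducible_abelianLocus hP
  have hdom := isDomain_map_of_isZariskiIrreducible hirr
  rw [algDim]
  rw [c.regHom_eq hP, Q.map_coordAlg] at hdom ⊢
  refine Q.ringKrullDim_coordAlg hK _ ?_
  rw [Set.range_comp, Subtype.range_coe, c.abelianLocus_eq Q, c.equiv.image_preimage]

end Manifold

end Basic

/-- A quotient of the homomorphism space by conjugation, in which the basic invariants are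
well-defined and every reducible homomorphism is identified with a commutative one. -/
structure IsRepQuotient (Q : QuatModel K G) (c : Coordinates g n m G) {R : Type} [TopologicalSpace R]
    (π : HomSpace g n G → R) : Prop where
  isQuotientMap : IsQuotientMap π
  map_smul : ∀ (x : G) ρ, π ((x : G ⧸ Subgroup.center G) • ρ) = π ρ
  invMap_eq : ∀ ρ ρ', π ρ = π ρ' → Q.invMap (c.equiv ρ) = Q.invMap (c.equiv ρ')
  reducible : ∀ ρ, c.equiv ρ ∉ Q.irreducible m → π ρ ∈ π '' abelianLocus g n G

namespace IsRepQuotient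

variable {c : Coordinates g n m G} {R : Type} [TopologicalSpace R] {π : HomSpace g n G → R}
  (h : IsRepQuotient Q c π)
include h

theorem eq_iff (hK : IsSpinField K) {ρ ρ' : HomSpace g n G} (hρ : c.equiv ρ ∈ Q.irreducible m) :
    π ρ = π ρ' ↔ ∃ x : G, c.equiv ρ' = fun k => x * c.equiv ρ k * x⁻¹ := by
  constructor
  · exact fun hp => Q.exists_conj_of_invMap_eq hK hρ (h.invMap_eq _ _ hp)
  · rintro ⟨x, hx⟩
    rw [← c.equiv_smul, c.equiv.injective.eq_iff] at hx
    rw [hx, h.map_smul]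

/-- An irreducible tuple with the image of a commuting one would be conjugate to it, while
irreducibility is preserved by conjugation and excludes commuting. -/
theorem preimage_compl (hK : IsSpinField K) :
    π ⁻¹' (π '' abelianLocus g n G)ᶜ = c.equiv ⁻¹' Q.irreducible m := by
  ext ρ
  refine ⟨fun hρ => not_not.1 fun h' => hρ (h.reducible ρ h'), ?_⟩
  rintro hρ ⟨ρ', hρ', hp⟩
  obtain ⟨x, hx⟩ := (h.eq_iff hK hρ).1 hp.symm
  rw [c.mem_abelianLocus_iff (Q := Q), hx] at hρ'
  exact Q.irreducible_subset (Q.conj_mem_irreducible hρ x) hρ'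

theorem isOpen_compl (hK : IsSpinField K) : IsOpen (π '' abelianLocus g n G)ᶜ := by
  rw [← h.isQuotientMap.isOpen_preimage, h.preimage_compl hK]
  exact Q.isOpen_irreducible.preimage c.equiv.continuous

/-- Fibres over this locus are exact conjugation orbits, so the saturation of an open set is a union
of its translates. -/
theorem isOpenQuotientMap (hK : IsSpinField K) :
    IsOpenQuotientMap ((π '' abelianLocus g n G)ᶜ.restrictPreimage π) := by
  have := Q.isTopologicalGroup
  have hT := h.isOpen_compl hK
  have hq := h.isQuotientMap.restrictPreimage_isOpen hT
  refine ⟨hq.surjective, hq.continuous, fun O hO => ?_⟩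
  rw [← hq.isOpen_preimage]
  have hcont : ∀ x : G, Continuous fun ρ : HomSpace g n G => (x : G ⧸ Subgroup.center G) • ρ := by
    intro x
    rw [← c.equiv.comp_continuous_iff]
    simp only [Function.comp_def, c.equiv_smul]
    fun_prop
  have hmem : ∀ (x : G) (ρ : HomSpace g n G), π ρ ∈ (π '' abelianLocus g n G)ᶜ →
      π ((x : G ⧸ Subgroup.center G) • ρ) ∈ (π '' abelianLocus g n G)ᶜ := fun x ρ hρ => by
    rwa [h.map_smul]
  have key : (π '' abelianLocus g n G)ᶜ.restrictPreimage π ⁻¹'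
      ((π '' abelianLocus g n G)ᶜ.restrictPreimage π '' O) =
      ⋃ x : G, (fun ρ : π ⁻¹' (π '' abelianLocus g n G)ᶜ =>
        (⟨(x : G ⧸ Subgroup.center G) • ρ.1, hmem x ρ.1 ρ.2⟩ : π ⁻¹' (π '' abelianLocus g n G)ᶜ)) ⁻¹' O := by
    ext ρ
    simp only [Set.mem_preimage, Set.mem_image, Set.mem_iUnion]
    constructor
    · rintro ⟨ρ', hρ', hp⟩
      have hi : c.equiv ρ.1 ∈ Q.irreducible m := (h.preimage_compl hK).le ρ.2
      obtain ⟨x, hx⟩ := (h.eq_iff hK hi).1 (congrArg Subtype.val hp).symm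
      rw [← c.equiv_smul, c.equiv.injective.eq_iff] at hx
      refine ⟨x, ?_⟩
      convert hρ'
      exact hx.symm
    · rintro ⟨x, hx⟩
      exact ⟨_, hx, Subtype.ext (h.map_smul x ρ.1)⟩
  rw [key]
  exact isOpen_iUnion fun x => hO.preimage (((hcont x).comp continuous_subtype_val).subtype_mk _)

/-- The basic invariants descend to a continuous injective map into a Hausdorff space. -/
theorem t2Space_compl (hK : IsSpinField K) : T2Space ((π '' abelianLocus g n G)ᶜ : Set R) := by
  have hq := h.isOpenQuotientMap hK
  have hs := hq.surjective
  let f : ((π '' abelianLocus g n G)ᶜ : Set R) → _ := fun y => Q.invMap (c.equiv (hs y).choose.1)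
  have hf : ∀ ρ, f ((π '' abelianLocus g n G)ᶜ.restrictPreimage π ρ) = Q.invMap (c.equiv ρ.1) :=
    fun ρ => h.invMap_eq _ _ (congrArg Subtype.val
      (hs ((π '' abelianLocus g n G)ᶜ.restrictPreimage π ρ)).choose_spec)
  refine T2Space.of_injective_continuous (f := f) ?_ (hq.isQuotientMap.continuous_iff.2 ?_)
  · intro y y' hy
    obtain ⟨ρ, rfl⟩ := hs y
    obtain ⟨ρ', rfl⟩ := hs y'
    rw [hf, hf] at hy
    have hi : c.equiv ρ.1 ∈ Q.irreducible m := (h.preimage_compl hK).le ρ.2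
    exact Subtype.ext ((h.eq_iff hK hi).2 (Q.exists_conj_of_invMap_eq hK hi hy))
  · rw [show f ∘ _ = fun ρ => Q.invMap (c.equiv ρ.1) from funext hf]
    exact Q.continuous_invMap.comp (c.equiv.continuous.comp continuous_subtype_val)

theorem isConnected_image (hK : IsSpinField K) : IsConnected (π '' abelianLocus g n G) :=
  (c.isConnected_abelianLocus Q hK).image _ h.isQuotientMap.continuous.continuousOn

section Reg

variable [NormedSpace K ℂ] {j : G →* Matrix (Fin 2) (Fin 2) ℂ}
  {P : ∀ σ : Type, Subalgebra K ((σ → Matrix (Fin 2) (Fin 2) ℂ) → K)}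

omit h in
theorem regRep_comp {f : R → K} (hf : f ∈ regRep j (P (Gen g n)) π) :
    f ∘ π ∈ regHom j (P (Gen g n)) := by
  obtain ⟨q, hq, hqf⟩ := hf
  exact ⟨q, hq.1, hqf⟩

omit h in
theorem isZariskiIrreducible_image (c : Coordinates g n m G) (hP : IsMatrixModel Q j P) :
    IsZariskiIrreducible (regRep j (P (Gen g n)) π) (π '' abelianLocus g n G) :=
  (c.isZariskiIrreducible_abelianLocus hP).image π fun _ hf => regRep_comp hf

theorem algDim_image (hP : IsMatrixModel Q j P) (hK : IsSpinField K) :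
    algDim (regRep j (P (Gen g n)) π) (π '' abelianLocus g n G) = m := by
  rw [algDim, ← c.image_commuting Q, ← Set.image_comp]
  refine Q.ringKrullDim_of_invariant hK _ (π ∘ c.equiv.symm)
    (fun f hf => c.comp_symm_mem hP (regRep_comp hf)) (fun x z => ?_) fun k => ?_
  · rw [Function.comp_apply, c.equiv_symm_conj, h.map_smul, Function.comp_apply]
  · obtain ⟨q, hq, hqx⟩ := hP.trace (c.gen k)
    let f : R → K := fun y => Q.re (c.equiv (h.isQuotientMap.surjective y).choose k)
    have hf : ∀ ρ, f (π ρ) = Q.re (c.equiv ρ k) := fun ρ => congrFun (congrArg Prod.fst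
      (h.invMap_eq _ _ (h.isQuotientMap.surjective (π ρ)).choose_spec)) k
    refine ⟨f, ⟨q, hq, funext fun ρ => ?_⟩, fun z => ?_⟩
    · exact (hqx (genValues ρ)).trans ((congrArg Q.re (c.apply_eq ρ k)).symm.trans (hf ρ).symm)
    · rw [Function.comp_apply, hf, Homeomorph.apply_symm_apply]

end Reg

end IsRepQuotient

section AtLeastTwo

variable (c : Coordinates g n (m + 2) G)

include c Q in
variable (Q) in
theorem isConnected_abelianLocus_compl (hK : IsSpinField K) : IsConnected (abelianLocus g n G)ᶜ := by
  rw [c.abelianLocus_eq Q, ← Set.preimage_compl, ← c.equiv.image_symm]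
  exact (Q.isConnected_compl_commuting hK).image _ c.equiv.symm.continuous.continuousOn

theorem dense_preimage_irreducible (hK : IsSpinField K) :
    Dense (c.equiv ⁻¹' Q.irreducible (m + 2)) :=
  (Q.dense_irreducible hK).preimage c.equiv.isOpenMap

include c Q in
variable (Q) in
theorem dense_abelianLocus_compl (hK : IsSpinField K) : Dense (abelianLocus g n G)ᶜ := by
  rw [c.abelianLocus_eq Q]
  exact (c.dense_preimage_irreducible hK).mono (Set.preimage_mono Q.irreducible_subset)

namespace IsRepQuotient

variable {c} {R : Type} [TopologicalSpace R] {π : HomSpace g n G → R} (h : IsRepQuotient Q c π)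
include h

theorem image_irreducible (hK : IsSpinField K) :
    π '' (c.equiv ⁻¹' Q.irreducible (m + 2)) = (π '' abelianLocus g n G)ᶜ := by
  rw [← h.preimage_compl hK, Set.image_preimage_eq _ h.isQuotientMap.surjective]

theorem isConnected_compl (hK : IsSpinField K) : IsConnected (π '' abelianLocus g n G)ᶜ := by
  rw [← h.image_irreducible hK, ← c.equiv.image_symm]
  exact ((Q.isConnected_irreducible hK).image _ c.equiv.symm.continuous.continuousOn).image _
    h.isQuotientMap.continuous.continuousOn

theorem dense_compl (hK : IsSpinField K) : Dense (π '' abelianLocus g n G)ᶜ := by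
  rw [← h.image_irreducible hK]
  exact h.isQuotientMap.surjective.denseRange.dense_image h.isQuotientMap.continuous
    (c.dense_preimage_irreducible hK)

theorem isOrientedQuotientManifold [NormedSpace K ℂ] {j : G →* Matrix (Fin 2) (Fin 2) ℂ}
    {P : ∀ σ : Type, Subalgebra K ((σ → Matrix (Fin 2) (Fin 2) ℂ) → K)}
    (hP : IsMatrixModel Q j P) (hK : IsSpinField K)
    {W : Mixing K (m + 2) → ℤˣ → Set (Fin (m + 2) → Fin 3 → K)} (hW : OrientingSets K m W) {D d : ℕ}
    [NormedSpace ℝ (EuclideanSpace K (Fin D))] [IsScalarTower ℝ K (EuclideanSpace K (Fin D))]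
    (hE : HasPositiveSquares K (EuclideanSpace K (Fin D)))
    [NormedSpace ℝ (EuclideanSpace K (Fin d))] [IsScalarTower ℝ K (EuclideanSpace K (Fin d))]
    (hF : HasPositiveSquares K (EuclideanSpace K (Fin d)))
    (hD : 3 * (m + 2) = D) (hd : 3 * (m + 1) = d) :
    IsOrientedQuotientManifold K j D d π (π '' abelianLocus g n G)ᶜ := by
  have hT := h.isOpen_compl hK
  have hS : IsOpen (π ⁻¹' (π '' abelianLocus g n G)ᶜ) := hT.preimage h.isQuotientMap.continuous
  have hp := h.isOpenQuotientMap hK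
  have hT2 := h.t2Space_compl hK
  have := c.secondCountableTopology_homSpace Q
  have hsc : SecondCountableTopology ((π '' abelianLocus g n G)ᶜ : Set R) :=
    hp.isQuotientMap.secondCountableTopology hp.isOpenMap
  have : Nonempty (π ⁻¹' (π '' abelianLocus g n G)ᶜ) := by
    obtain ⟨y, hy⟩ := (h.isConnected_compl hK).nonempty
    exact ⟨(hp.surjective ⟨y, hy⟩).choose⟩
  have hirr : ∀ ρ : π ⁻¹' (π '' abelianLocus g n G)ᶜ, c.equiv ρ.1 ∈ Q.irreducible (m + 2) := by
    rw [h.preimage_compl hK]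
    exact fun ρ => ρ.2
  obtain ⟨LE⟩ := nonempty_equiv (K := K) (m + 2) D hD
  obtain ⟨LF⟩ := nonempty_equiv (K := K) (m + 1) d hd
  obtain ⟨h1, h2⟩ := c.isOrientedManifold_locus hP hK hE LE hS
  obtain ⟨C, h3, h4, h5⟩ := Q.exists_quotient_manifold (c.isOpenEmbedding_restrict hS) LE LF hK hW hp
    (fun x y => Subtype.ext_iff.trans (h.eq_iff hK (hirr x))) hirr hF
  exact ⟨_, C, h1, h2, ⟨hT2, hsc, h3, h4⟩, h5⟩

end IsRepQuotient

end AtLeastTwo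

end Coordinates

end SurfaceRep
end

noncomputable section
namespace SurfaceRep

/-! ### The fields of real and complex numbers -/

theorem exists_cos_sin_real {a b : ℝ} (h : a ^ 2 + b ^ 2 = 1) :
    ∃ t, Real.cos t = a ∧ Real.sin t = b := by
  have hn : ‖(⟨a, b⟩ : ℂ)‖ = 1 := by
    rw [Complex.norm_def, Complex.normSq_mk, ← sq, ← sq, h, Real.sqrt_one]
  refine ⟨Complex.arg ⟨a, b⟩, ?_, ?_⟩
  · rw [Complex.cos_arg (by rintro h0; simp [h0] at hn), hn, div_one]
  · rw [Complex.sin_arg, hn, div_one]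

theorem isSpinField_real : IsSpinField ℝ where
  sqrt a p := ⟨√(a ^ 2 + p ⬝ᵥ p), Real.sq_sqrt (by rw [vec3_dotProduct]; nlinarith [sq_nonneg a, mul_self_nonneg (p 0), mul_self_nonneg (p 1), mul_self_nonneg (p 2)])⟩
  circle := by
    rw [show {c : ℝ × ℝ | c.1 ^ 2 + c.2 ^ 2 = 1} = Set.range fun t : ℝ => (Real.cos t, Real.sin t) from ?_]
    · exact isPreconnected_range (by fun_prop)
    · ext ⟨a, b⟩
      simp only [Set.mem_ofPred_eq, Set.mem_range, Prod.mk.injEq]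
      constructor
      · exact exists_cos_sin_real
      · rintro ⟨t, rfl, rfl⟩
        exact Real.cos_sq_add_sin_sq t
  arc := by
    refine ⟨(fun c : ℝ => (c, √(1 - c ^ 2))) '' Set.Ioo (-1) 1,
      isPreconnected_Ioo.image _ (by fun_prop), ?_, ?_⟩
    · rintro _ ⟨c, hc, rfl⟩
      have h : 0 < 1 - c ^ 2 := by nlinarith [hc.1, hc.2]
      exact ⟨by rw [Real.sq_sqrt h.le]; ring, (Real.sqrt_pos.2 h).ne'⟩
    · intro c w h hw
      have : 0 < w ⬝ᵥ w := lt_of_le_of_ne (by rw [vec3_dotProduct]; nlinarith [mul_self_nonneg (w 0), mul_self_nonneg (w 1), mul_self_nonneg (w 2)]) hw.symm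
      exact ⟨_, c, ⟨by nlinarith, by nlinarith⟩, rfl⟩
  box := by
    -- Three numbers below `1/2` have squares with sum below 1, so the remaining coordinate is real.
    refine ⟨Set.Ioo 0 (1 / 2), Set.Ioo_infinite (by norm_num), fun a ha b hb c hc =>
      ⟨⟨√(1 - a ^ 2 - b ^ 2 - c ^ 2), ?_⟩, ?_⟩⟩
    · rw [Real.sq_sqrt (by nlinarith [ha.1, ha.2, hb.1, hb.2, hc.1, hc.2])]; ring
    · nlinarith [ha.1, ha.2]

theorem exists_sq_eq (a : ℂ) : ∃ s, s ^ 2 = a := IsAlgClosed.exists_pow_nat_eq a two_pos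

/-- The rational parametrisation of the complex circle. -/
def circleParam (t : ℂ) : ℂ × ℂ := ((t + t⁻¹) / 2, (t - t⁻¹) / (2 * Complex.I))

theorem circleParam_sq {t : ℂ} (ht : t ≠ 0) : (circleParam t).1 ^ 2 + (circleParam t).2 ^ 2 = 1 := by
  have hI := Complex.I_ne_zero
  simp only [circleParam]
  field_simp
  rw [Complex.I_sq]
  ring

theorem exists_circleParam {c : ℂ × ℂ} (h : c.1 ^ 2 + c.2 ^ 2 = 1) :
    c.1 + c.2 * Complex.I ≠ 0 ∧ circleParam (c.1 + c.2 * Complex.I) = c := by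
  have h1 : (c.1 + c.2 * Complex.I) * (c.1 - c.2 * Complex.I) = 1 := by
    linear_combination h - c.2 ^ 2 * Complex.I_sq
  have h2 : (c.1 + c.2 * Complex.I)⁻¹ = c.1 - c.2 * Complex.I := inv_eq_of_mul_eq_one_right h1
  have hI := Complex.I_ne_zero
  refine ⟨left_ne_zero_of_mul_eq_one h1, ?_⟩
  rw [circleParam, h2]
  refine Prod.ext (by ring) ?_
  simp only
  field_simp
  ring

theorem continuousOn_circleParam : ContinuousOn circleParam {0}ᶜ := by
  have h : ContinuousOn (fun t : ℂ => t⁻¹) {0}ᶜ := continuousOn_inv₀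
  exact ((continuousOn_id.add h).div_const 2).prodMk ((continuousOn_id.sub h).div_const _)

theorem isSpinField_complex : IsSpinField ℂ where
  sqrt a p := exists_sq_eq _
  circle := by
    rw [show {c : ℂ × ℂ | c.1 ^ 2 + c.2 ^ 2 = 1} = circleParam '' {0}ᶜ from ?_]
    · exact (isConnected_compl_singleton_of_one_lt_rank (by simp [Complex.rank_real_complex]) 0).isPreconnected.image _
        continuousOn_circleParam
    · ext c
      refine ⟨fun h => ⟨_, (exists_circleParam h).1, (exists_circleParam h).2⟩, ?_⟩
      rintro ⟨t, ht, rfl⟩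
      exact circleParam_sq ht
  arc := by
    have hfin : ({0, 1, -1} : Set ℂ).Finite := by simp
    -- The parameters `±1` are the points with `s = 0`. The plane without finitely many points stays
    -- connected.
    refine ⟨circleParam '' {0, 1, -1}ᶜ,
      (hfin.countable.isConnected_compl_of_one_lt_rank
        (by simp [Complex.rank_real_complex])).isPreconnected.image _
        (continuousOn_circleParam.mono (Set.compl_subset_compl.2 (by simp))), ?_, ?_⟩
    · rintro _ ⟨t, ht, rfl⟩
      simp only [Set.mem_compl_iff, Set.mem_insert_iff, Set.mem_singleton_iff, not_or] at ht
      refine ⟨circleParam_sq ht.1, div_ne_zero (fun h => ?_) (by simp)⟩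
      have h2 : t * t = 1 := (eq_mul_inv_iff_mul_eq₀ ht.1).1 (by rw [one_mul]; exact sub_eq_zero.1 h)
      rcases mul_self_eq_one_iff.1 h2 with h | h
      exacts [ht.2.1 h, ht.2.2 h]
    · intro c w h hw
      obtain ⟨s, hs⟩ := exists_sq_eq (w ⬝ᵥ w)
      have hcs : c ^ 2 + s ^ 2 = 1 := by rw [hs, h]
      obtain ⟨h1, h2⟩ := exists_circleParam (c := (c, s)) hcs
      have hs0 : s ≠ 0 := by rintro rfl; exact hw (by rw [← hs]; simp)
      refine ⟨s, _, ?_, h2⟩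
      simp only [Set.mem_compl_iff, Set.mem_insert_iff, Set.mem_singleton_iff, not_or]
      refine ⟨h1, fun h3 => hs0 ?_, fun h3 => hs0 ?_⟩
      · have := congrArg Prod.snd h2
        simp only at this h3
        rw [← this, h3]; simp [circleParam]
      · have := congrArg Prod.snd h2
        simp only at this h3
        rw [← this, h3]; simp [circleParam, inv_neg]
  box := by
    have hfin : ({1, -1} : Set ℂ).Finite := by simp
    refine ⟨{1, -1}ᶜ, hfin.infinite_compl, fun a ha b hb c hc => ⟨?_, ?_⟩⟩
    · obtain ⟨d, hd⟩ := exists_sq_eq (1 - a ^ 2 - b ^ 2 - c ^ 2)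
      exact ⟨d, by rw [hd]; ring⟩
    · intro h
      simp only [Set.mem_compl_iff, Set.mem_insert_iff, Set.mem_singleton_iff, not_or] at ha
      rcases mul_self_eq_one_iff.1 ((sq a).symm.trans (sub_eq_zero.1 h).symm) with h | h
      exacts [ha.1 h, ha.2 h]

theorem hasPositiveSquares_real (E : Type) [NormedAddCommGroup E] [NormedSpace ℝ E] :
    HasPositiveSquares ℝ E := by
  rintro L ⟨s, hs, h⟩
  rw [show L.restrictScalars ℝ = L from rfl, h]
  positivity

/-- The real determinant of a complex linear map is the squared modulus of its complex determinant.
-/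
theorem hasPositiveSquares_complex (E : Type) [NormedAddCommGroup E] [NormedSpace ℂ E]
    [NormedSpace ℝ E] [IsScalarTower ℝ ℂ E] : HasPositiveSquares ℂ E := by
  rintro L ⟨s, hs, h⟩
  have h1 : (L.restrictScalars ℝ).det = Algebra.norm ℝ L.det := by
    exact LinearMap.det_restrictScalars
  rw [h1, h, Algebra.norm_complex_apply, Complex.normSq_pos]
  exact pow_ne_zero 2 hs

end SurfaceRep
end

noncomputable section
namespace SurfaceRep

/-! ### `SU₂` and `SL₂(ℂ)` as groups of unit quaternions -/

open Topology

/-- The matrix of the quaternion `a + p`. -/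
def quatMat (a : ℂ) (p : Fin 3 → ℂ) : Matrix (Fin 2) (Fin 2) ℂ :=
  !![a + Complex.I * p 0, p 1 + Complex.I * p 2; -p 1 + Complex.I * p 2, a - Complex.I * p 0]

theorem matrix2_ext {R : Type} {A B : Matrix (Fin 2) (Fin 2) R} (h00 : A 0 0 = B 0 0)
    (h01 : A 0 1 = B 0 1) (h10 : A 1 0 = B 1 0) (h11 : A 1 1 = B 1 1) : A = B := by
  ext a b
  fin_cases a <;> fin_cases b <;> assumption

theorem quatMat_mul (a a' : ℂ) (p p' : Fin 3 → ℂ) :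
    quatMat a p * quatMat a' p' =
      quatMat (a * a' - p ⬝ᵥ p') (a • p' + a' • p + p ⨯₃ p') := by
  apply matrix2_ext <;>
  simp only [quatMat, Matrix.mul_apply, Fin.sum_univ_two, of_apply, cons_val_zero, cons_val_one,
    cons_val', cons_val_fin_one, vec3_dotProduct, cross_apply_zero, cross_apply_one, cross_apply_two,
    Pi.add_apply, Pi.smul_apply, smul_eq_mul] <;>
  grind [Complex.I_sq]

theorem det_quatMat (a : ℂ) (p : Fin 3 → ℂ) : (quatMat a p).det = a ^ 2 + p ⬝ᵥ p := by
  rw [quatMat, det_fin_two_of, vec3_dotProduct]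
  linear_combination (-(p 0) ^ 2 - p 2 ^ 2) * Complex.I_sq

/-- The real part of the quaternion of a matrix. -/
def quatRe (w : Matrix (Fin 2) (Fin 2) ℂ) : ℂ := (w 0 0 + w 1 1) / 2

/-- The imaginary part of the quaternion of a matrix. -/
def quatIm (w : Matrix (Fin 2) (Fin 2) ℂ) : Fin 3 → ℂ :=
  ![(w 0 0 - w 1 1) / (2 * Complex.I), (w 0 1 - w 1 0) / 2, (w 0 1 + w 1 0) / (2 * Complex.I)]

theorem quatRe_quatMat (a : ℂ) (p : Fin 3 → ℂ) : quatRe (quatMat a p) = a := by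
  simp [quatRe, quatMat]

theorem quatIm_quatMat (a : ℂ) (p : Fin 3 → ℂ) : quatIm (quatMat a p) = p := by
  have hI := Complex.I_ne_zero
  apply vec3_ext <;> simp [quatIm, quatMat] <;> field_simp <;> ring

theorem quatMat_quatRe_quatIm (w : Matrix (Fin 2) (Fin 2) ℂ) : quatMat (quatRe w) (quatIm w) = w := by
  have hI := Complex.I_ne_zero
  apply matrix2_ext <;> simp [quatRe, quatIm, quatMat] <;> field_simp <;> ring

theorem continuous_quatMat : Continuous fun q : ℂ × (Fin 3 → ℂ) => quatMat q.1 q.2 :=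
  continuous_matrix fun a b => by
    fin_cases a <;> fin_cases b <;> simp [quatMat] <;> fun_prop

theorem continuous_quatRe : Continuous quatRe := by unfold quatRe; fun_prop

theorem continuous_quatIm : Continuous quatIm :=
  continuous_pi fun b => by fin_cases b <;> simp [quatIm] <;> fun_prop

theorem isInducing_matSL2 : IsInducing matSL2 := ⟨rfl⟩

theorem isInducing_matSU2 : IsInducing matSU2 := ⟨rfl⟩

theorem matSL2_injective : Function.Injective matSL2 := Subtype.val_injective

theorem matSU2_injective : Function.Injective matSU2 := Subtype.val_injective

/-- The model of `SL₂(ℂ)` by complex unit quaternions. -/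
def quatSL2 : QuatModel ℂ SL2 where
  re x := quatRe (matSL2 x)
  im x := quatIm (matSL2 x)
  re_mul x y := by
    rw [map_mul, ← quatMat_quatRe_quatIm (matSL2 x), ← quatMat_quatRe_quatIm (matSL2 y), quatMat_mul]
    simp only [quatRe_quatMat, quatIm_quatMat]
  im_mul x y := by
    rw [map_mul, ← quatMat_quatRe_quatIm (matSL2 x), ← quatMat_quatRe_quatIm (matSL2 y), quatMat_mul]
    simp only [quatRe_quatMat, quatIm_quatMat]
  norm_eq x := by rw [← det_quatMat, quatMat_quatRe_quatIm]; exact x.2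
  exists_eq a p h := ⟨⟨quatMat a p, by rw [det_quatMat, h]⟩, quatRe_quatMat a p, quatIm_quatMat a p⟩
  ext x y h1 h2 := matSL2_injective (by
    rw [← quatMat_quatRe_quatIm (matSL2 x), h1, h2, quatMat_quatRe_quatIm])
  isInducing := by
    refine IsInducing.of_comp (g := fun q => quatMat q.1 q.2) ?_ continuous_quatMat ?_
    · exact (continuous_quatRe.comp isInducing_matSL2.continuous).prodMk
        (continuous_quatIm.comp isInducing_matSL2.continuous)
    · simp only [Function.comp_def, quatMat_quatRe_quatIm]
      exact isInducing_matSL2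

theorem matSL2_eq (x : SL2) : matSL2 x = quatMat (quatSL2.re x) (quatSL2.im x) :=
  (quatMat_quatRe_quatIm _).symm

/-- The matrix of a real quaternion. -/
def realQuatMat (a : ℝ) (p : Fin 3 → ℝ) : Matrix (Fin 2) (Fin 2) ℂ := quatMat a fun b => p b

/-- The real part of the real quaternion of a matrix. -/
def realRe (w : Matrix (Fin 2) (Fin 2) ℂ) : ℝ := (w 0 0).re

/-- The imaginary part of the real quaternion of a matrix. -/
def realIm (w : Matrix (Fin 2) (Fin 2) ℂ) : Fin 3 → ℝ := ![(w 0 0).im, (w 0 1).re, (w 0 1).im]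

theorem realRe_realQuatMat (a : ℝ) (p : Fin 3 → ℝ) : realRe (realQuatMat a p) = a := by
  simp [realRe, realQuatMat, quatMat]

theorem realIm_realQuatMat (a : ℝ) (p : Fin 3 → ℝ) : realIm (realQuatMat a p) = p := by
  apply vec3_ext <;> simp [realIm, realQuatMat, quatMat]

theorem realQuatMat_mul (a a' : ℝ) (p p' : Fin 3 → ℝ) :
    realQuatMat a p * realQuatMat a' p' =
      realQuatMat (a * a' - p ⬝ᵥ p') (a • p' + a' • p + p ⨯₃ p') := by
  rw [realQuatMat, realQuatMat, quatMat_mul, realQuatMat]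
  congr 1
  · simp [vec3_dotProduct]
  · apply vec3_ext <;> simp [cross_apply]

theorem det_realQuatMat (a : ℝ) (p : Fin 3 → ℝ) :
    (realQuatMat a p).det = ((a ^ 2 + p ⬝ᵥ p : ℝ) : ℂ) := by
  rw [realQuatMat, det_quatMat]
  simp [vec3_dotProduct]

theorem realQuatMat_mem {a : ℝ} {p : Fin 3 → ℝ} (h : a ^ 2 + p ⬝ᵥ p = 1) :
    realQuatMat a p ∈ Matrix.specialUnitaryGroup (Fin 2) ℂ := by
  rw [mem_specialUnitaryGroup_iff, det_realQuatMat, h, mem_unitaryGroup_iff]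
  refine ⟨?_, by simp⟩
  have hs : star (realQuatMat a p) = realQuatMat a (-p) := by
    apply matrix2_ext <;> simp [realQuatMat, quatMat, star_apply, Complex.ext_iff]
  rw [hs, realQuatMat_mul]
  apply matrix2_ext <;>
    simp [realQuatMat, quatMat, dotProduct_neg, ← sq, h]

/-- For a unitary matrix of determinant 1 the adjoint and the adjugate are both the inverse;
equating their entries gives the quaternionic shape. -/
theorem matSU2_eq_realQuatMat (x : SU2) :
    matSU2 x = realQuatMat (realRe (matSU2 x)) (realIm (matSU2 x)) := by
  have h1 := mem_specialUnitaryGroup_iff.1 x.2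
  have h2 : star x.1 = x.1.adjugate := by
    have h3 : x.1 * x.1.adjugate = 1 := by rw [mul_adjugate, h1.2, one_smul]
    exact left_inv_eq_right_inv (mem_unitaryGroup_iff'.1 h1.1) h3
  rw [adjugate_fin_two] at h2
  have h00 : (starRingEnd ℂ) (x.1 0 0) = x.1 1 1 := congrFun (congrFun h2 0) 0
  have h10 : (starRingEnd ℂ) (x.1 0 1) = -x.1 1 0 := congrFun (congrFun h2 1) 0
  have h10' : x.1 1 0 = -(starRingEnd ℂ) (x.1 0 1) := by rw [h10, neg_neg]
  apply matrix2_ext <;> simp only [realQuatMat, quatMat, realRe, realIm, matSU2, Subgroup.subtype_apply, Submonoid.subtype_apply, ← h00, h10'] <;>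
    simp [Complex.ext_iff]

theorem continuous_realQuatMat : Continuous fun q : ℝ × (Fin 3 → ℝ) => realQuatMat q.1 q.2 :=
  continuous_quatMat.comp (f := fun q : ℝ × (Fin 3 → ℝ) => ((q.1 : ℂ), fun b => (q.2 b : ℂ)))
    (by fun_prop)

theorem continuous_realRe : Continuous realRe := by unfold realRe; fun_prop

theorem continuous_realIm : Continuous realIm :=
  continuous_pi fun b => by fin_cases b <;> simp [realIm] <;> fun_prop

/-- The model of `SU₂` by real unit quaternions. -/
def quatSU2 : QuatModel ℝ SU2 where
  re x := realRe (matSU2 x)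
  im x := realIm (matSU2 x)
  re_mul x y := by
    rw [map_mul, matSU2_eq_realQuatMat x, matSU2_eq_realQuatMat y, realQuatMat_mul]
    simp only [realRe_realQuatMat, realIm_realQuatMat]
  im_mul x y := by
    rw [map_mul, matSU2_eq_realQuatMat x, matSU2_eq_realQuatMat y, realQuatMat_mul]
    simp only [realRe_realQuatMat, realIm_realQuatMat]
  norm_eq x := by
    have h := det_realQuatMat (realRe (matSU2 x)) (realIm (matSU2 x))
    rw [← matSU2_eq_realQuatMat, show (matSU2 x).det = 1 from (mem_specialUnitaryGroup_iff.1 x.2).2] at h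
    exact_mod_cast h.symm
  exists_eq a p h := ⟨⟨_, realQuatMat_mem h⟩, realRe_realQuatMat a p, realIm_realQuatMat a p⟩
  ext x y h1 h2 := matSU2_injective (by
    rw [matSU2_eq_realQuatMat x, h1, h2, ← matSU2_eq_realQuatMat])
  isInducing := by
    refine IsInducing.of_comp (g := fun q => realQuatMat q.1 q.2) ?_ continuous_realQuatMat ?_
    · exact (continuous_realRe.comp isInducing_matSU2.continuous).prodMk
        (continuous_realIm.comp isInducing_matSU2.continuous)
    · simp only [Function.comp_def, ← matSU2_eq_realQuatMat]
      exact isInducing_matSU2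

theorem matSU2_eq (x : SU2) : matSU2 x = realQuatMat (quatSU2.re x) (quatSU2.im x) :=
  matSU2_eq_realQuatMat x

end SurfaceRep
end

noncomputable section
namespace SurfaceRep

/-! ### Polynomial functions on `SU₂` and `SL₂(ℂ)` -/

theorem quatMat_linear (t t' : ℂ) (q q' : ℂ × (Fin 3 → ℂ)) :
    quatMat (t * q.1 + t' * q'.1) (t • q.2 + t' • q'.2) =
      t • quatMat q.1 q.2 + t' • quatMat q'.1 q'.2 := by
  apply matrix2_ext <;> simp [quatMat] <;> ring

/-- The entries of the matrix of a quaternion. -/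
def quatEntries : (ℂ × (Fin 3 → ℂ)) →L[ℂ] (Fin 2 → Fin 2 → ℂ) :=
  LinearMap.toContinuousLinearMap
    { toFun := fun q a b => quatMat q.1 q.2 a b
      map_add' := fun q q' => by
        have h := quatMat_linear 1 1 q q'
        simp only [one_mul, one_smul] at h
        exact h
      map_smul' := fun t q => by
        have h := quatMat_linear t 0 q 0
        simp only [zero_mul, zero_smul, add_zero] at h
        exact h }

/-- The quaternion with given matrix entries. -/
def quatOfEntries : (Fin 2 → Fin 2 → ℂ) →L[ℂ] (ℂ × (Fin 3 → ℂ)) :=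
  LinearMap.toContinuousLinearMap
    { toFun := fun w => (quatRe (of w), quatIm (of w))
      map_add' := fun w w' => by
        refine Prod.ext ?_ (vec3_ext ?_ ?_ ?_) <;> simp [quatRe, quatIm] <;> ring
      map_smul' := fun t w => by
        refine Prod.ext ?_ (vec3_ext ?_ ?_ ?_) <;> simp [quatRe, quatIm] <;> ring }

/-- The entries of the matrix of a real quaternion. -/
def realQuatEntries : (ℝ × (Fin 3 → ℝ)) →L[ℝ] (Fin 2 → Fin 2 → ℂ) :=
  LinearMap.toContinuousLinearMap
    { toFun := fun q a b => realQuatMat q.1 q.2 a b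
      map_add' := fun q q' => by
        have h := quatMat_linear 1 1 ((q.1 : ℂ), fun b => (q.2 b : ℂ)) ((q'.1 : ℂ), fun b => (q'.2 b : ℂ))
        simp only [one_mul, one_smul] at h
        rw [realQuatMat, realQuatMat, realQuatMat, Prod.fst_add, Complex.ofReal_add]
        rw [show (fun b => ((q + q').2 b : ℂ)) = (fun b => (q.2 b : ℂ)) + fun b => (q'.2 b : ℂ) from
          funext fun b => by simp]
        exact h
      map_smul' := fun t q => by
        have h := quatMat_linear t 0 ((q.1 : ℂ), fun b => (q.2 b : ℂ)) 0
        simp only [zero_mul, zero_smul, add_zero] at h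
        rw [realQuatMat, realQuatMat, Prod.smul_fst, smul_eq_mul, Complex.ofReal_mul]
        rw [show (fun b => ((t • q).2 b : ℂ)) = (t : ℂ) • fun b => (q.2 b : ℂ) from
          funext fun b => by simp]
        exact h }

/-- The real quaternion with given matrix entries. -/
def realQuatOfEntries : (Fin 2 → Fin 2 → ℂ) →L[ℝ] (ℝ × (Fin 3 → ℝ)) :=
  LinearMap.toContinuousLinearMap
    { toFun := fun w => (realRe (of w), realIm (of w))
      map_add' := fun w w' => by
        refine Prod.ext ?_ (vec3_ext ?_ ?_ ?_) <;> simp [realRe, realIm]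
      map_smul' := fun t w => by
        refine Prod.ext ?_ (vec3_ext ?_ ?_ ?_) <;> simp [realRe, realIm] }

theorem map_complexPoly {σ X : Type} (φ : X → σ → SL2) :
    (complexPoly σ).map (pullback ℂ fun x s => matSL2 (φ x s)) = quatSL2.coordAlg φ := by
  rw [complexPoly, AlgHom.map_adjoin]
  apply le_antisymm
  · refine Algebra.adjoin_le ?_
    rintro _ ⟨_, ⟨s, a, b, rfl⟩, rfl⟩
    have hr := quatSL2.re_mem_coordAlg φ s
    have hi := quatSL2.im_mem_coordAlg φ s
    have key : ∀ x, matSL2 (φ x s) a b =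
        quatMat (quatSL2.re (φ x s)) (quatSL2.im (φ x s)) a b := fun x => by rw [← matSL2_eq]
    rw [show pullback ℂ (fun x s => matSL2 (φ x s)) (fun w => w s a b) = fun x =>
      quatMat (quatSL2.re (φ x s)) (quatSL2.im (φ x s)) a b from funext key]
    have hI : ∀ b, (fun x => Complex.I * quatSL2.im (φ x s) b) ∈ quatSL2.coordAlg φ := fun b =>
      Subalgebra.smul_mem _ (hi b) Complex.I
    fin_cases a <;> fin_cases b
    exacts [add_mem hr (hI 0), add_mem (hi 1) (hI 2), add_mem (neg_mem (hi 1)) (hI 2),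
      sub_mem hr (hI 0)]
  · refine Algebra.adjoin_le ?_
    set A := Algebra.adjoin ℂ (pullback ℂ (fun (x : X) (s : σ) => matSL2 (φ x s)) ''
      {f | ∃ s a b, f = fun w => w s a b}) with hA
    have hmem : ∀ s a b, (fun x => matSL2 (φ x s) a b) ∈ A := fun s a b =>
      Algebra.subset_adjoin ⟨_, ⟨s, a, b, rfl⟩, rfl⟩
    have hdiv : ∀ (f : X → ℂ) (t : ℂ), f ∈ A → (fun x => f x / t) ∈ A := fun f t hf => by
      simp only [div_eq_inv_mul]
      exact Subalgebra.smul_mem _ hf t⁻¹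
    rintro _ (⟨s, rfl⟩ | ⟨⟨s, b⟩, rfl⟩)
    · exact hdiv _ _ (add_mem (hmem s 0 0) (hmem s 1 1))
    · fin_cases b
      exacts [hdiv _ _ (sub_mem (hmem s 0 0) (hmem s 1 1)),
        hdiv _ _ (sub_mem (hmem s 0 1) (hmem s 1 0)),
        hdiv _ _ (add_mem (hmem s 0 1) (hmem s 1 0))]

theorem map_realPoly {σ X : Type} (φ : X → σ → SU2) :
    (realPoly σ).map (pullback ℝ fun x s => matSU2 (φ x s)) = quatSU2.coordAlg φ := by
  rw [realPoly, AlgHom.map_adjoin]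
  apply le_antisymm
  · refine Algebra.adjoin_le ?_
    have key : ∀ x s, matSU2 (φ x s) =
        realQuatMat (quatSU2.re (φ x s)) (quatSU2.im (φ x s)) := fun x s => matSU2_eq _
    rintro _ ⟨_, ⟨s, a, b, rfl⟩ | ⟨s, a, b, rfl⟩, rfl⟩
    · have hr := quatSU2.re_mem_coordAlg φ s
      have hi := quatSU2.im_mem_coordAlg φ s
      rw [show pullback ℝ (fun x s => matSU2 (φ x s)) (fun w => (w s a b).re) = fun x =>
        (realQuatMat (quatSU2.re (φ x s)) (quatSU2.im (φ x s)) a b).re from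
        funext fun x => by rw [← key]; rfl]
      fin_cases a <;> fin_cases b <;> simp [realQuatMat, quatMat]
      exacts [hr, hi 1, neg_mem (hi 1), hr]
    · have hr := quatSU2.re_mem_coordAlg φ s
      have hi := quatSU2.im_mem_coordAlg φ s
      rw [show pullback ℝ (fun x s => matSU2 (φ x s)) (fun w => (w s a b).im) = fun x =>
        (realQuatMat (quatSU2.re (φ x s)) (quatSU2.im (φ x s)) a b).im from
        funext fun x => by rw [← key]; rfl]
      fin_cases a <;> fin_cases b <;> simp [realQuatMat, quatMat]
      exacts [hi 0, hi 2, hi 2, neg_mem (hi 0)]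
  · refine Algebra.adjoin_le ?_
    rintro _ (⟨s, rfl⟩ | ⟨⟨s, b⟩, rfl⟩)
    · exact Algebra.subset_adjoin ⟨_, Or.inl ⟨s, 0, 0, rfl⟩, rfl⟩
    · fin_cases b
      exacts [Algebra.subset_adjoin ⟨_, Or.inr ⟨s, 0, 0, rfl⟩, rfl⟩,
        Algebra.subset_adjoin ⟨_, Or.inl ⟨s, 0, 1, rfl⟩, rfl⟩,
        Algebra.subset_adjoin ⟨_, Or.inr ⟨s, 0, 1, rfl⟩, rfl⟩]

theorem quatRe_conj {G : Type} [Group G] (j : G →* Matrix (Fin 2) (Fin 2) ℂ) (x : G)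
    (w : Matrix (Fin 2) (Fin 2) ℂ) : quatRe (j x * w * j x⁻¹) = quatRe w := by
  have h := trace_mul_cycle (j x) w (j x⁻¹)
  rw [← map_mul, inv_mul_cancel, map_one, one_mul, trace_fin_two, trace_fin_two] at h
  rw [quatRe, quatRe, h]

theorem isMatrixModel_SL2 : IsMatrixModel quatSL2 matSL2 complexPoly where
  map_eq := map_complexPoly
  entries := by
    refine ⟨quatEntries, quatOfEntries, fun q => Prod.ext (quatRe_quatMat _ _) (quatIm_quatMat _ _),
      fun x a b => ?_⟩
    rw [matSL2_eq]
    rfl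
  trace s := by
    refine ⟨fun w => quatRe (w s), ⟨?_, fun x w => quatRe_conj matSL2 x (w s)⟩, fun x => rfl⟩
    have hmem : ∀ a b, (fun w : _ → Matrix (Fin 2) (Fin 2) ℂ => w s a b) ∈ complexPoly _ :=
      fun a b => Algebra.subset_adjoin ⟨s, a, b, rfl⟩
    have h := Subalgebra.smul_mem _ (add_mem (hmem 0 0) (hmem 1 1)) (2⁻¹ : ℂ)
    convert h using 1
    funext w
    simp [quatRe, div_eq_inv_mul]

theorem isMatrixModel_SU2 : IsMatrixModel quatSU2 matSU2 realPoly where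
  map_eq := map_realPoly
  entries := by
    refine ⟨realQuatEntries, realQuatOfEntries,
      fun q => Prod.ext (realRe_realQuatMat _ _) (realIm_realQuatMat _ _), fun x a b => ?_⟩
    rw [matSU2_eq]
    rfl
  trace s := by
    refine ⟨fun w => (quatRe (w s)).re, ⟨?_, fun x w =>
      congrArg Complex.re (quatRe_conj matSU2 x (w s))⟩,
      fun x => ?_⟩
    · have hmem : ∀ a b, (fun w : _ → Matrix (Fin 2) (Fin 2) ℂ => (w s a b).re) ∈ realPoly _ :=
        fun a b => Algebra.subset_adjoin (Or.inl ⟨s, a, b, rfl⟩)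
      have h := Subalgebra.smul_mem _ (add_mem (hmem 0 0) (hmem 1 1)) (2⁻¹ : ℝ)
      convert h using 1
      funext w
      simp [quatRe, div_eq_inv_mul]
    · simp only
      rw [matSU2_eq, realQuatMat, quatRe_quatMat, Complex.ofReal_re]

end SurfaceRep
end

noncomputable section
namespace SurfaceRep

/-! ### Coaxial homomorphisms -/

open Topology

theorem exp_mul_comm {A B : Matrix (Fin 2) (Fin 2) ℂ} (h : Commute A B) :
    NormedSpace.exp A * NormedSpace.exp B = NormedSpace.exp B * NormedSpace.exp A := by
  rw [← Matrix.exp_add_of_commute _ _ h, ← Matrix.exp_add_of_commute _ _ h.symm, add_comm]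

theorem exp_of_sq_eq_zero {N : Matrix (Fin 2) (Fin 2) ℂ} (h : N * N = 0) :
    NormedSpace.exp N = 1 + N := by
  rw [NormedSpace.exp_eq_tsum ℂ]
  simp only
  rw [tsum_eq_sum (s := Finset.range 2)]
  · simp [Finset.sum_range_succ]
  · intro k hk
    obtain ⟨k, rfl⟩ := Nat.exists_eq_add_of_le (not_lt.1 (Finset.mem_range.not.1 hk))
    rw [pow_add, pow_two, h, zero_mul, smul_zero]

theorem exp_quatMat_e1 (z : ℂ) :
    NormedSpace.exp (z • quatMat 0 ![1, 0, 0]) =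
      quatMat (Complex.cos z) (Complex.sin z • ![1, 0, 0]) := by
  have h1 : z • quatMat 0 ![1, 0, 0] = diagonal ![z * Complex.I, -z * Complex.I] := by
    apply matrix2_ext <;> simp [quatMat]
  rw [h1, Matrix.exp_diagonal]
  apply matrix2_ext <;> simp [quatMat, Pi.exp_def, ← Complex.exp_eq_exp_ℂ, Complex.exp_mul_I,
    Complex.exp_neg]
  · ring
  · refine inv_eq_of_mul_eq_one_right ?_
    linear_combination Complex.cos_sq_add_sin_sq z - Complex.sin z ^ 2 * Complex.I_sq

/-- A rotation takes `e₁` to `u`, and for `e₁` the matrix is diagonal. The exponential is computed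
there and conjugated back. -/
theorem exp_quatMat (z : ℂ) {u : Fin 3 → ℂ} (hu : u ⬝ᵥ u = 1) :
    NormedSpace.exp (z • quatMat 0 u) = quatMat (Complex.cos z) (Complex.sin z • u) := by
  obtain ⟨x, hx⟩ := quatSL2.exists_rot_e1_eq isSpinField_complex hu
  have hconj : ∀ (c s : ℂ) (h : c ^ 2 + s ^ 2 = 1),
      quatMat c (s • u) = matSL2 x * quatMat c (s • ![1, 0, 0]) * (matSL2 x)⁻¹ := by
    intro c s h
    have h1 := matSL2_eq (quatSL2.ofCoords c (s • ![1, 0, 0]) (QuatModel.circle_norm QuatModel.e1_dot h))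
    have h2 := matSL2_eq (x * quatSL2.ofCoords c (s • ![1, 0, 0]) (QuatModel.circle_norm QuatModel.e1_dot h) * x⁻¹)
    rw [QuatModel.re_ofCoords, QuatModel.im_ofCoords] at h1
    rw [QuatModel.re_conj, QuatModel.im_conj, QuatModel.re_ofCoords, QuatModel.im_ofCoords,
      LinearMap.map_smul, hx, map_mul, map_mul, h1] at h2
    rw [← h2, Matrix.inv_eq_right_inv (B := matSL2 x⁻¹) (by rw [← map_mul, mul_inv_cancel, map_one])]
  have hunit : IsUnit (matSL2 x) := (isUnit_iff_isUnit_det _).2 (by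
    rw [show (matSL2 x).det = 1 from x.2]; exact isUnit_one)
  rw [hconj _ _ (Complex.cos_sq_add_sin_sq z), ← exp_quatMat_e1, ← Matrix.exp_conj _ _ hunit]
  congr 1
  have h := hconj 0 1 (by simp)
  rw [one_smul, one_smul] at h
  rw [h, Matrix.mul_smul, Matrix.smul_mul]

theorem trace_quatMat_zero (p : Fin 3 → ℂ) : (quatMat 0 p).trace = 0 := by
  simp [quatMat, trace_fin_two]

theorem exists_cos_sin_complex {a b : ℂ} (h : a ^ 2 + b ^ 2 = 1) :
    ∃ z, Complex.cos z = a ∧ Complex.sin z = b := by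
  obtain ⟨h0, h1⟩ := exists_circleParam (c := (a, b)) h
  obtain ⟨w, hw⟩ : ∃ w, Complex.exp w = a + b * Complex.I := ⟨_, Complex.exp_log h0⟩
  have hz : -Complex.I * w * Complex.I = w := by linear_combination (-w) * Complex.I_sq
  have hz' : -(-Complex.I * w) * Complex.I = -w := by rw [neg_mul, hz]
  simp only [← hw, circleParam, Prod.mk.injEq, ← Complex.exp_neg] at h1
  refine ⟨-Complex.I * w, ?_, ?_⟩
  · rw [Complex.cos, hz, hz', h1.1]
  · rw [Complex.sin, hz, hz', ← h1.2]
    have hI := Complex.I_ne_zero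
    field_simp
    rw [Complex.I_sq]
    ring

variable {g n : ℕ}

/-- One-parameter subgroups are commutative. Conversely, commuting quaternions share a unit axis `u`
and are of the form `cos t + sin t u = exp (t u)`. -/
theorem coaxialSU2_eq : coaxialSU2 g n = abelianLocus g n SU2 := by
  ext ρ
  constructor
  · rintro ⟨X, -, -, h⟩ γ γ'
    apply matSU2_injective
    obtain ⟨t, ht⟩ := h γ
    obtain ⟨t', ht'⟩ := h γ'
    rw [map_mul, map_mul]
    change matSU2 _ * matSU2 _ = matSU2 _ * matSU2 _
    erw [ht, ht']
    exact exp_mul_comm (((Commute.refl X).smul_left t).smul_right t')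
  · intro h
    obtain ⟨l, u, hl⟩ := QuatModel.exists_parallel (v := fun γ => quatSU2.im (toHom ρ γ))
      fun γ γ' => (quatSU2.mul_comm_iff _ _).1 (h γ γ')
    obtain ⟨l, u, hu, hl⟩ : ∃ (l : SurfaceGroup g n → ℝ) (u : Fin 3 → ℝ), u ⬝ᵥ u = 1 ∧
        ∀ γ, quatSU2.im (toHom ρ γ) = l γ • u := by
      by_cases hu : u = 0
      -- If all imaginary parts vanish, any axis will do.
      · exact ⟨0, ![1, 0, 0], QuatModel.e1_dot, fun γ => by rw [congrFun hl γ]; simp [hu]⟩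
      · have hpos : u ⬝ᵥ u ≠ 0 := fun h0 => hu (dotProduct_self_eq_zero.1 h0)
        obtain ⟨s, hs⟩ := isSpinField_real.sqrt 0 u
        rw [zero_pow two_ne_zero, zero_add] at hs
        have hs0 : s ≠ 0 := by rintro rfl; exact hpos (by rw [← hs]; simp)
        refine ⟨fun γ => l γ * s, s⁻¹ • u, ?_, fun γ => ?_⟩
        · rw [smul_dotProduct, dotProduct_smul, ← hs]
          simp only [smul_eq_mul]
          field_simp
        · rw [congrFun hl γ, smul_smul, mul_assoc, mul_inv_cancel₀ hs0, mul_one]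
    refine ⟨realQuatMat 0 u, ?_, ?_, fun γ => ?_⟩
    · apply matrix2_ext <;> simp [realQuatMat, quatMat, Complex.ext_iff]
    · rw [realQuatMat, Complex.ofReal_zero, trace_quatMat_zero]
    · have hn := quatSU2.norm_eq (toHom ρ γ)
      rw [hl, smul_dotProduct, dotProduct_smul, hu] at hn
      have hc : quatSU2.re (toHom ρ γ) ^ 2 + l γ ^ 2 = 1 := by
        simp only [smul_eq_mul] at hn
        linear_combination hn

      obtain ⟨t, ht, ht'⟩ := exists_cos_sin_real hc
      refine ⟨t, (matSU2_eq (toHom ρ γ)).trans ?_⟩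
      have hu' : (fun b => (u b : ℂ)) ⬝ᵥ (fun b => (u b : ℂ)) = 1 := by
        rw [vec3_dotProduct] at hu ⊢
        exact_mod_cast hu
      have he := exp_quatMat (t : ℂ) hu'
      rw [hl, realQuatMat, realQuatMat, Complex.ofReal_zero, ← ht, ← ht', Complex.ofReal_cos]
      refine Eq.trans ?_ (he.symm.trans (congrArg NormedSpace.exp ?_))
      · congr 1
        funext b
        simp
      · ext a b
        simp

/-- Elements that commute modulo central factors commute. In the converse the new case is an
isotropic axis `u`: an element is then `a + l u` with `a² = 1`, and `a (a + l u) = 1 + a l u = exp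
(a l u)` because `u` is nilpotent. The sign `a` is what forces coaxiality to be tested in PSL₂(ℂ).
-/
theorem coaxialSL2_eq : coaxialSL2 g n = abelianLocus g n SL2 := by
  ext ρ
  constructor
  · rintro ⟨X, -, h⟩ γ γ'
    obtain ⟨z, x, hx, hq⟩ := h γ
    obtain ⟨z', x', hx', hq'⟩ := h γ'
    have hxx : x * x' = x' * x := by
      apply matSL2_injective
      rw [map_mul, map_mul, hx, hx']
      exact exp_mul_comm (((Commute.refl X).smul_left z).smul_right z')
    have h1 := Subgroup.mem_center_iff.1 (QuotientGroup.eq.1 hq.symm)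
    have h2 := Subgroup.mem_center_iff.1 (QuotientGroup.eq.1 hq'.symm)
    have e1 : toHom ρ γ = x * (x⁻¹ * toHom ρ γ) := by group
    have e2 : toHom ρ γ' = x' * (x'⁻¹ * toHom ρ γ') := by group
    change ∀ y, y * (x⁻¹ * toHom ρ γ) = (x⁻¹ * toHom ρ γ) * y at h1
    change ∀ y, y * (x'⁻¹ * toHom ρ γ') = (x'⁻¹ * toHom ρ γ') * y at h2
    have c1 : Commute x (x'⁻¹ * toHom ρ γ') := h2 x
    have c2 : Commute (x⁻¹ * toHom ρ γ) (x' * (x'⁻¹ * toHom ρ γ')) := (h1 _).symm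
    have c3 : Commute x x' := hxx
    rw [e1, e2]
    exact (c3.mul_right c1).mul_left c2
  · intro h
    obtain ⟨l, u, hl⟩ := QuatModel.exists_parallel (v := fun γ => quatSL2.im (toHom ρ γ))
      fun γ γ' => (quatSL2.mul_comm_iff _ _).1 (h γ γ')
    by_cases hu : u ⬝ᵥ u = 0
    · refine ⟨quatMat 0 u, trace_quatMat_zero u, fun γ => ?_⟩
      have hl' : quatSL2.im (toHom ρ γ) = l γ • u := congrFun hl γ
      have hn := quatSL2.norm_eq (toHom ρ γ)
      rw [hl', smul_dotProduct, dotProduct_smul, hu, smul_zero, smul_zero, add_zero] at hn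
      set a := quatSL2.re (toHom ρ γ) with ha
      have hn' : (1 : ℂ) ^ 2 + ((a * l γ) • u) ⬝ᵥ ((a * l γ) • u) = 1 := by
        rw [smul_dotProduct, dotProduct_smul, hu]; simp
      refine ⟨a * l γ, quatSL2.ofCoords 1 ((a * l γ) • u) hn', ?_, ?_⟩
      · have h0 : quatMat 0 ((a * l γ) • u) * quatMat 0 ((a * l γ) • u) = 0 := by
          rw [quatMat_mul, cross_self, smul_dotProduct, dotProduct_smul, hu]
          apply matrix2_ext <;> simp [quatMat]
        have h1 : (a * l γ) • quatMat 0 u = quatMat 0 ((a * l γ) • u) := by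
          apply matrix2_ext <;> simp [quatMat] <;> ring
        rw [h1, exp_of_sq_eq_zero h0, matSL2_eq, QuatModel.re_ofCoords, QuatModel.im_ofCoords]
        apply matrix2_ext <;> simp [quatMat]
        ring
      · refine QuotientGroup.eq.2 (quatSL2.mem_center_of_im_eq_zero ?_)
        change quatSL2.im ((toHom ρ γ)⁻¹ * _) = 0
        rw [QuatModel.im_mul, QuatModel.im_inv, QuatModel.re_inv, QuatModel.re_ofCoords,
          QuatModel.im_ofCoords, hl', ← neg_smul, QuatModel.smul_cross_smul, ← ha, smul_smul, ← mul_assoc, ← sq, hn]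
        simp
    · obtain ⟨s, hs⟩ := exists_sq_eq (u ⬝ᵥ u)
      have hs0 : s ≠ 0 := by rintro rfl; exact hu (by rw [← hs]; simp)
      have hu1 : (s⁻¹ • u) ⬝ᵥ (s⁻¹ • u) = 1 := by
        rw [smul_dotProduct, dotProduct_smul, ← hs]
        simp only [smul_eq_mul]
        field_simp
      refine ⟨quatMat 0 (s⁻¹ • u), trace_quatMat_zero _, fun γ => ?_⟩
      have hl' : quatSL2.im (toHom ρ γ) = (l γ * s) • s⁻¹ • u := by
        rw [congrFun hl γ, smul_smul, mul_assoc, mul_inv_cancel₀ hs0, mul_one]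
      have hn := quatSL2.norm_eq (toHom ρ γ)
      rw [hl', smul_dotProduct, dotProduct_smul, hu1] at hn
      have hc : quatSL2.re (toHom ρ γ) ^ 2 + (l γ * s) ^ 2 = 1 := by
        simp only [smul_eq_mul] at hn
        linear_combination hn
      obtain ⟨z, hz, hz'⟩ := exists_cos_sin_complex hc
      refine ⟨z, toHom ρ γ, ?_, rfl⟩
      rw [exp_quatMat z hu1, hz, hz', ← hl', ← matSL2_eq]

end SurfaceRep
end

noncomputable section
namespace SurfaceRep

/-! ### The representation spaces -/

open Topology

variable {g n m : ℕ}

/-- The inner product is definite over ℝ, so a tuple without nondegenerate pairs already commutes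
and no limit is needed. -/
theorem isRepQuotient_SU2 (c : Coordinates g n m SU2) :
    Coordinates.IsRepQuotient quatSU2 c (projSU2 g n) where
  isQuotientMap := isQuotientMap_quotient_mk'
  map_smul x ρ := Quotient.sound ⟨_, rfl⟩
  invMap_eq ρ ρ' h := by
    obtain ⟨y, hy⟩ := Quotient.exact h
    induction y using QuotientGroup.induction_on with
    | H x =>
      rw [← hy]
      change quatSU2.invMap (c.equiv ((x : SU2 ⧸ Subgroup.center SU2) • ρ')) = _
      rw [c.equiv_smul, QuatModel.invMap_conj]
  reducible ρ h := by
    refine ⟨ρ, (c.mem_abelianLocus_iff (Q := quatSU2)).2 fun i k => ?_, rfl⟩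
    simp only [QuatModel.irreducible, Set.mem_ofPred_eq, not_or, not_exists, not_not] at h
    exact dotProduct_self_eq_zero.1 (h.1 i k)

/-- A tuple of vectors without irreducible pairs or triples is orthogonal to an isotropic axis. -/
theorem exists_isotropic {ι : Type} {v : ι → Fin 3 → ℂ}
    (h2 : ∀ i j, (v i ⨯₃ v j) ⬝ᵥ (v i ⨯₃ v j) = 0) (h3 : ∀ i j k, v i ⬝ᵥ (v j ⨯₃ v k) = 0)
    (hne : ∃ i j, v i ⨯₃ v j ≠ 0) : ∃ N, N ≠ 0 ∧ N ⬝ᵥ N = 0 ∧ ∀ i, v i ⬝ᵥ N = 0 := by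
  obtain ⟨i, j, hij⟩ := hne
  exact ⟨_, hij, h2 i j, fun k => h3 k i j⟩

/-- An isotropic vector is an eigenvector of the rotations about some axis. -/
theorem exists_axis {N : Fin 3 → ℂ} (hN : N ≠ 0) (h0 : N ⬝ᵥ N = 0) :
    ∃ u : Fin 3 → ℂ, u ⬝ᵥ u = 1 ∧ u ⬝ᵥ N = 0 ∧ u ⨯₃ N = Complex.I • N := by
  have hr : star N ⬝ᵥ N ≠ 0 := fun h => hN (by
    open scoped ComplexOrder in exact dotProduct_star_self_eq_zero.1 h)
  have h0' : star N ⬝ᵥ star N = 0 := by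
    have := congrArg star h0
    simpa [vec3_dotProduct] using this
  set M := star N with hM
  refine ⟨(-Complex.I / (M ⬝ᵥ N)) • (N ⨯₃ M), ?_, ?_, ?_⟩
  · rw [smul_dotProduct, dotProduct_smul, cross_dot_cross, h0, dotProduct_comm N M]
    simp only [smul_eq_mul]
    field_simp
    linear_combination (-(M ⬝ᵥ N) ^ 2) * Complex.I_sq
  · rw [smul_dotProduct, dotProduct_comm (N ⨯₃ M), dot_self_cross, smul_zero]
  · rw [LinearMap.map_smul₂]
    have h1 : (N ⨯₃ M) ⨯₃ N = -(M ⬝ᵥ N) • N := by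
      rw [cross_cross_eq_smul_sub_smul, h0]; simp
    rw [h1, smul_smul]
    congr 1
    field_simp

/-- The plane orthogonal to the isotropic `N` contains `N` and is spanned by `N` and `u`; the
component `y` is the multiple of `N`. -/
theorem cross_axis {N u : Fin 3 → ℂ} (hN : N ≠ 0) (h0 : N ⬝ᵥ N = 0) (hu : u ⬝ᵥ u = 1)
    (huN : u ⬝ᵥ N = 0) (hc : u ⨯₃ N = Complex.I • N) {v : Fin 3 → ℂ} (hv : v ⬝ᵥ N = 0) :
    ∃ y, v = (u ⬝ᵥ v) • u + y ∧ u ⨯₃ y = Complex.I • y ∧ v ⬝ᵥ v = (u ⬝ᵥ v) ^ 2 := by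
  have h1 : N ⨯₃ (v - (u ⬝ᵥ v) • u) = 0 := by
    have h2 : (v - (u ⬝ᵥ v) • u) ⨯₃ (u ⨯₃ N) = 0 := by
      rw [cross_cross_eq_smul_sub_smul', dotProduct_sub, sub_dotProduct, dotProduct_smul,
        smul_dotProduct, hu, huN, hv]
      simp
    rw [hc, LinearMap.map_smul, smul_eq_zero, ← cross_anticomm, neg_eq_zero] at h2
    exact h2.resolve_left Complex.I_ne_zero
  have h3 : ¬ LinearIndependent ℂ ![N, v - (u ⬝ᵥ v) • u] := fun h =>
    crossProduct_ne_zero_iff_linearIndependent.2 h h1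
  rw [LinearIndependent.pair_iff' hN] at h3
  push Not at h3
  obtain ⟨a, ha⟩ := h3
  have hv' : v = (u ⬝ᵥ v) • u + a • N := by rw [ha]; abel
  refine ⟨a • N, hv', by rw [LinearMap.map_smul, hc, smul_comm], ?_⟩
  generalize u ⬝ᵥ v = b at hv'
  rw [hv']
  simp only [add_dotProduct, dotProduct_add, smul_dotProduct, dotProduct_smul, hu, huN, h0,
    dotProduct_comm N u, smul_eq_mul]
  ring

/-- The operator `u × ·` is multiplication by `i` on `y`, so the rotation with quaternion `cos + sin
u` multiplies `y` by `(cos + i sin)² = t²`, while it fixes `u`. -/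
theorem rot_circleParam {t : ℂ} (ht : t ≠ 0) {u v y : Fin 3 → ℂ} (hu : u ⬝ᵥ u = 1)
    (hv : v = (u ⬝ᵥ v) • u + y) (hy : u ⨯₃ y = Complex.I • y) :
    rot (circleParam t).1 ((circleParam t).2 • u) v = (u ⬝ᵥ v) • u + t ^ 2 • y := by
  have h1 := circleParam_sq ht
  have h2 : (circleParam t).1 + Complex.I * (circleParam t).2 = t := by
    have hI := Complex.I_ne_zero
    simp only [circleParam]
    field_simp
    ring
  have hc : u ⨯₃ v = Complex.I • y := by
    rw [hv, map_add, map_smul, cross_self, smul_zero, zero_add, hy]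
  rw [rot_apply, LinearMap.map_smul₂, hc, smul_dotProduct, smul_dotProduct, dotProduct_smul, hu]
  generalize u ⬝ᵥ v = b at hv
  rw [hv, show t ^ 2 = ((circleParam t).1 + Complex.I * (circleParam t).2) ^ 2 by rw [h2]]
  generalize circleParam t = q at h1
  apply vec3_ext <;> simp only [Pi.add_apply, Pi.smul_apply, smul_eq_mul] <;>
    grind [Complex.I_sq]

/-- A reducible tuple can be deformed by conjugation to a commuting one. -/
theorem exists_tendsto_commuting {z : Fin m → SL2} (hz : z ∉ quatSL2.irreducible m) :
    ∃ z₀ ∈ quatSL2.commuting m, ∃ γ : ℂ → SL2,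
      Filter.Tendsto (fun t k => γ t * z k * (γ t)⁻¹) (𝓝[≠] 0) (𝓝 z₀) := by
  by_cases hcomm : z ∈ quatSL2.commuting m
  · exact ⟨z, hcomm, 1, by simpa using tendsto_const_nhds⟩
  simp only [QuatModel.irreducible, Set.mem_ofPred_eq, not_or, not_exists, not_not] at hz
  simp only [QuatModel.commuting, Set.mem_ofPred_eq, not_forall] at hcomm
  obtain ⟨N, hN, hN0, hNz⟩ := exists_isotropic hz.1 hz.2 hcomm
  obtain ⟨u, hu, huN, hc⟩ := exists_axis hN hN0
  choose y hv hy hn using fun k => cross_axis hN hN0 hu huN hc (hNz k)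
  have hnorm : ∀ k, quatSL2.re (z k) ^ 2 +
      ((u ⬝ᵥ quatSL2.im (z k)) • u) ⬝ᵥ ((u ⬝ᵥ quatSL2.im (z k)) • u) = 1 := fun k => by
    rw [← quatSL2.norm_eq (z k), hn, smul_dotProduct, dotProduct_smul, hu]
    simp [sq]
  classical
  refine ⟨fun k => quatSL2.ofCoords _ _ (hnorm k), fun i j => by
      rw [QuatModel.im_ofCoords, QuatModel.im_ofCoords, QuatModel.smul_cross_smul],
    fun t => if ht : t ≠ 0 then quatSL2.ofCoords (circleParam t).1 ((circleParam t).2 • u)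
      (QuatModel.circle_norm hu (circleParam_sq ht)) else 1, ?_⟩
  refine tendsto_pi_nhds.2 fun k => ?_
  rw [quatSL2.isInducing.tendsto_nhds_iff, QuatModel.re_ofCoords, QuatModel.im_ofCoords]
  have hlim : Filter.Tendsto (fun t : ℂ => (quatSL2.re (z k), (u ⬝ᵥ quatSL2.im (z k)) • u + t ^ 2 • y k))
      (𝓝[≠] 0) (𝓝 (quatSL2.re (z k), (u ⬝ᵥ quatSL2.im (z k)) • u)) := by
    refine Filter.Tendsto.mono_left ?_ nhdsWithin_le_nhds
    have h : Continuous fun t : ℂ => (quatSL2.re (z k), (u ⬝ᵥ quatSL2.im (z k)) • u + t ^ 2 • y k) := by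
      fun_prop
    simpa using h.tendsto 0
  refine hlim.congr' ?_
  filter_upwards [self_mem_nhdsWithin] with t ht
  have ht : t ≠ 0 := ht
  simp only [Function.comp_apply, dif_pos ht, QuatModel.re_conj, QuatModel.im_conj,
    QuatModel.re_ofCoords, QuatModel.im_ofCoords, rot_circleParam ht hu (hv k) (hy k)]

theorem isQuotientMap_projSL2 : IsQuotientMap (projSL2 g n) :=
  (isQuotientMap_quotient_mk' (s := t2Setoid _)).comp isQuotientMap_quotient_mk'

/-- The invariants are continuous with values in a Hausdorff space, so they factor through the
largest Hausdorff quotient. The orbit of a reducible tuple accumulates at a commuting one, and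
uniqueness of limits identifies their images. -/
theorem isRepQuotient_SL2 (c : Coordinates g n m SL2) :
    Coordinates.IsRepQuotient quatSL2 c (projSL2 g n) where
  isQuotientMap := isQuotientMap_projSL2
  map_smul x ρ := congrArg T2Quotient.mk (Quotient.sound ⟨_, rfl⟩)
  invMap_eq ρ ρ' h := by
    have hc : Continuous (Quotient.lift (fun ρ => quatSL2.invMap (c.equiv ρ)) (by
        rintro ρ ρ' ⟨y, hy⟩
        induction y using QuotientGroup.induction_on with
        | H x =>
          rw [← hy]
          change quatSL2.invMap (c.equiv ((x : SL2 ⧸ Subgroup.center SL2) • ρ')) = _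
          rw [c.equiv_smul, QuatModel.invMap_conj]) : OrbitSpace g n SL2 → _) :=
      Continuous.quotient_lift (quatSL2.continuous_invMap.comp c.equiv.continuous) _
    exact congrArg (T2Quotient.lift hc) h
  reducible ρ h := by
    obtain ⟨z₀, hz₀, γ, hγ⟩ := exists_tendsto_commuting h
    refine ⟨c.equiv.symm z₀, (c.mem_abelianLocus_iff (Q := quatSL2)).2 (by simpa using hz₀), ?_⟩
    have hcont : Continuous (projSL2 g n) :=
      isQuotientMap_projSL2.continuous
    have h1 := ((hcont.comp c.equiv.symm.continuous).tendsto z₀).comp hγ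
    have h2 : ∀ t, projSL2 g n (c.equiv.symm fun k => γ t * c.equiv ρ k * (γ t)⁻¹) = projSL2 g n ρ :=
      fun t => by
        rw [c.equiv_symm_conj, Homeomorph.symm_apply_apply]
        exact congrArg T2Quotient.mk (Quotient.sound ⟨_, rfl⟩)
    simp only [Function.comp_def, h2] at h1
    exact tendsto_nhds_unique h1 tendsto_const_nhds

end SurfaceRep
end

/-! ### Assembly of the assertions for both groups -/

noncomputable section
namespace SurfaceRep

/-- The common form of the assertions for the two groups. -/
theorem Coordinates.main {K G : Type} [RCLike K] [NormedSpace K ℂ] [Group G] [TopologicalSpace G]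
    {Q : QuatModel K G} {g n m : ℕ} (c : Coordinates g n (m + 2) G) (hm : 2 * g + n - 1 = m + 2)
    {j : G →* Matrix (Fin 2) (Fin 2) ℂ}
    {P : ∀ σ : Type, Subalgebra K ((σ → Matrix (Fin 2) (Fin 2) ℂ) → K)}
    (hP : IsMatrixModel Q j P) (hK : IsSpinField K)
    {W : Mixing K (m + 2) → ℤˣ → Set (Fin (m + 2) → Fin 3 → K)} (hW : OrientingSets K m W)
    [NormedSpace ℝ (EuclideanSpace K (Fin (6 * g + 3 * n - 3)))]
    [IsScalarTower ℝ K (EuclideanSpace K (Fin (6 * g + 3 * n - 3)))]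
    (hE : HasPositiveSquares K (EuclideanSpace K (Fin (6 * g + 3 * n - 3))))
    [NormedSpace ℝ (EuclideanSpace K (Fin (6 * g + 3 * n - 6)))]
    [IsScalarTower ℝ K (EuclideanSpace K (Fin (6 * g + 3 * n - 6)))]
    (hF : HasPositiveSquares K (EuclideanSpace K (Fin (6 * g + 3 * n - 6))))
    {R : Type} [TopologicalSpace R] {π : HomSpace g n G → R} (h : c.IsRepQuotient Q π)
    {C : Set (HomSpace g n G)} (hC : C = abelianLocus g n G) :
    (∀ ρ ∈ Cᶜ, MulAction.stabilizer (G ⧸ Subgroup.center G) ρ = ⊥) ∧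
      (∃ e : HomSpace g n G ≃ₜ (Fin (2 * g + n - 1) → G), ∀ f : (Fin (2 * g + n - 1) → G) → K,
        f ∈ regPow j (P (Fin (2 * g + n - 1))) ↔ f ∘ e ∈ regHom j (P (Gen g n))) ∧
      IsZariskiIrreducible (regHom j (P (Gen g n))) C ∧
      algDim (regHom j (P (Gen g n))) C = ((2 * g + n + 1 : ℕ) : WithBot ℕ∞) ∧
      IsOrientedSubmanifold K j (6 * g + 3 * n - 3) Cᶜ ∧
      IsZariskiIrreducible (regRep j (P (Gen g n)) π) (π '' C) ∧
      algDim (regRep j (P (Gen g n)) π) (π '' C) = ((2 * g + n - 1 : ℕ) : WithBot ℕ∞) ∧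
      IsOrientedQuotientManifold K j (6 * g + 3 * n - 3) (6 * g + 3 * n - 6) π (π '' C)ᶜ ∧
      IsConnected C ∧ Dense Cᶜ ∧ IsConnected Cᶜ ∧
      IsConnected (π '' C) ∧ Dense (π '' C)ᶜ ∧ IsConnected (π '' C)ᶜ := by
  subst hC
  have hD : 3 * (m + 2) = 6 * g + 3 * n - 3 := by omega
  have hd : 3 * (m + 1) = 6 * g + 3 * n - 6 := by omega
  refine ⟨fun ρ hρ => c.stabilizer_eq_bot Q hρ, ?_, c.isZariskiIrreducible_abelianLocus hP, ?_,
    c.isOrientedSubmanifold hP hK hE hD (c.isOpen_abelianLocus_compl Q)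
      (c.isConnected_abelianLocus_compl Q hK).nonempty,
    IsRepQuotient.isZariskiIrreducible_image c hP, ?_,
    h.isOrientedQuotientManifold hP hK hW hE hF hD hd, c.isConnected_abelianLocus Q hK,
    c.dense_abelianLocus_compl Q hK, c.isConnected_abelianLocus_compl Q hK,
    h.isConnected_image hK, h.dense_compl hK, h.isConnected_compl hK⟩
  · rw [hm]
    exact ⟨c.equiv, c.mem_regPow_iff hP⟩
  -- There are `m + 2 = (m + 1) + 1` coordinates, so the dimension lemma is used with `m + 1` in
  -- place of `m`.
  · rw [show 2 * g + n + 1 = (m + 1) + 3 by omega]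
    exact Coordinates.algDim_abelianLocus (m := m + 1) c hP hK
  · rw [hm]
    exact h.algDim_image hP hK

end SurfaceRep
end

open SurfaceRep in
theorem mainTheorem6 (g n : ℕ) (hn : 0 < n) (hχ : 2 < 2 * g + n) :
    -- the case of `SU₂`
    ((∀ ρ ∈ (coaxialSU2 g n)ᶜ, MulAction.stabilizer (SU2 ⧸ Subgroup.center SU2) ρ = ⊥) ∧
      (∃ e : HomSpace g n SU2 ≃ₜ (Fin (2 * g + n - 1) → SU2),
        ∀ f : (Fin (2 * g + n - 1) → SU2) → ℝ,
          f ∈ regPow matSU2 (realPoly (Fin (2 * g + n - 1))) ↔ f ∘ e ∈ regHomSU2 g n) ∧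
      IsZariskiIrreducible (regHomSU2 g n) (coaxialSU2 g n) ∧
      algDim (regHomSU2 g n) (coaxialSU2 g n) = ((2 * g + n + 1 : ℕ) : WithBot ℕ∞) ∧
      IsOrientedSubmanifold ℝ matSU2 (6 * g + 3 * n - 3) (coaxialSU2 g n)ᶜ ∧
      IsZariskiIrreducible (regRepSU2 g n) (repCoaxialSU2 g n) ∧
      algDim (regRepSU2 g n) (repCoaxialSU2 g n) = ((2 * g + n - 1 : ℕ) : WithBot ℕ∞) ∧
      IsOrientedQuotientManifold ℝ matSU2 (6 * g + 3 * n - 3) (6 * g + 3 * n - 6)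
        (projSU2 g n) (repCoaxialSU2 g n)ᶜ ∧
      IsConnected (coaxialSU2 g n) ∧
      Dense (coaxialSU2 g n)ᶜ ∧ IsConnected (coaxialSU2 g n)ᶜ ∧
      IsConnected (repCoaxialSU2 g n) ∧
      Dense (repCoaxialSU2 g n)ᶜ ∧ IsConnected (repCoaxialSU2 g n)ᶜ) ∧
    -- the case of `SL₂(ℂ)`
    ((∀ ρ ∈ (coaxialSL2 g n)ᶜ, MulAction.stabilizer (SL2 ⧸ Subgroup.center SL2) ρ = ⊥) ∧
      (∃ e : HomSpace g n SL2 ≃ₜ (Fin (2 * g + n - 1) → SL2),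
        ∀ f : (Fin (2 * g + n - 1) → SL2) → ℂ,
          f ∈ regPow matSL2 (complexPoly (Fin (2 * g + n - 1))) ↔ f ∘ e ∈ regHomSL2 g n) ∧
      IsZariskiIrreducible (regHomSL2 g n) (coaxialSL2 g n) ∧
      algDim (regHomSL2 g n) (coaxialSL2 g n) = ((2 * g + n + 1 : ℕ) : WithBot ℕ∞) ∧
      IsOrientedSubmanifold ℂ matSL2 (6 * g + 3 * n - 3) (coaxialSL2 g n)ᶜ ∧
      IsZariskiIrreducible (regRepSL2 g n) (repCoaxialSL2 g n) ∧
      algDim (regRepSL2 g n) (repCoaxialSL2 g n) = ((2 * g + n - 1 : ℕ) : WithBot ℕ∞) ∧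
      IsOrientedQuotientManifold ℂ matSL2 (6 * g + 3 * n - 3) (6 * g + 3 * n - 6)
        (projSL2 g n) (repCoaxialSL2 g n)ᶜ ∧
      IsConnected (coaxialSL2 g n) ∧
      Dense (coaxialSL2 g n)ᶜ ∧ IsConnected (coaxialSL2 g n)ᶜ ∧
      IsConnected (repCoaxialSL2 g n) ∧
      Dense (repCoaxialSL2 g n)ᶜ ∧ IsConnected (repCoaxialSL2 g n)ᶜ) := by
  -- The condition on the Euler characteristic says that there are at least two free generators, as
  -- a nondegenerate pair requires.
  obtain ⟨m, hm⟩ : ∃ m, 2 * g + n - 1 = m + 2 := ⟨2 * g + n - 3, by omega⟩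
  have := quatSU2.isTopologicalGroup
  have := quatSL2.isTopologicalGroup
  obtain ⟨c⟩ := nonempty_coordinates (G := SU2) hn hm
  obtain ⟨c'⟩ := nonempty_coordinates (G := SL2) hn hm
  exact ⟨c.main hm isMatrixModel_SU2 isSpinField_real (orientingSets_real (m := m))
      (hasPositiveSquares_real _) (hasPositiveSquares_real _) (isRepQuotient_SU2 c) coaxialSU2_eq,
    c'.main hm isMatrixModel_SL2 isSpinField_complex (orientingSets_complex (m := m))
      (hasPositiveSquares_complex _) (hasPositiveSquares_complex _) (isRepQuotient_SL2 c')
      coaxialSL2_eq⟩
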